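/- Let $0\le m\le N$ and $0\le R\le N$, let $\eta\in\mathbb C\setminus\{0\}$, and let $\xi_1,\dots,\xi_N\in\mathbb C$ satisfy $\xi_a\ne\xi_b$ and $\xi_a\neq\xi_b\pm\eta$ for all $a\ne b$. Let $K=\begin{pmatrix}\mathsf a&\mathsf b\\ \mathsf c&\mathsf d\end{pmatrix}$ be an invertible complex matrix with $\mathsf b\neq0$, let $\mathsf k_1$ be an eigenvalue of $K$, i.e. $\mathsf k_1^2-\mathsf k_1\operatorname{tr}K+\det K=0$, and let $\mathsf k_2=\det K/\mathsf k_1$. *Notation.* On $\mathcal H=(\mathbb C^2)^{\otimes N}$ let $T_0(\lambda)=R_{0N}(\lambda-\xi_N)\cdots R_{01}(\lambda-\xi_1)$ with $R(\lambda)=\lambda\,\mathrm{Id}+\eta P$ on $\mathbb C^2\otimes\mathbb C^2$ ($P$ the permutation), let $T^{(K)}_0(\lambda)=K_0T_0(\lambda)$, and let $A^{(K)}(\lambda)$ be its upper left entry in the auxiliary space $0$. Put $a(\lambda)=\prod_{n=1}^N(\lambda-\xi_n+\eta)$, $d(\lambda)=\prod_{n=1}^N(\lambda-\xi_n)$, $V(x_1,\dots,x_N)=\prod_{i<j}(x_j-x_i)$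 and $\xi_n^{(h)}=\xi_n-h\eta$. For $\mathbf h\in\{0,1\}^N$ put $$\langle\mathbf h|=\bigotimes_{n=1}^N(1,0)_n\ \prod_{n=1}^N\Big(\tfrac{A^{(K)}(\xi_n)}{\mathsf k_1d(\xi_n-\eta)}\Big)^{h_n},\qquad |\mathbf h\rangle=\frac1{\mathsf n}\prod_{n=1}^N\Big(\tfrac{A^{(K)}(\xi_n-\eta)}{\mathsf k_1d(\xi_n-\eta)}\Big)^{1-h_n}\bigotimes_{n=1}^N\tbinom01_n,$$ where $\mathsf n$ is the constant such that $\langle\mathbf h|\mathbf h\rangle=1/V(\xi_1^{(h_1)},\dots,\xi_N^{(h_N)})$ for $\mathbf h=(1,\dots,1)$. For a polynomial $P$ put $$\langle P|=\sum_{\mathbf h}\prod_{n}P(\xi_n^{(h_n)})\,V(\xi_1^{(h_1)},\dots,\xi_N^{(h_N)})\,\langle\mathbf h|,\qquad |P\rangle=\sum_{\mathbf h}\prod_{n}\Big\{\Big(-\frac{\mathsf k_2}{\mathsf k_1}\Big)^{h_n}P(\xi_n^{(h_n)})\Big\}\,V(\xi_1^{(1-h_1)},\dots,\xi_N^{(1-h_N)})\,|\mathbf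 h\rangle .$$ Let $Q_\tau(\lambda)=\prod_{j=1}^R(\lambda-q_j)$ with $q_1,\dots,q_R$ pairwise distinct and different from all $\xi_n$, and let $\tau$ be a polynomial such that $$\tau(\lambda)Q_\tau(\lambda)=\mathsf k_2\,a(\lambda)\,Q_\tau(\lambda-\eta)+\mathsf k_1\,d(\lambda)\,Q_\tau(\lambda+\eta).$$ (Then $\tau(\lambda)$ is an eigenvalue of the twisted transfer matrix $\operatorname{tr}_0T_0^{(K)}(\lambda)$, with eigenstates $\langle Q_\tau|$ and $|Q_\tau\rangle$.) For $\boldsymbol\epsilon\in\{1,2\}^{2m}$ define, whenever $\langle Q_\tau|Q_\tau\rangle\neq0$, $$F_m^{(K)}(\tau,\boldsymbol\epsilon)=\frac{\langle Q_\tau|\prod_{j=1}^mE_j^{\epsilon_{2j-1},\epsilon_{2j}}|Q_\tau\rangle}{\langle Q_\tau|Q_\tau\rangle},$$ where $E_j^{\epsilon,\epsilon'}$ is the elementary matrix with entries $\delta_{i,\epsilon}\delta_{k,\epsilon'}$ acting on site $j$. Let $\alpha^-=\{j\le m:\epsilon_{2j-1}=1\}$, $\alpha^+=\{j\le m:\epsilon_{2j}=2\}$,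 $s=\#\alpha^-$, $s'=\#\alpha^+$, and $q_{R+j}=\xi_j$ for $1\le j\le m$. *Claim.* $$F_m^{(K)}(\tau,\boldsymbol\epsilon)=\frac{\mathsf b^{m-s-s'}}{\prod_{k=1}^m\tau(\xi_k)}\sum_{\substack{\bar\alpha^-\subset\alpha^-\\ \bar\alpha^+\subset\alpha^+}}(-1)^{(m-\#\bar\alpha^-+\#\bar\alpha^+)N}(\mathsf a-\mathsf k_1)^{s-\#\bar\alpha^-}(\mathsf d-\mathsf k_2)^{s'-\#\bar\alpha^+}\sum_{\{a_j,a'_j\}}\prod_{j\in\bar\alpha^-}\frac{\mathsf k_1\,d(q_{a_j})\prod_{k\in\mathbf A_j,\,k\le R+j-1}(q_{a_j}-q_k+\eta)}{\prod_{k\in\mathbf A'_j,\,k\le R+j}(q_{a_j}-q_k)}$$ $$\qquad\times\prod_{j\in\bar\alpha^+}\frac{\mathsf k_2\,a(q_{a'_j})\prod_{k\in\mathbf A'_j,\,k\le R+j-1}(q_k-q_{a'_j}+\eta)}{\prod_{k\in\mathbf A_{j+1},\,k\le R+j}(q_k-q_{a'_j})}\ \frac{\langle\bar Q_{\mathbf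 A_{m+1}}|Q_\tau\rangle}{\langle Q_\tau|Q_\tau\rangle}.$$ The inner sum is over the indices $a_j$ ($j\in\bar\alpha^-$) and $a'_j$ ($j\in\bar\alpha^+$) with $1\le a_j\le R+j$, $a_j\in\mathbf A_j$, $1\le a'_j\le R+j$, $a'_j\in\mathbf A'_j$, where $\mathbf A_j=\{b:1\le b\le R+m,\ b\ne a_k,a'_k\text{ for }k<j\}$ and $\mathbf A'_j=\{b:1\le b\le R+m,\ b\neq a'_k\text{ for }k<j,\ b\neq a_k\text{ for }k\le j\}$. Moreover $\bar Q_{\mathbf A_{m+1}}(\lambda)=\prod_{j\in\mathbf A_{m+1}}(\lambda-q_j)$, which is a polynomial of degree $R+m-\#\bar\alpha^--\#\bar\alpha^+$. -/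

import Mathlib

open Polynomial

noncomputable section

namespace XXX

/-- Basis labels of the quantum space `(ℂ²)^{⊗N}`; the value `0 : Fin 2` is the basis vector `(1,0)`
and `1 : Fin 2` is `(0,1)` at the site.  The same type serves for the tuples `h ∈ {0,1}^N`. -/
abbrev Spins (N : ℕ) : Type := Fin N → Fin 2

/-- Operators on the quantum space, as matrices in the standard tensor basis.  Bras (row vectors)
and kets (column vectors) are functions `Spins N → ℂ`. -/
abbrev Op (N : ℕ) : Type := Matrix (Spins N) (Spins N) ℂ

/-- The rational `R`-matrix `R(l) = l · 1 + η · P` on `ℂ² ⊗ ℂ²`, with `P` the permutation. -/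
def rMatrix (η l : ℂ) : Matrix (Fin 2 × Fin 2) (Fin 2 × Fin 2) ℂ :=
  Matrix.of fun p r =>
    (if p = r then l else 0) + (if p.1 = r.2 ∧ p.2 = r.1 then η else 0)

/-- The `2 × 2` matrix `X` acting on the site `n` of the chain, and as the identity elsewhere. -/
def siteOp {N : ℕ} (n : Fin N) (X : Matrix (Fin 2) (Fin 2) ℂ) : Op N :=
  Matrix.of fun s t => if ∀ k, k ≠ n → s k = t k then X (s n) (t n) else 0

/-- `R_{0n}(l)`, as a `2 × 2` matrix in the auxiliary space `0` with operator entries. -/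
def rSite {N : ℕ} (η : ℂ) (n : Fin N) (l : ℂ) : Matrix (Fin 2) (Fin 2) (Op N) :=
  Matrix.of fun i j => siteOp n (Matrix.of fun k o => rMatrix η l (i, k) (j, o))

/-- The monodromy matrix `T₀(l) = R_{0N}(l - ξ_N) ⋯ R_{01}(l - ξ_1)`. -/
def monodromy {N : ℕ} (η : ℂ) (ξ : Fin N → ℂ) (l : ℂ) : Matrix (Fin 2) (Fin 2) (Op N) :=
  ((List.finRange N).reverse.map fun n => rSite η n (l - ξ n)).prod

/-- The twisted monodromy matrix `T₀^{(K)}(l) = K₀ T₀(l)`. -/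
def twistedMonodromy {N : ℕ} (K : Matrix (Fin 2) (Fin 2) ℂ) (η : ℂ) (ξ : Fin N → ℂ) (l : ℂ) :
    Matrix (Fin 2) (Fin 2) (Op N) :=
  Matrix.of fun i j => ∑ k, K i k • monodromy η ξ l k j

/-- `A^{(K)}(l)`, the upper left entry of the twisted monodromy matrix. -/
def opA {N : ℕ} (K : Matrix (Fin 2) (Fin 2) ℂ) (η : ℂ) (ξ : Fin N → ℂ) (l : ℂ) : Op N :=
  twistedMonodromy K η ξ l 0 0

/-- `a(l) = ∏ₙ (l - ξₙ + η)`. -/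
def aFun {N : ℕ} (η : ℂ) (ξ : Fin N → ℂ) (l : ℂ) : ℂ := ∏ n, (l - ξ n + η)

/-- `d(l) = ∏ₙ (l - ξₙ)`. -/
def dFun {N : ℕ} (ξ : Fin N → ℂ) (l : ℂ) : ℂ := ∏ n, (l - ξ n)

/-- The Vandermonde product `V(x₁, …, x_N) = ∏_{i<j} (x_j - x_i)`. -/
def vand {N : ℕ} (x : Fin N → ℂ) : ℂ := ∏ i, ∏ j ∈ Finset.Ioi i, (x j - x i)

/-- The shifted inhomogeneities `ξₙ^{(hₙ)} = ξₙ - hₙ η`. -/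
def shifted {N : ℕ} (η : ℂ) (ξ : Fin N → ℂ) (h : Spins N) (n : Fin N) : ℂ :=
  ξ n - ((h n : ℕ) : ℂ) * η

/-- The left SoV basis
`⟨h| = ⟨0| ∏ₙ (A^{(K)}(ξₙ) / (k₁ d(ξₙ - η)))^{hₙ}`, with `⟨0| = ⊗ₙ (1,0)ₙ`. -/
def leftSoV {N : ℕ} (K : Matrix (Fin 2) (Fin 2) ℂ) (k₁ η : ℂ) (ξ : Fin N → ℂ) (h : Spins N) :
    Spins N → ℂ :=
  Matrix.vecMul (Pi.single (fun _ => 0) 1)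
    ((List.finRange N).map fun n =>
      ((k₁ * dFun ξ (ξ n - η))⁻¹ • opA K η ξ (ξ n)) ^ (h n : ℕ)).prod

/-- The right SoV basis before normalization,
`∏ₙ (A^{(K)}(ξₙ - η) / (k₁ d(ξₙ - η)))^{1 - hₙ} |0̲⟩`, with `|0̲⟩ = ⊗ₙ (0,1)ₙ`. -/
def rightSoVRaw {N : ℕ} (K : Matrix (Fin 2) (Fin 2) ℂ) (k₁ η : ℂ) (ξ : Fin N → ℂ)
    (h : Spins N) : Spins N → ℂ :=
  Matrix.mulVec
    ((List.finRange N).map fun n =>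
      ((k₁ * dFun ξ (ξ n - η))⁻¹ • opA K η ξ (ξ n - η)) ^ (1 - (h n : ℕ))).prod
    (Pi.single (fun _ => 1) 1)

/-- The normalization coefficient of the right SoV basis: the constant for which
`⟨h|h⟩ = 1 / V(ξ₁^{(h₁)}, …, ξ_N^{(h_N)})` at `h = (1, …, 1)`. -/
def sovNorm {N : ℕ} (K : Matrix (Fin 2) (Fin 2) ℂ) (k₁ η : ℂ) (ξ : Fin N → ℂ) : ℂ :=
  (leftSoV K k₁ η ξ (fun _ => 1) ⬝ᵥ rightSoVRaw K k₁ η ξ (fun _ => 1)) *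
    vand (shifted η ξ (fun _ => 1))

/-- The normalized right SoV basis `|h⟩`. -/
def rightSoV {N : ℕ} (K : Matrix (Fin 2) (Fin 2) ℂ) (k₁ η : ℂ) (ξ : Fin N → ℂ) (h : Spins N) :
    Spins N → ℂ :=
  (sovNorm K k₁ η ξ)⁻¹ • rightSoVRaw K k₁ η ξ h

/-- The left separate state `⟨Q| = ∑_h ∏ₙ Q(ξₙ^{(hₙ)}) V(ξ^{(h)}) ⟨h|`. -/
def leftState {N : ℕ} (K : Matrix (Fin 2) (Fin 2) ℂ) (k₁ η : ℂ) (ξ : Fin N → ℂ) (Q : ℂ[X]) :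
    Spins N → ℂ :=
  ∑ h : Spins N, ((∏ n, Q.eval (shifted η ξ h n)) * vand (shifted η ξ h)) • leftSoV K k₁ η ξ h

/-- The right separate state
`|Q⟩ = ∑_h ∏ₙ {(-k₂/k₁)^{hₙ} Q(ξₙ^{(hₙ)})} V(ξ^{(1-h)}) |h⟩`, with `k₂ = det K / k₁`. -/
def rightState {N : ℕ} (K : Matrix (Fin 2) (Fin 2) ℂ) (k₁ η : ℂ) (ξ : Fin N → ℂ) (Q : ℂ[X]) :
    Spins N → ℂ :=
  ∑ h : Spins N,
    ((∏ n, (-((K.det / k₁) / k₁)) ^ (h n : ℕ) * Q.eval (shifted η ξ h n)) *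
      vand (shifted η ξ (fun n => 1 - h n))) • rightSoV K k₁ η ξ h

/-- The scalar product `⟨P|Q⟩` of a left and a right separate state (no complex conjugation). -/
def scalarProduct {N : ℕ} (K : Matrix (Fin 2) (Fin 2) ℂ) (k₁ η : ℂ) (ξ : Fin N → ℂ)
    (P Q : ℂ[X]) : ℂ :=
  leftState K k₁ η ξ P ⬝ᵥ rightState K k₁ η ξ Q

/-- The entry `ε_{2j-1}` of a `2m`-tuple (`j` counted from `1`).
The values `0, 1 : Fin 2` stand for the indices `1, 2`. -/
def epsOdd {m : ℕ} (ε : Fin (2 * m) → Fin 2) (j : Fin m) : Fin 2 := ε ⟨2 * j, by omega⟩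

/-- The entry `ε_{2j}` of a `2m`-tuple (`j` counted from `1`). -/
def epsEven {m : ℕ} (ε : Fin (2 * m) → Fin 2) (j : Fin m) : Fin 2 := ε ⟨2 * j + 1, by omega⟩

/-- The product of elementary matrices `∏_{j=1}^m E_j^{ε_{2j-1}, ε_{2j}}` on the first `m` sites. -/
def elemProduct {N m : ℕ} (hm : m ≤ N) (ε : Fin (2 * m) → Fin 2) : Op N :=
  (List.ofFn fun j : Fin m =>
    siteOp (Fin.castLE hm j) (Matrix.single (epsOdd ε j) (epsEven ε j) (1 : ℂ))).prod

/-- The elementary block `⟨Q| ∏_j E_j^{ε_{2j-1}, ε_{2j}} |Q⟩ / ⟨Q|Q⟩`. -/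
def elemBlock {N m : ℕ} (hm : m ≤ N) (K : Matrix (Fin 2) (Fin 2) ℂ) (k₁ η : ℂ) (ξ : Fin N → ℂ)
    (Q : ℂ[X]) (ε : Fin (2 * m) → Fin 2) : ℂ :=
  (Matrix.vecMul (leftState K k₁ η ξ Q) (elemProduct hm ε) ⬝ᵥ rightState K k₁ η ξ Q) /
    scalarProduct K k₁ η ξ Q Q

/-- `α⁻ = {j : ε_{2j-1} = 1}`. -/
def alphaMinus {m : ℕ} (ε : Fin (2 * m) → Fin 2) : Finset (Fin m) :=
  Finset.univ.filter fun j => epsOdd ε j = 0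

/-- `α⁺ = {j : ε_{2j} = 2}`. -/
def alphaPlus {m : ℕ} (ε : Fin (2 * m) → Fin 2) : Finset (Fin m) :=
  Finset.univ.filter fun j => epsEven ε j = 1

/-- The polynomial `∏_{b ∈ s} (X - x_b)`. -/
def rootPoly {ι : Type} (x : ι → ℂ) (s : Finset ι) : ℂ[X] := ∏ b ∈ s, (X - C (x b))

/-- The extended family `q_1, …, q_R, q_{R+1} = ξ_1, …, q_{R+m} = ξ_m`. -/
def qExt {N m R : ℕ} (hm : m ≤ N) (ξ : Fin N → ℂ) (q : Fin R → ℂ) : Fin (R + m) → ℂ :=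
  Fin.append q fun j => ξ (Fin.castLE hm j)

/-- The index set `{b : b ≠ a_k, a'_k for k < j}`.  Sites are counted from `0` here, so for `j : Fin m`
with `1`-based position `j + 1` this is `𝐀_{j+1}`; the argument `j + 1` gives the following set, and
the argument `m` gives `𝐀_{m+1}`. -/
def setA {m R : ℕ} {βm βp : Finset (Fin m)} (a : βm → Fin (R + m)) (a' : βp → Fin (R + m))
    (j : ℕ) : Finset (Fin (R + m)) :=
  Finset.univ.filter fun b =>
    (∀ k : βm, ((k : Fin m) : ℕ) < j → b ≠ a k) ∧ (∀ k : βp, ((k : Fin m) : ℕ) < j → b ≠ a' k)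

/-- The index set `{b : b ≠ a'_k for k < j, b ≠ a_k for k ≤ j}`, with the same conventions. -/
def setA' {m R : ℕ} {βm βp : Finset (Fin m)} (a : βm → Fin (R + m)) (a' : βp → Fin (R + m))
    (j : ℕ) : Finset (Fin (R + m)) :=
  Finset.univ.filter fun b =>
    (∀ k : βm, ((k : Fin m) : ℕ) ≤ j → b ≠ a k) ∧ (∀ k : βp, ((k : Fin m) : ℕ) < j → b ≠ a' k)

/-- The allowed choices of indices `a_j` (`j ∈ ᾱ⁻`) and `a'_j` (`j ∈ ᾱ⁺`): in `1`-based counting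
`a_j ≤ R + j`, `a_j ∈ 𝐀_j` and `a'_j ≤ R + j`, `a'_j ∈ 𝐀'_j`. -/
def indexChoices {m : ℕ} (R : ℕ) (βm βp : Finset (Fin m)) :
    Finset ((βm → Fin (R + m)) × (βp → Fin (R + m))) :=
  Finset.univ.filter fun p =>
    (∀ j : βm, (p.1 j : ℕ) ≤ R + ((j : Fin m) : ℕ) ∧ p.1 j ∈ setA p.1 p.2 ((j : Fin m) : ℕ)) ∧
    (∀ j : βp, (p.2 j : ℕ) ≤ R + ((j : Fin m) : ℕ) ∧ p.2 j ∈ setA' p.1 p.2 ((j : Fin m) : ℕ))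

/-- The factor of an index `a_j`, `j ∈ ᾱ⁻`:
`k₁ d(q_{a_j}) ∏_{k ∈ 𝐀_j, k ≤ R+j-1} (q_{a_j} - q_k + η) / ∏_{k ∈ 𝐀'_j, k ≤ R+j} (q_{a_j} - q_k)`
in `1`-based counting.  The argument `x` is the extended family `q_1, …, q_{R+m}`. -/
def factorMinus {N m R : ℕ} (k₁ η : ℂ) (ξ : Fin N → ℂ) (x : Fin (R + m) → ℂ)
    {βm βp : Finset (Fin m)} (a : βm → Fin (R + m)) (a' : βp → Fin (R + m)) (j : βm) : ℂ :=
  k₁ * dFun ξ (x (a j)) *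
      (∏ k ∈ (setA a a' ((j : Fin m) : ℕ)).filter (fun k : Fin (R + m) => (k : ℕ) < R + ((j : Fin m) : ℕ)),
        (x (a j) - x k + η)) /
    ∏ k ∈ (setA' a a' ((j : Fin m) : ℕ)).filter (fun k : Fin (R + m) => (k : ℕ) ≤ R + ((j : Fin m) : ℕ)),
      (x (a j) - x k)

/-- The factor of an index `a'_j`, `j ∈ ᾱ⁺`:
`k₂ a(q_{a'_j}) ∏_{k ∈ 𝐀'_j, k ≤ R+j-1} (q_k - q_{a'_j} + η) / ∏_{k ∈ 𝐀_{j+1}, k ≤ R+j} (q_k - q_{a'_j})`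
in `1`-based counting. -/
def factorPlus {N m R : ℕ} (k₂ η : ℂ) (ξ : Fin N → ℂ) (x : Fin (R + m) → ℂ)
    {βm βp : Finset (Fin m)} (a : βm → Fin (R + m)) (a' : βp → Fin (R + m)) (j : βp) : ℂ :=
  k₂ * aFun η ξ (x (a' j)) *
      (∏ k ∈ (setA' a a' ((j : Fin m) : ℕ)).filter (fun k : Fin (R + m) => (k : ℕ) < R + ((j : Fin m) : ℕ)),
        (x k - x (a' j) + η)) /
    ∏ k ∈ (setA a a' (((j : Fin m) : ℕ) + 1)).filter (fun k : Fin (R + m) => (k : ℕ) ≤ R + ((j : Fin m) : ℕ)),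
      (x k - x (a' j))

end XXX

end

/-! The block is computed by letting the twisted monodromy matrix T act to the left on ⟨Q|. The
inverse problem (`prod_unitOp_mul_transferProd`) states that ∏ E_j^{ε,ε'} times ∏ t(ξ_k), with t the
transfer matrix, is the product of the entries T(ξ_k)_{ε',ε}. The TQ equation makes |Q⟩ an
eigenvector of t (`Generic.transfer_mulVec_rightState`), so on |Q⟩ the transfer matrices become the
numbers τ(ξ_k), which are nonzero by `Generic.eval_xi_ne_zero`. What remains is a purely left action
of entries of T on separate states.

In the left SoV basis B(l) is diagonal with eigenvalue b ∏ (l - ξ_n^{(h_n)}), and at a zero of this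
eigenvalue A and D flip one label. Entries of T are polynomials of degree N in l with known leading
coefficient, so interpolation gives A(l) and D(l) everywhere; the Vandermonde weight of a separate
state turns the flips into a sum over sites (`Generic.bra_vecMul`). The residue identity
`sum_residues` trades this sum for one over roots: the action adjoins the root l and then either
removes nothing, with weight a - k₁ for A and d - k₂ for D, or removes one root. B only adjoins l.

The entry C is reached through the quantum determinant, ⟨P|C(l)B(l+η) = ⟨P|A(l)D(l+η) - qdet(l)⟨P|.
Every surviving term on the right factors through B(l+η), which is invertible for generic l;
cancelling it and letting l tend to ξ_n shows that C(ξ_n) is a removal of A type followed by one of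
D type, divided by b (`Generic.leftState_vecMul_C`). Hence all four entries obey one formula,
`Generic.leftState_vecMul_entry`.

Iterating it over the sites gives a sum over sequences of optional removals
(`Generic.leftState_vecMul_prod`). Sorting these sequences by the steps at which a removal really
occurs produces the subsets ᾱ⁻, ᾱ⁺ and the indices a_j, a'_j (`sum_pathWeight`). -/

noncomputable section

namespace XXX

/-! ### Yang–Baxter relation, quantum determinant and fusion -/

section YangBaxter

variable {A : Type*} [Ring A]

/-- The entries of `W` commute with those of `W'`. -/
def EntriesCommute (W W' : ℂ → Matrix (Fin 2) (Fin 2) A) : Prop :=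
  ∀ (l μ : ℂ) (i j k o : Fin 2), Commute (W l i j) (W' μ k o)

theorem EntriesCommute.mul_left {W₁ W₂ W' : ℂ → Matrix (Fin 2) (Fin 2) A}
    (h₁ : EntriesCommute W₁ W') (h₂ : EntriesCommute W₂ W') :
    EntriesCommute (fun l => W₁ l * W₂ l) W' := by
  intro l μ i j k o
  simp only [Matrix.mul_apply]
  exact Commute.sum_left _ _ _ fun a _ => (h₁ l μ i a k o).mul_left (h₂ l μ a j k o)

theorem EntriesCommute.symm {W W' : ℂ → Matrix (Fin 2) (Fin 2) A} (h : EntriesCommute W W') :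
    EntriesCommute W' W := fun l μ i j k o => (h μ l k o i j).symm

/-- The product of two entries of `W W'`, with the entries of `W` moved to the left. -/
theorem EntriesCommute.mul_apply_mul_apply {W W' : ℂ → Matrix (Fin 2) (Fin 2) A}
    (hc : EntriesCommute W W') (l μ : ℂ) (i j k o : Fin 2) :
    (W l * W' l) i j * (W μ * W' μ) k o =
      ∑ a, ∑ c, W l i a * W μ k c * (W' l a j * W' μ c o) := by
  simp only [Matrix.mul_apply, Finset.sum_mul, Finset.mul_sum]
  rw [Finset.sum_comm]
  refine Finset.sum_congr rfl fun a _ => Finset.sum_congr rfl fun c _ => ?_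
  rw [mul_assoc, ← mul_assoc (W' l a j), ← (hc μ l k c a j).eq]
  simp only [mul_assoc]

/-- The fused product `W₁(l) W₂(l + η)` is antisymmetric in its column indices. -/
def FusionAntisymm (η l : ℂ) (W : ℂ → Matrix (Fin 2) (Fin 2) A) : Prop :=
  ∀ i j k o : Fin 2, W l i j * W (l + η) k o = -(W l i o * W (l + η) k j)

theorem FusionAntisymm.mul_left {η l : ℂ} {W W' : ℂ → Matrix (Fin 2) (Fin 2) A}
    (h' : FusionAntisymm η l W') (hc : EntriesCommute W W') :
    FusionAntisymm η l (fun l => W l * W' l) := by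
  intro i j k o
  have swap := hc.mul_apply_mul_apply
  simp only [swap, ← Finset.sum_neg_distrib, ← mul_neg]
  exact Finset.sum_congr rfl fun a _ => Finset.sum_congr rfl fun c _ => by simp [h' a j c o]

variable [Algebra ℂ A]

/-- The entrywise form of the Yang–Baxter relation
`R₁₂(l - μ) W₁(l) W₂(μ) = W₂(μ) W₁(l) R₁₂(l - μ)`. -/
def RTT (η : ℂ) (W : ℂ → Matrix (Fin 2) (Fin 2) A) : Prop :=
  ∀ (l μ : ℂ) (i j k o : Fin 2),
    (l - μ) • (W l i j * W μ k o) + η • (W l k j * W μ i o) =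
      (l - μ) • (W μ k o * W l i j) + η • (W μ k j * W l i o)

/-- `W` has the scalar quantum determinant `f`. -/
def HasQDet (η : ℂ) (W : ℂ → Matrix (Fin 2) (Fin 2) A) (f : ℂ → ℂ) : Prop :=
  ∀ (l : ℂ) (j o : Fin 2),
    W l 0 j * W (l + η) 1 o - W l 1 j * W (l + η) 0 o =
      (f l * (if j = 0 ∧ o = 1 then 1 else if j = 1 ∧ o = 0 then -1 else 0)) • (1 : A)

/-- Once the W factors are gathered on the left, the relation for W exchanges the spectral
parameters there and the relation for W' then exchanges them on the right. The two steps meet after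
renaming the summation indices. -/
theorem RTT.mul {η : ℂ} {W W' : ℂ → Matrix (Fin 2) (Fin 2) A} (h : RTT η W) (h' : RTT η W')
    (hc : EntriesCommute W W') : RTT η (fun l => W l * W' l) := by
  intro l μ i j k o
  have swap := hc.mul_apply_mul_apply
  have e₁ : ∀ a c, (l - μ) • (W l i a * W μ k c * (W' l a j * W' μ c o)) +
      η • (W l k a * W μ i c * (W' l a j * W' μ c o)) =
      (l - μ) • (W μ k c * W l i a * (W' l a j * W' μ c o)) +
      η • (W μ k a * W l i c * (W' l a j * W' μ c o)) := by
    intro a c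
    have := congrArg (fun z => z * (W' l a j * W' μ c o)) (h l μ i a k c)
    simpa only [add_mul, smul_mul_assoc] using this
  have e₂ : ∀ a c, (l - μ) • (W μ k c * W l i a * (W' l a j * W' μ c o)) +
      η • (W μ k c * W l i a * (W' l c j * W' μ a o)) =
      (l - μ) • (W μ k c * W l i a * (W' μ c o * W' l a j)) +
      η • (W μ k c * W l i a * (W' μ c j * W' l a o)) := by
    intro a c
    have := congrArg (fun z => W μ k c * W l i a * z) (h' l μ a j c o)
    simpa only [mul_add, mul_smul_comm] using this
  simp only [swap]
  have s₁ := Finset.sum_congr rfl fun a (_ : a ∈ Finset.univ) =>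
    Finset.sum_congr rfl fun c (_ : c ∈ Finset.univ) => e₁ a c
  have s₂ := Finset.sum_congr rfl fun a (_ : a ∈ Finset.univ) =>
    Finset.sum_congr rfl fun c (_ : c ∈ Finset.univ) => e₂ a c
  simp only [Finset.sum_add_distrib, ← Finset.smul_sum] at s₁ s₂
  rw [s₁]
  rw [Finset.sum_comm (f := fun a c => W μ k a * W l i c * (W' l a j * W' μ c o)), s₂]
  congr 2
  all_goals rw [Finset.sum_comm]

theorem HasQDet.mul {η : ℂ} {W W' : ℂ → Matrix (Fin 2) (Fin 2) A} {f f' : ℂ → ℂ}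
    (h : HasQDet η W f) (h' : HasQDet η W' f') (hc : EntriesCommute W W') :
    HasQDet η (fun l => W l * W' l) (fun l => f l * f' l) := by
  intro l j o
  have swap := hc.mul_apply_mul_apply
  simp only [swap, ← Finset.sum_sub_distrib, ← sub_mul, h l]
  have := h' l j o
  simp only [Fin.sum_univ_two]
  simp
  rw [← sub_eq_add_neg, ← smul_sub, this, smul_smul]
  split_ifs <;> simp

/-- Antisymmetry of W leaves a single column pair (0, 1), so the product is a fixed operator times
the 2 × 2 minor of W'. That minor is the scalar quantum determinant, which is itself antisymmetric
in the columns. -/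
theorem FusionAntisymm.mul_right {η l : ℂ} {W W' : ℂ → Matrix (Fin 2) (Fin 2) A} {f : ℂ → ℂ}
    (h : FusionAntisymm η l W) (h' : HasQDet η W' f) (hc : EntriesCommute W W') :
    FusionAntisymm η l (fun l => W l * W' l) := by
  intro i j k o
  have swap := hc.mul_apply_mul_apply
  have diag : ∀ a, W l i a * W (l + η) k a = 0 := by
    intro a
    have := h i a k a
    rwa [eq_neg_iff_add_eq_zero, ← two_smul ℂ, smul_eq_zero_iff_right two_ne_zero] at this
  have key : ∀ j o, (W l * W' l) i j * (W (l + η) * W' (l + η)) k o =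
      W l i 0 * W (l + η) k 1 * (W' l 0 j * W' (l + η) 1 o - W' l 1 j * W' (l + η) 0 o) := by
    intro j o
    rw [swap]
    simp only [Fin.sum_univ_two, diag, h i 1 k 0]
    noncomm_ring
  change (W l * W' l) i j * (W (l + η) * W' (l + η)) k o =
    -((W l * W' l) i o * (W (l + η) * W' (l + η)) k j)
  rw [key, key, h', h', ← mul_neg, ← neg_smul]
  congr 2
  fin_cases j <;> fin_cases o <;> simp

end YangBaxter

/-! ### Consequences of the algebra: commutation, exchange relations, inverse problem for one site
-/

section Consequences

variable {A : Type*} [Ring A] [Algebra ℂ A]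

theorem FusionAntisymm.mul_self_eq_zero {η l : ℂ} {W : ℂ → Matrix (Fin 2) (Fin 2) A}
    (h : FusionAntisymm η l W) (i j k : Fin 2) : W l i j * W (l + η) k j = 0 := by
  have := h i j k j
  rwa [eq_neg_iff_add_eq_zero, ← two_smul ℂ, smul_eq_zero_iff_right two_ne_zero] at this

/-- The commutator is annihilated by both l - μ + η and μ - l + η. Their sum is the nonzero constant
2η, so no exceptional pair (l, μ) has to be excluded. -/
theorem RTT.commute {η : ℂ} {W : ℂ → Matrix (Fin 2) (Fin 2) A} (h : RTT η W) (hη : η ≠ 0)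
    (l μ : ℂ) (i j : Fin 2) : Commute (W l i j) (W μ i j) := by
  have h₁ : (l - μ + η) • (W l i j * W μ i j - W μ i j * W l i j) = 0 := by
    rw [smul_sub, add_smul, add_smul, h l μ i j i j, sub_self]
  have h₂ : (μ - l + η) • (W l i j * W μ i j - W μ i j * W l i j) = 0 := by
    rw [smul_sub, add_smul, add_smul, ← h μ l i j i j, sub_self]
  have h₃ : (2 * η) • (W l i j * W μ i j - W μ i j * W l i j) = 0 := by
    have := congrArg₂ (· + ·) h₁ h₂
    simp only [← add_smul, add_zero] at this
    rw [← this]; congr 1; ring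
  rw [smul_eq_zero_iff_right (by simpa using hη), sub_eq_zero] at h₃
  exact h₃

/-- The exchange relation with the entry `W(l)_{00}` moved to the right of `W(μ)_{01}`. -/
theorem RTT.exchange_left {η : ℂ} {W : ℂ → Matrix (Fin 2) (Fin 2) A} (h : RTT η W) (l μ : ℂ) :
    (l - μ) • (W l 0 0 * W μ 0 1) =
      (l - μ - η) • (W μ 0 1 * W l 0 0) + η • (W l 0 1 * W μ 0 0) := by
  have := h μ l 0 1 0 0
  linear_combination (norm := module) this

/-- The exchange relation with the entry `W(μ)_{01}` moved to the right of `W(l)_{00}`. -/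
theorem RTT.exchange_right {η : ℂ} {W : ℂ → Matrix (Fin 2) (Fin 2) A} (h : RTT η W) (l μ : ℂ) :
    (l - μ) • (W μ 0 1 * W l 0 0) =
      (l - μ + η) • (W l 0 0 * W μ 0 1) - η • (W μ 0 0 * W l 0 1) := by
  have := h l μ 0 0 0 1
  linear_combination (norm := module) (-1 : ℂ) • this

theorem HasQDet.a_d_sub_c_b {η : ℂ} {W : ℂ → Matrix (Fin 2) (Fin 2) A} {f : ℂ → ℂ}
    (hq : HasQDet η W f) (l : ℂ) :
    W l 0 0 * W (l + η) 1 1 - W l 1 0 * W (l + η) 0 1 = f l • 1 := by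
  simpa using hq l 0 1

/-- At μ = l + η the coefficient l - μ is -η, so the exchange relation degenerates to an equality of
antisymmetrized products. It converts the quantum determinant into its other orderings. -/
theorem RTT.antisymm {η : ℂ} {W : ℂ → Matrix (Fin 2) (Fin 2) A} (h : RTT η W) (hη : η ≠ 0)
    (l : ℂ) (i j k o : Fin 2) :
    W l i j * W (l + η) k o - W l k j * W (l + η) i o =
      W (l + η) k o * W l i j - W (l + η) k j * W l i o := by
  have := h l (l + η) i j k o
  have h' : η • (W l i j * W (l + η) k o - W l k j * W (l + η) i o) =
      η • (W (l + η) k o * W l i j - W (l + η) k j * W l i o) := by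
    linear_combination (norm := module) (-1 : ℂ) • this
  exact smul_right_injective _ hη h'

theorem HasQDet.d_a_sub_b_c {η : ℂ} {W : ℂ → Matrix (Fin 2) (Fin 2) A} {f : ℂ → ℂ}
    (hq : HasQDet η W f) (l : ℂ) :
    W l 1 1 * W (l + η) 0 0 - W l 0 1 * W (l + η) 1 0 = f l • 1 := by
  have := hq l 1 0
  simp at this
  rw [← neg_sub, this, neg_neg]

theorem HasQDet.a_d_sub_b_c {η : ℂ} {W : ℂ → Matrix (Fin 2) (Fin 2) A} {f : ℂ → ℂ}
    (hq : HasQDet η W f) (h : RTT η W) (hη : η ≠ 0) (l : ℂ) :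
    W (l + η) 0 0 * W l 1 1 - W (l + η) 0 1 * W l 1 0 = f l • 1 := by
  rw [← h.antisymm hη, hq.d_a_sub_b_c]

theorem HasQDet.d_a_sub_c_b {η : ℂ} {W : ℂ → Matrix (Fin 2) (Fin 2) A} {f : ℂ → ℂ}
    (hq : HasQDet η W f) (h : RTT η W) (hη : η ≠ 0) (l : ℂ) :
    W (l + η) 1 1 * W l 0 0 - W (l + η) 1 0 * W l 0 1 = f l • 1 := by
  rw [← h.antisymm hη, hq.a_d_sub_c_b]

variable {η : ℂ} {W L : ℂ → Matrix (Fin 2) (Fin 2) A} {e : Fin 2 → Fin 2 → A} {x : ℂ}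

/-- At the inhomogeneity of a site, inserting an elementary matrix of this site in front of the
trace amounts to selecting an entry of the monodromy matrix. -/
theorem mul_entry_eq_mul_trace (he : ∀ a b c d, e a b * e c d = if b = c then e a d else 0)
    (hL : ∀ l i j, L l i j = (if i = j then (l - x) • (1 : A) else 0) + η • e j i)
    (hc : ∀ l i j a b, Commute (W l i j) (e a b)) (a b : Fin 2) :
    (W x * L x) b a = e a b * (W x * L x).trace := by
  -- At its own inhomogeneity the local factor is η times the permutation, whose entries are the
  -- elementary matrices of the site with transposed indices.
  have hL' : ∀ i j, L x i j = η • e j i := fun i j => by rw [hL]; simp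
  have : ∀ i j p q, e a b * (W x i j * e p q) = W x i j * (if b = p then e a q else 0) := by
    intro i j p q
    rw [← mul_assoc, ← (hc x i j a b).eq, mul_assoc, he]
  simp only [Matrix.trace, Matrix.diag, Matrix.mul_apply, hL', mul_smul_comm, Finset.mul_sum, this]
  symm
  rw [Finset.sum_eq_single b (by intro i _ hi; simp [Ne.symm hi]) (by simp)]
  simp

/-- The trace at the inhomogeneity of a site moves this site through the chain. -/
theorem trace_mul_entry (hW : RTT η W)
    (he : ∀ a b c d, e a b * e c d = if b = c then e a d else 0)
    (hL : ∀ l i j, L l i j = (if i = j then (l - x) • (1 : A) else 0) + η • e j i)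
    (hc : ∀ l i j a b, Commute (W l i j) (e a b)) (l : ℂ) (k o : Fin 2) :
    (W x * L x).trace * (W l * L l) k o = (L l * W l) k o * (W x * L x).trace := by
  have hL' : ∀ i j, L x i j = η • e j i := fun i j => by rw [hL]; simp
  have ht : (W x * L x).trace = η • ∑ i, ∑ j, W x i j * e i j := by
    simp only [Matrix.trace, Matrix.diag, Matrix.mul_apply, hL', mul_smul_comm, Finset.smul_sum]
  have h₁ : (∑ i, ∑ j, W x i j * e i j) * (W l * L l) k o =
      ∑ i, ∑ j, ((l - x) • (W x i j * W l k o) + η • (W x i o * W l k j)) * e i j := by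
    have t₁ : ∀ i j p, W x i j * e i j * (W l k p * L l p o) =
        (if p = o then (l - x) • (W x i j * W l k o * e i j) else 0) +
        if j = o then η • (W x i o * W l k p * e i p) else 0 := by
      intro i j p
      rw [mul_assoc, ← mul_assoc (e i j), ← (hc l k p i j).eq, hL]
      simp only [mul_add, mul_assoc, mul_smul_comm, he]
      congr 1
      · split_ifs with h
        · subst h; simp
        · simp
      · split_ifs with h
        · subst h; simp
        · simp
    rw [Matrix.mul_apply, Finset.sum_mul]
    refine Finset.sum_congr rfl fun i _ => ?_
    rw [Finset.sum_mul]
    simp only [Finset.mul_sum, t₁, Finset.sum_add_distrib, add_mul, smul_mul_assoc]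
    congr 1
    · simp
    · rw [Finset.sum_comm]
      simp
  have h₂ : (L l * W l) k o * (∑ i, ∑ j, W x i j * e i j) =
      ∑ i, ∑ j, ((l - x) • (W l k o * W x i j) + η • (W l i o * W x k j)) * e i j := by
    have t₁ : ∀ i j p, L l k p * W l p o * (W x i j * e i j) =
        (if k = p then (l - x) • (W l k o * W x i j * e i j) else 0) +
        if k = i then η • (W l p o * W x k j * e p j) else 0 := by
      intro i j p
      have : e p k * (W l p o * (W x i j * e i j)) =
          W l p o * (W x i j * (if k = i then e p j else 0)) := by
        rw [← mul_assoc, ← (hc l p o p k).eq, mul_assoc, ← mul_assoc (e p k),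
          ← (hc x i j p k).eq, mul_assoc, he]
      rw [hL]
      simp only [add_mul, mul_assoc, smul_mul_assoc, this]
      congr 1
      · split_ifs with h
        · subst h; simp
        · simp
      · split_ifs with h
        · subst h; simp
        · simp
    rw [Matrix.mul_apply, Finset.sum_mul]
    simp only [Finset.mul_sum, t₁, Finset.sum_add_distrib, add_mul, smul_mul_assoc]
    congr 1
    · rw [Finset.sum_eq_single k (by intro i _ hi; simp [Ne.symm hi]) (by simp)]
      simp
    · refine Finset.sum_congr rfl fun p _ => ?_
      rw [Finset.sum_eq_single k (by intro i _ hi; simp [Ne.symm hi]) (by simp)]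
      simp
  rw [ht, smul_mul_assoc, mul_smul_comm, h₁, h₂]
  congr 1
  refine Finset.sum_congr rfl fun i _ => Finset.sum_congr rfl fun j _ => ?_
  congr 1
  have := hW l x k o i j
  linear_combination (norm := module) (-1 : ℂ) • this

end Consequences

/-! ### Operators on one site and the local R-matrix -/

section SiteOperators

variable {N : ℕ}

theorem siteOp_mulVec (n : Fin N) (X : Matrix (Fin 2) (Fin 2) ℂ) (v : Spins N → ℂ) (s : Spins N) :
    (siteOp n X).mulVec v s = ∑ k, X (s n) k * v (Function.update s n k) := by
  have hinj : Function.Injective (Function.update s n) := Function.update_injective s n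
  rw [Matrix.mulVec, dotProduct, ← Finset.sum_subset
    (Finset.subset_univ (Finset.univ.map ⟨Function.update s n, hinj⟩)), Finset.sum_map]
  · refine Finset.sum_congr rfl fun k _ => ?_
    simp only [siteOp, Matrix.of_apply, Function.Embedding.coeFn_mk]
    rw [if_pos fun k hk => by rw [Function.update_of_ne hk], Function.update_self]
  · intro t _ ht
    rw [siteOp, Matrix.of_apply, if_neg, zero_mul]
    intro h
    refine ht (Finset.mem_map.2 ⟨t n, Finset.mem_univ _, ?_⟩)
    funext k
    by_cases hk : k = n
    · subst hk; simp
    · simp [Function.update_of_ne hk, h k hk]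

theorem siteOp_mul (n : Fin N) (X Y : Matrix (Fin 2) (Fin 2) ℂ) :
    siteOp n X * siteOp n Y = siteOp n (X * Y) := by
  refine Matrix.mulVec_injective (funext fun v => ?_)
  funext s
  rw [← Matrix.mulVec_mulVec, siteOp_mulVec, siteOp_mulVec]
  simp only [siteOp_mulVec, Function.update_self, Function.update_idem, Matrix.mul_apply,
    Finset.mul_sum, Finset.sum_mul, mul_assoc]
  exact Finset.sum_comm

theorem siteOp_commute {n k : Fin N} (hnk : n ≠ k) (X Y : Matrix (Fin 2) (Fin 2) ℂ) :
    Commute (siteOp n X) (siteOp k Y) := by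
  refine Matrix.mulVec_injective (funext fun v => ?_)
  funext s
  rw [← Matrix.mulVec_mulVec, ← Matrix.mulVec_mulVec, siteOp_mulVec, siteOp_mulVec]
  simp only [siteOp_mulVec, Function.update_of_ne hnk, Function.update_of_ne hnk.symm,
    Finset.mul_sum]
  rw [Finset.sum_comm]
  refine Finset.sum_congr rfl fun a _ => Finset.sum_congr rfl fun b _ => ?_
  rw [Function.update_comm hnk]
  ring

theorem siteOp_add (n : Fin N) (X Y : Matrix (Fin 2) (Fin 2) ℂ) :
    siteOp n (X + Y) = siteOp n X + siteOp n Y := by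
  ext s t
  simp only [siteOp, Matrix.of_apply, Matrix.add_apply]
  split_ifs <;> simp

theorem siteOp_smul (n : Fin N) (c : ℂ) (X : Matrix (Fin 2) (Fin 2) ℂ) :
    siteOp n (c • X) = c • siteOp n X := by
  ext s t
  simp only [siteOp, Matrix.of_apply, Matrix.smul_apply]
  split_ifs <;> simp

theorem siteOp_one (n : Fin N) : siteOp n (1 : Matrix (Fin 2) (Fin 2) ℂ) = 1 := by
  refine Matrix.mulVec_injective (funext fun v => ?_)
  funext s
  rw [siteOp_mulVec]
  simp [Matrix.one_apply]

theorem siteOp_zero (n : Fin N) : siteOp n (0 : Matrix (Fin 2) (Fin 2) ℂ) = 0 := by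
  simpa using siteOp_smul n 0 (0 : Matrix (Fin 2) (Fin 2) ℂ)

/-- The elementary matrix `E_n^{ab}` acting on the site `n`. -/
abbrev unitOp (n : Fin N) (a b : Fin 2) : Op N := siteOp n (Matrix.single a b 1)

theorem unitOp_mul (n : Fin N) (a b c d : Fin 2) :
    unitOp n a b * unitOp n c d = if b = c then unitOp n a d else 0 := by
  rw [siteOp_mul]
  split_ifs with h
  · subst h; simp
  · rw [Matrix.single_mul_single_of_ne _ _ _ _ h, siteOp_zero]

theorem rSite_apply (η : ℂ) (n : Fin N) (l : ℂ) (i j : Fin 2) :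
    rSite η n l i j = (if i = j then l • (1 : Op N) else 0) + η • unitOp n j i := by
  have : (Matrix.of fun k o => rMatrix η l (i, k) (j, o)) =
      (if i = j then l else 0) • (1 : Matrix (Fin 2) (Fin 2) ℂ) + η • Matrix.single j i 1 := by
    ext k o
    fin_cases i <;> fin_cases j <;> fin_cases k <;> fin_cases o <;> simp [rMatrix]
  rw [rSite, Matrix.of_apply, this, siteOp_add, siteOp_smul, siteOp_smul, siteOp_one]
  split_ifs <;> simp

theorem sum_unitOp (n : Fin N) : unitOp n 0 0 + unitOp n 1 1 = 1 := by
  rw [← siteOp_add, ← siteOp_one n]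
  congr 1
  ext i j
  fin_cases i <;> fin_cases j <;> simp

theorem rtt_rSite (η : ℂ) (n : Fin N) (x : ℂ) : RTT η (fun l => rSite η n (l - x)) := by
  intro l μ i j k o
  simp only [rSite_apply]
  fin_cases i <;> fin_cases j <;> fin_cases k <;> fin_cases o <;>
    simp [mul_add, add_mul, unitOp_mul] <;> module

theorem hasQDet_rSite (η : ℂ) (n : Fin N) (x : ℂ) :
    HasQDet η (fun l => rSite η n (l - x)) (fun l => (l - x) * (l + η - x + η)) := by
  intro l j o
  simp only [rSite_apply]
  have h := sum_unitOp n
  rw [← eq_sub_iff_add_eq'] at h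
  fin_cases j <;> fin_cases o <;>
    simp [mul_add, add_mul, unitOp_mul] <;> (try simp only [h]) <;> module

/-- With auxiliary spaces 1, 2 and the site n, the product R(-η)R(0) is proportional to (P_{1n} -
1)P_{2n} = P_{2n}(P_{12} - 1), and the factor P_{12} - 1 antisymmetrizes the auxiliary columns. -/
theorem fusionAntisymm_rSite (η : ℂ) (n : Fin N) (x : ℂ) :
    FusionAntisymm η (x - η) (fun l => rSite η n (l - x)) := by
  intro i j k o
  simp only [rSite_apply]
  fin_cases i <;> fin_cases j <;> fin_cases k <;> fin_cases o <;>
    simp [add_mul, unitOp_mul]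

end SiteOperators

/-! ### The twisted monodromy matrix, its cyclic rotations and the quantum inverse problem -/

section Monodromy

variable {N : ℕ}

/-- The ordered product of the operators `R_{0n}(l - ξ_n)` over a list of sites. -/
def chain (η : ℂ) (ξ : Fin N → ℂ) (s : List (Fin N)) (l : ℂ) : Matrix (Fin 2) (Fin 2) (Op N) :=
  (s.map fun n => rSite η n (l - ξ n)).prod

/-- The twist, as an operator-valued matrix. -/
def twist (K : Matrix (Fin 2) (Fin 2) ℂ) : Matrix (Fin 2) (Fin 2) (Op N) :=
  Matrix.of fun i j => K i j • 1

theorem chain_nil (η : ℂ) (ξ : Fin N → ℂ) (l : ℂ) : chain η ξ [] l = 1 := rfl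

theorem chain_cons (η : ℂ) (ξ : Fin N → ℂ) (n : Fin N) (s : List (Fin N)) (l : ℂ) :
    chain η ξ (n :: s) l = rSite η n (l - ξ n) * chain η ξ s l := by
  simp [chain]

theorem chain_append (η : ℂ) (ξ : Fin N → ℂ) (s t : List (Fin N)) (l : ℂ) :
    chain η ξ (s ++ t) l = chain η ξ s l * chain η ξ t l := by
  simp [chain]

theorem twistedMonodromy_eq (K : Matrix (Fin 2) (Fin 2) ℂ) (η : ℂ) (ξ : Fin N → ℂ) (l : ℂ) :
    twistedMonodromy K η ξ l = twist K * chain η ξ (List.finRange N).reverse l := by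
  ext i j : 2
  simp [twistedMonodromy, twist, Matrix.mul_apply, chain, monodromy]

theorem chain_commute_siteOp (η : ℂ) (ξ : Fin N → ℂ) {n : Fin N} {s : List (Fin N)} (hn : n ∉ s)
    (X : Matrix (Fin 2) (Fin 2) ℂ) (l : ℂ) (i j : Fin 2) :
    Commute (chain η ξ s l i j) (siteOp n X) := by
  induction s generalizing i j with
  | nil =>
    rw [chain_nil, Matrix.one_apply]
    split_ifs
    exacts [Commute.one_left _, Commute.zero_left _]
  | cons k s ih =>
    rw [List.mem_cons, not_or] at hn
    rw [chain_cons, Matrix.mul_apply]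
    refine Commute.sum_left _ _ _ fun a _ => Commute.mul_left ?_ (ih hn.2 _ _)
    rw [rSite]
    exact siteOp_commute (Ne.symm hn.1) _ _

theorem chain_entriesCommute (η : ℂ) (ξ : Fin N → ℂ) {s t : List (Fin N)} (h : s.Disjoint t) :
    EntriesCommute (chain η ξ s) (chain η ξ t) := by
  intro l μ i j k o
  induction t generalizing k o with
  | nil =>
    rw [chain_nil, Matrix.one_apply]
    split_ifs
    exacts [Commute.one_right _, Commute.zero_right _]
  | cons n t ih =>
    rw [List.disjoint_cons_right] at h
    rw [chain_cons, Matrix.mul_apply]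
    refine Commute.sum_right _ _ _ fun a _ => Commute.mul_right ?_ (ih h.2 _ _)
    rw [rSite]
    exact chain_commute_siteOp η ξ h.1 _ _ _ _

theorem twist_entriesCommute_left (K : Matrix (Fin 2) (Fin 2) ℂ)
    (W : ℂ → Matrix (Fin 2) (Fin 2) (Op N)) : EntriesCommute (fun _ => twist K) W :=
  fun _ _ i j _ _ => by
    change Commute (K i j • (1 : Op N)) _
    exact (Commute.one_left _).smul_left _

theorem rSite_entriesCommute_chain (η : ℂ) (ξ : Fin N → ℂ) {n : Fin N} {s : List (Fin N)}
    (hn : n ∉ s) : EntriesCommute (fun l => rSite η n (l - ξ n)) (chain η ξ s) :=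
  fun _ _ _ _ _ _ => (chain_commute_siteOp η ξ hn _ _ _ _).symm

theorem rtt_twist (η : ℂ) (K : Matrix (Fin 2) (Fin 2) ℂ) :
    RTT η (fun _ => (twist K : Matrix (Fin 2) (Fin 2) (Op N))) := by
  intro l μ i j k o
  simp only [twist, Matrix.of_apply, smul_mul_smul_comm, smul_smul]
  module

theorem rtt_chain (η : ℂ) (ξ : Fin N → ℂ) {s : List (Fin N)} (hs : s.Nodup) :
    RTT η (chain η ξ s) := by
  induction s with
  | nil =>
    have := rtt_twist (N := N) η 1
    intro l μ i j k o
    simp only [chain_nil]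
    have h := this l μ i j k o
    have e : (twist 1 : Matrix (Fin 2) (Fin 2) (Op N)) = 1 := by
      ext i j : 2
      rw [twist, Matrix.of_apply, Matrix.one_apply, Matrix.one_apply]
      split_ifs <;> simp
    rwa [e] at h
  | cons n s ih =>
    rw [List.nodup_cons] at hs
    have : chain η ξ (n :: s) = fun l => rSite η n (l - ξ n) * chain η ξ s l :=
      funext fun l => chain_cons η ξ n s l
    rw [this]
    exact (rtt_rSite η n (ξ n)).mul (ih hs.2) (rSite_entriesCommute_chain η ξ hs.1)

theorem hasQDet_chain (η : ℂ) (ξ : Fin N → ℂ) {s : List (Fin N)} (hs : s.Nodup) :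
    HasQDet η (chain η ξ s) (fun l => (s.map fun n => (l - ξ n) * (l + η - ξ n + η)).prod) := by
  induction s with
  | nil =>
    intro l j o
    simp only [chain_nil]
    fin_cases j <;> fin_cases o <;> simp [Matrix.one_apply]
  | cons n s ih =>
    rw [List.nodup_cons] at hs
    have : chain η ξ (n :: s) = fun l => rSite η n (l - ξ n) * chain η ξ s l :=
      funext fun l => chain_cons η ξ n s l
    rw [this]
    simp only [List.map_cons, List.prod_cons]
    exact (hasQDet_rSite η n (ξ n)).mul (ih hs.2) (rSite_entriesCommute_chain η ξ hs.1)

theorem hasQDet_twist (η : ℂ) (K : Matrix (Fin 2) (Fin 2) ℂ) :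
    HasQDet η (fun _ => (twist K : Matrix (Fin 2) (Fin 2) (Op N))) (fun _ => K.det) := by
  intro l j o
  simp only [twist, Matrix.of_apply, smul_mul_smul_comm, Matrix.det_fin_two]
  fin_cases j <;> fin_cases o <;> simp <;> module

theorem rtt_twistedMonodromy (K : Matrix (Fin 2) (Fin 2) ℂ) (η : ℂ) (ξ : Fin N → ℂ) :
    RTT η (twistedMonodromy K η ξ) := by
  rw [funext (twistedMonodromy_eq K η ξ)]
  exact (rtt_twist η K).mul (rtt_chain η ξ (List.nodup_reverse.2 (List.nodup_finRange N)))
    (twist_entriesCommute_left K _)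

theorem hasQDet_twistedMonodromy (K : Matrix (Fin 2) (Fin 2) ℂ) (η : ℂ) (ξ : Fin N → ℂ) :
    HasQDet η (twistedMonodromy K η ξ) (fun l => K.det * (dFun ξ l * aFun η ξ (l + η))) := by
  rw [funext (twistedMonodromy_eq K η ξ)]
  have := (hasQDet_twist η K).mul
    (hasQDet_chain η ξ (List.nodup_reverse.2 (List.nodup_finRange N)))
    (twist_entriesCommute_left K _)
  convert this using 3 with l
  rw [dFun, aFun, ← Finset.prod_mul_distrib, List.map_reverse, List.prod_reverse, 
    ← List.ofFn_eq_map, List.prod_ofFn]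

/-- The local factor at site n is antisymmetric. Factors to its right preserve this because they
have a scalar quantum determinant; factors to its left, including the twist, do not touch the column
indices. -/
theorem fusionAntisymm_twistedMonodromy (K : Matrix (Fin 2) (Fin 2) ℂ) (η : ℂ) (ξ : Fin N → ℂ)
    (n : Fin N) : FusionAntisymm η (ξ n - η) (twistedMonodromy K η ξ) := by
  obtain ⟨s, t, hst⟩ := List.append_of_mem (a := n) (l := (List.finRange N).reverse) (by simp)
  have hnd : (s ++ n :: t).Nodup := hst ▸ List.nodup_reverse.2 (List.nodup_finRange N)
  rw [funext (twistedMonodromy_eq K η ξ), hst]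
  have h₁ : (s ++ n :: t) = s ++ (n :: t) := rfl
  rw [List.nodup_append'] at hnd
  have hnt := List.nodup_cons.1 hnd.2.1
  refine FusionAntisymm.mul_left ?_ (twist_entriesCommute_left K _)
  have e : chain η ξ (s ++ n :: t) = fun l => chain η ξ s l * (fun l => rSite η n (l - ξ n) *
      chain η ξ t l) l := funext fun l => by rw [chain_append, chain_cons]
  rw [e]
  refine FusionAntisymm.mul_left ((fusionAntisymm_rSite η n (ξ n)).mul_right
    (hasQDet_chain η ξ hnt.2) (rSite_entriesCommute_chain η ξ hnt.1)) ?_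
  have e' : (fun l => rSite η n (l - ξ n) * chain η ξ t l) = chain η ξ (n :: t) :=
    funext fun l => (chain_cons η ξ n t l).symm
  rw [e']
  exact chain_entriesCommute η ξ hnd.2.2

theorem finRange_drop (n : Fin N) :
    (List.finRange N).drop n = n :: (List.finRange N).drop (n + 1) := by
  rw [List.drop_eq_getElem_cons (by simp)]
  simp

theorem finRange_take_drop (n : Fin N) :
    (List.finRange N).take n ++ n :: (List.finRange N).drop (n + 1) = List.finRange N := by
  rw [← finRange_drop, List.take_append_drop]

/-- The monodromy matrix obtained from the twisted one by moving the first `n` sites around. -/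
def cyclicMonodromy (K : Matrix (Fin 2) (Fin 2) ℂ) (η : ℂ) (ξ : Fin N → ℂ) (n : ℕ) (l : ℂ) :
    Matrix (Fin 2) (Fin 2) (Op N) :=
  chain η ξ ((List.finRange N).take n).reverse l * twist K *
    chain η ξ ((List.finRange N).drop n).reverse l

/-- The cyclic monodromy matrix without the site `n`. -/
def cyclicRest (K : Matrix (Fin 2) (Fin 2) ℂ) (η : ℂ) (ξ : Fin N → ℂ) (n : ℕ) (l : ℂ) :
    Matrix (Fin 2) (Fin 2) (Op N) :=
  chain η ξ ((List.finRange N).take n).reverse l * twist K *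
    chain η ξ ((List.finRange N).drop (n + 1)).reverse l

theorem cyclicMonodromy_zero (K : Matrix (Fin 2) (Fin 2) ℂ) (η : ℂ) (ξ : Fin N → ℂ) (l : ℂ) :
    cyclicMonodromy K η ξ 0 l = twistedMonodromy K η ξ l := by
  rw [cyclicMonodromy, twistedMonodromy_eq]
  simp [chain_nil]

/-- Site n is the rightmost factor of the n-th rotation and the leftmost factor of the next one. The
common remainder `cyclicRest` commutes with this site, which is the setting of `trace_mul_entry`. -/
theorem cyclicMonodromy_eq_rest_mul (K : Matrix (Fin 2) (Fin 2) ℂ) (η : ℂ) (ξ : Fin N → ℂ)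
    (n : Fin N) (l : ℂ) :
    cyclicMonodromy K η ξ n l = cyclicRest K η ξ n l * rSite η n (l - ξ n) := by
  rw [cyclicMonodromy, cyclicRest, finRange_drop, List.reverse_cons, chain_append, chain_cons,
    chain_nil]
  simp only [mul_assoc, mul_one]

theorem cyclicMonodromy_succ (K : Matrix (Fin 2) (Fin 2) ℂ) (η : ℂ) (ξ : Fin N → ℂ)
    (n : Fin N) (l : ℂ) :
    cyclicMonodromy K η ξ (n + 1) l = rSite η n (l - ξ n) * cyclicRest K η ξ n l := by
  have : (List.finRange N).take (n + 1) = (List.finRange N).take n ++ [n] := by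
    rw [List.take_succ_eq_append_getElem (by simp)]
    simp
  rw [cyclicMonodromy, cyclicRest, this, List.reverse_append, List.reverse_singleton,
    List.singleton_append, chain_cons]
  simp only [mul_assoc]

theorem cyclicRest_commute (K : Matrix (Fin 2) (Fin 2) ℂ) (η : ℂ) (ξ : Fin N → ℂ)
    (n : Fin N) (l : ℂ) (i j : Fin 2) (X : Matrix (Fin 2) (Fin 2) ℂ) :
    Commute (cyclicRest K η ξ n l i j) (siteOp n X) := by
  have hnd := List.nodup_finRange N
  rw [← finRange_take_drop n, List.nodup_append', List.nodup_cons] at hnd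
  have h₁ : n ∉ ((List.finRange N).take n).reverse := by
    rw [List.mem_reverse]
    intro h
    exact hnd.2.2 h (by simp)
  have h₂ : n ∉ ((List.finRange N).drop (n + 1)).reverse := by
    rw [List.mem_reverse]
    exact hnd.2.1.1
  simp only [cyclicRest, Matrix.mul_apply]
  refine Commute.sum_left _ _ _ fun a _ => Commute.mul_left
    (Commute.sum_left _ _ _ fun b _ => Commute.mul_left ?_ ?_) ?_
  · exact chain_commute_siteOp η ξ h₁ X l i _
  · change Commute (K b a • (1 : Op N)) _
    exact (Commute.one_left _).smul_left _
  · exact chain_commute_siteOp η ξ h₂ X l _ j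

theorem rtt_cyclicRest (K : Matrix (Fin 2) (Fin 2) ℂ) (η : ℂ) (ξ : Fin N → ℂ) (n : Fin N) :
    RTT η (cyclicRest K η ξ n) := by
  have hnd := List.nodup_finRange N
  rw [← finRange_take_drop n, List.nodup_append', List.nodup_cons] at hnd
  have hd : ((List.finRange N).take n).reverse.Disjoint
      ((List.finRange N).drop (n + 1)).reverse := by
    intro a ha hb
    rw [List.mem_reverse] at ha hb
    exact hnd.2.2 ha (List.mem_cons_of_mem _ hb)
  have ht := (twist_entriesCommute_left K (chain η ξ ((List.finRange N).take n).reverse)).symm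
  refine RTT.mul (RTT.mul (rtt_chain η ξ (List.nodup_reverse.2 hnd.1)) (rtt_twist η K) ht)
    (rtt_chain η ξ (List.nodup_reverse.2 hnd.2.1.2)) ?_
  exact EntriesCommute.mul_left (chain_entriesCommute η ξ hd) (twist_entriesCommute_left K _)

theorem cyclicMonodromy_entry (K : Matrix (Fin 2) (Fin 2) ℂ) (η : ℂ) (ξ : Fin N → ℂ) (n : Fin N)
    (a b : Fin 2) :
    cyclicMonodromy K η ξ n (ξ n) b a =
      unitOp n a b * (cyclicMonodromy K η ξ n (ξ n)).trace := by
  rw [cyclicMonodromy_eq_rest_mul]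
  exact mul_entry_eq_mul_trace (W := cyclicRest K η ξ n)
    (L := fun l => rSite η n (l - ξ n)) (unitOp_mul n) (fun l i j => rSite_apply η n _ i j)
    (fun l i j a b => cyclicRest_commute K η ξ n l i j _) a b

theorem trace_mul_cyclicMonodromy (K : Matrix (Fin 2) (Fin 2) ℂ) (η : ℂ) (ξ : Fin N → ℂ)
    (n : Fin N) (l : ℂ) (i j : Fin 2) :
    (cyclicMonodromy K η ξ n (ξ n)).trace * cyclicMonodromy K η ξ n l i j =
      cyclicMonodromy K η ξ (n + 1) l i j * (cyclicMonodromy K η ξ n (ξ n)).trace := by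
  rw [cyclicMonodromy_eq_rest_mul, cyclicMonodromy_eq_rest_mul, cyclicMonodromy_succ]
  exact trace_mul_entry (W := cyclicRest K η ξ n) (L := fun l => rSite η n (l - ξ n))
    (rtt_cyclicRest K η ξ n) (unitOp_mul n) (fun l i j => rSite_apply η n _ i j)
    (fun l i j a b => cyclicRest_commute K η ξ n l i j _) l i j

/-- The transfer matrix. -/
def transfer (K : Matrix (Fin 2) (Fin 2) ℂ) (η : ℂ) (ξ : Fin N → ℂ) (l : ℂ) : Op N :=
  (twistedMonodromy K η ξ l).trace

/-- The product of the transfer matrices at the first `m` inhomogeneities. -/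
def transferProd (K : Matrix (Fin 2) (Fin 2) ℂ) (η : ℂ) (ξ : Fin N → ℂ) {m : ℕ} (hm : m ≤ N) :
    Op N :=
  (List.ofFn fun k : Fin m => transfer K η ξ (ξ (Fin.castLE hm k))).prod

theorem transferProd_succ (K : Matrix (Fin 2) (Fin 2) ℂ) (η : ℂ) (ξ : Fin N → ℂ) {m : ℕ}
    (hm : m + 1 ≤ N) :
    transferProd K η ξ hm =
      transferProd K η ξ (Nat.le_of_succ_le hm) * transfer K η ξ (ξ ⟨m, hm⟩) := by
  rw [transferProd, List.ofFn_succ', List.concat_eq_append, List.prod_append, List.prod_singleton]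
  rfl

/-- The product of the transfer matrices at the first inhomogeneities intertwines the
monodromy matrix with the cyclically permuted one. -/
theorem transferProd_mul_monodromy (K : Matrix (Fin 2) (Fin 2) ℂ) (η : ℂ) (ξ : Fin N → ℂ)
    {m : ℕ} (hm : m ≤ N) (l : ℂ) (i j : Fin 2) :
    transferProd K η ξ hm * twistedMonodromy K η ξ l i j =
      cyclicMonodromy K η ξ m l i j * transferProd K η ξ hm := by
  induction m generalizing l i j with
  | zero => simp [cyclicMonodromy_zero, transferProd]
  | succ m ih =>
    have ih' := ih (Nat.le_of_succ_le hm)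
    -- All entries have already been carried through the first m transfer matrices, hence so has
    -- their sum over the diagonal.
    have hUt : transferProd K η ξ (Nat.le_of_succ_le hm) * transfer K η ξ (ξ ⟨m, hm⟩) =
        (cyclicMonodromy K η ξ m (ξ ⟨m, hm⟩)).trace *
          transferProd K η ξ (Nat.le_of_succ_le hm) := by
      simp only [transfer, Matrix.trace, Matrix.diag, Finset.mul_sum, Finset.sum_mul, ih']
    have key := trace_mul_cyclicMonodromy K η ξ ⟨m, hm⟩ l i j
    simp only at key
    rw [transferProd_succ, hUt, mul_assoc, ih', ← mul_assoc, key, mul_assoc]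

/-- The solution of the quantum inverse problem: products of elementary matrices on the first
sites in terms of entries of the monodromy matrix. -/
theorem prod_unitOp_mul_transferProd (K : Matrix (Fin 2) (Fin 2) ℂ) (η : ℂ) (ξ : Fin N → ℂ)
    {m : ℕ} (hm : m ≤ N) (e e' : Fin m → Fin 2) :
    (List.ofFn fun k : Fin m => unitOp (Fin.castLE hm k) (e k) (e' k)).prod *
        transferProd K η ξ hm =
      (List.ofFn fun k : Fin m =>
        twistedMonodromy K η ξ (ξ (Fin.castLE hm k)) (e' k) (e k)).prod := by
  induction m with
  | zero => simp [transferProd]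
  | succ m ih =>
    have ih' := ih (Nat.le_of_succ_le hm) (fun k => e k.castSucc) (fun k => e' k.castSucc)
    have hmon := transferProd_mul_monodromy K η ξ (Nat.le_of_succ_le hm) (ξ ⟨m, hm⟩)
    have hUt : transferProd K η ξ (Nat.le_of_succ_le hm) * transfer K η ξ (ξ ⟨m, hm⟩) =
        (cyclicMonodromy K η ξ m (ξ ⟨m, hm⟩)).trace *
          transferProd K η ξ (Nat.le_of_succ_le hm) := by
      simp only [transfer, Matrix.trace, Matrix.diag, Finset.mul_sum, Finset.sum_mul, hmon]
    have key := cyclicMonodromy_entry K η ξ ⟨m, hm⟩ (e (Fin.last m)) (e' (Fin.last m))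
    simp only at key
    rw [List.ofFn_succ', List.ofFn_succ', List.concat_eq_append, List.concat_eq_append,
      List.prod_append, List.prod_append, List.prod_singleton, List.prod_singleton,
      transferProd_succ, hUt, mul_assoc, ← mul_assoc (unitOp _ _ _)]
    change _ * (unitOp ⟨m, hm⟩ _ _ * _ * _) =
      _ * twistedMonodromy K η ξ (ξ ⟨m, hm⟩) (e' (Fin.last m)) (e (Fin.last m))
    rw [← key, ← hmon, ← mul_assoc]
    exact congrArg (· * _) ih'

end Monodromy

/-! ### Lagrange interpolation and the residue identity -/

section Interpolation

/-- `f` is a polynomial function of degree at most `d` whose coefficient of degree `d` is `c`. -/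
def PolyFun (d : ℕ) (c : ℂ) (f : ℂ → ℂ) : Prop :=
  ∃ p : ℂ[X], (∀ l, p.eval l = f l) ∧ p.natDegree ≤ d ∧ p.coeff d = c

theorem PolyFun.mul {d d' : ℕ} {c c' : ℂ} {f f' : ℂ → ℂ} (h : PolyFun d c f)
    (h' : PolyFun d' c' f') : PolyFun (d + d') (c * c') (fun l => f l * f' l) := by
  obtain ⟨p, hp, hd, hc⟩ := h
  obtain ⟨p', hp', hd', hc'⟩ := h'
  refine ⟨p * p', fun l => by rw [eval_mul, hp, hp'], natDegree_mul_le_of_le hd hd', ?_⟩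
  rw [coeff_mul_add_eq_of_natDegree_le hd hd', hc, hc']

theorem PolyFun.sum {ι : Type*} (s : Finset ι) {d : ℕ} {c : ι → ℂ} {f : ι → ℂ → ℂ}
    (h : ∀ i ∈ s, PolyFun d (c i) (f i)) : PolyFun d (∑ i ∈ s, c i) (fun l => ∑ i ∈ s, f i l) := by
  choose! p hp hd hc using h
  refine ⟨∑ i ∈ s, p i, fun l => ?_, natDegree_sum_le_of_forall_le _ _ hd, ?_⟩
  · rw [eval_finsetSum]
    exact Finset.sum_congr rfl fun i hi => hp i hi l
  · rw [finsetSum_coeff]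
    exact Finset.sum_congr rfl fun i hi => hc i hi

theorem PolyFun.const_mul {d : ℕ} {c : ℂ} {f : ℂ → ℂ} (a : ℂ) (h : PolyFun d c f) :
    PolyFun d (a * c) (fun l => a * f l) := by
  obtain ⟨p, hp, hd, hc⟩ := h
  exact ⟨C a * p, fun l => by simp [hp], (natDegree_C_mul_le _ _).trans hd, by simp [hc]⟩

theorem PolyFun.continuous {d : ℕ} {c : ℂ} {f : ℂ → ℂ} (h : PolyFun d c f) : Continuous f := by
  obtain ⟨p, hp, -, -⟩ := h
  rw [← funext hp]
  exact p.continuous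

variable {N : ℕ}

theorem eval_lagrange_basis {ι : Type*} [DecidableEq ι] (s : Finset ι) (x : ι → ℂ) (n : ι) (l : ℂ) :
    (Lagrange.basis s x n).eval l = ∏ k ∈ s.erase n, (l - x k) / (x n - x k) := by
  rw [Lagrange.basis, eval_prod]
  refine Finset.prod_congr rfl fun k _ => ?_
  simp [Lagrange.basisDivisor, div_eq_mul_inv, mul_comm]

theorem eval_rootPoly {ι : Type} (x : ι → ℂ) (s : Finset ι) (l : ℂ) :
    (rootPoly x s).eval l = ∏ b ∈ s, (l - x b) := by
  simp [rootPoly, eval_prod]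

theorem rootPoly_monic {ι : Type} (x : ι → ℂ) (s : Finset ι) : (rootPoly x s).Monic :=
  monic_prod_of_monic _ _ fun b _ => monic_X_sub_C (x b)

theorem natDegree_rootPoly {ι : Type} (x : ι → ℂ) (s : Finset ι) :
    (rootPoly x s).natDegree = s.card := by
  rw [rootPoly, natDegree_prod_of_monic _ _ fun b _ => monic_X_sub_C (x b)]
  simp

/-- Interpolation of a polynomial of degree `N` at `N` points, with prescribed leading
coefficient. -/
theorem PolyFun.eq_interpolate {c : ℂ} {f : ℂ → ℂ} (h : PolyFun N c f) {x : Fin N → ℂ}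
    (hx : Function.Injective x) (l : ℂ) :
    f l = c * ∏ n, (l - x n) +
      ∑ n, (∏ k ∈ Finset.univ.erase n, (l - x k) / (x n - x k)) * f (x n) := by
  obtain ⟨p, hp, hd, hc⟩ := h
  have hW := natDegree_rootPoly x Finset.univ
  rw [Finset.card_univ, Fintype.card_fin] at hW
  have hWc : (rootPoly x Finset.univ).coeff N = 1 := by
    have := (rootPoly_monic x Finset.univ).coeff_natDegree
    rwa [hW] at this
  have hdeg : (p - C c * rootPoly x Finset.univ).degree < (Finset.univ : Finset (Fin N)).card := by
    rw [Finset.card_univ, Fintype.card_fin, degree_lt_iff_coeff_zero]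
    intro m hm
    rcases hm.eq_or_lt with rfl | hm
    · simp [hc, hWc]
    · rw [coeff_sub, coeff_C_mul, coeff_eq_zero_of_natDegree_lt (hd.trans_lt hm),
        coeff_eq_zero_of_natDegree_lt (hW.le.trans_lt hm)]
      simp
  have key := Lagrange.eq_interpolate (v := x) (hx.injOn) hdeg
  have := congrArg (eval l) key
  simp only [Lagrange.interpolate_apply, eval_sub, eval_mul, eval_C, eval_finsetSum,
    eval_lagrange_basis, eval_rootPoly, hp] at this
  rw [sub_eq_iff_eq_add'] at this
  rw [this]
  congr 1
  refine Finset.sum_congr rfl fun n _ => ?_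
  rw [Finset.prod_eq_zero (Finset.mem_univ n) (sub_self (x n)), mul_zero, sub_zero, mul_comm]

theorem sum_prod_div_eq_one (hN : 0 < N) {x : Fin N → ℂ} (hx : Function.Injective x) (l : ℂ) :
    ∑ n, ∏ k ∈ Finset.univ.erase n, (l - x k) / (x n - x k) = 1 := by
  have : Nonempty (Fin N) := ⟨⟨0, hN⟩⟩
  have := congrArg (eval l) (Lagrange.sum_basis (v := x) hx.injOn Finset.univ_nonempty)
  simpa only [eval_finsetSum, eval_lagrange_basis, eval_one] using this

/-- Comparison of the coefficients of degree N - 1 in the Lagrange formula; equivalently, the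
residue at infinity. -/
theorem sum_eval_div_prod (hN : 0 < N) {x : Fin N → ℂ} (hx : Function.Injective x) {p : ℂ[X]}
    (hp : p.natDegree ≤ N - 1) :
    ∑ n, p.eval (x n) / ∏ k ∈ Finset.univ.erase n, (x n - x k) = p.coeff (N - 1) := by
  have hdeg : p.degree < (Finset.univ : Finset (Fin N)).card := by
    rw [Finset.card_univ, Fintype.card_fin]
    exact (degree_le_natDegree).trans_lt (by exact_mod_cast (by omega))
  have key := Lagrange.eq_interpolate (v := x) (hx.injOn) hdeg
  have := congrArg (fun r => coeff r (N - 1)) key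
  simp only [Lagrange.interpolate_apply, finsetSum_coeff, coeff_C_mul] at this
  rw [this]
  refine Finset.sum_congr rfl fun n _ => ?_
  have hb : Lagrange.basis Finset.univ x n =
      C (∏ k ∈ Finset.univ.erase n, (x n - x k))⁻¹ * rootPoly x (Finset.univ.erase n) := by
    rw [Lagrange.basis, rootPoly, ← Finset.prod_inv_distrib, map_prod, ← Finset.prod_mul_distrib]
    rfl
  have hW := natDegree_rootPoly x (Finset.univ.erase n)
  rw [Finset.card_erase_of_mem (Finset.mem_univ n), Finset.card_univ, Fintype.card_fin] at hW
  rw [hb, coeff_C_mul, ← hW, (rootPoly_monic x _).coeff_natDegree, mul_one, div_eq_mul_inv]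

/-- The residue identity behind the action of the monodromy matrix on separate states. -/
theorem sum_residues (hN : 0 < N) {x : Fin N → ℂ} (hx : Function.Injective x) {ι : Type}
    [DecidableEq ι] (S : Finset ι) {q : ι → ℂ} (hq : Set.InjOn q S) {f : ℂ[X]}
    (hf : f.natDegree ≤ S.card + (N - 1)) :
    ∑ n, f.eval (x n) * ∏ k ∈ Finset.univ.erase n, (rootPoly q S).eval (x k) / (x n - x k) +
      (-1) ^ N * ∑ a ∈ S, f.eval (q a) / (∏ b ∈ S.erase a, (q a - q b)) *
        ∏ k, (rootPoly q (S.erase a)).eval (x k) =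
    f.coeff (S.card + (N - 1)) * ∏ k, (rootPoly q S).eval (x k) := by
  set W := rootPoly q S with hWdef
  have hWm : W.Monic := rootPoly_monic q S
  have hWd : W.natDegree = S.card := natDegree_rootPoly q S
  -- For distinct x_n and q_a this is the sum of all residues of f / (W ∏ (z - x_k)), multiplied by
  -- ∏ W(x_k). Writing f = r + W h avoids assuming x_n ≠ q_a: r is interpolated at the roots q_a and
  -- yields the second sum, while in W h the factor W completes the product and leaves the leading
  -- coefficient of h.
  set r := f %ₘ W
  set h := f /ₘ W
  have hdec : r + W * h = f := modByMonic_add_div f W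
  have hWq : ∀ a ∈ S, W.eval (q a) = 0 := fun a ha => by
    rw [eval_rootPoly]; exact Finset.prod_eq_zero ha (sub_self _)
  have hrd : r.degree < S.card := by
    rw [← hWd, ← degree_eq_natDegree hWm.ne_zero]
    exact degree_modByMonic_lt f hWm
  have hr : ∀ l, r.eval l = ∑ a ∈ S, f.eval (q a) / (∏ b ∈ S.erase a, (q a - q b)) *
      (rootPoly q (S.erase a)).eval l := by
    intro l
    have := congrArg (eval l) (Lagrange.eq_interpolate (v := q) hq hrd)
    rw [this]
    simp only [Lagrange.interpolate_apply, eval_finsetSum, eval_mul, eval_C, eval_lagrange_basis]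
    refine Finset.sum_congr rfl fun a ha => ?_
    rw [← hdec, eval_add, eval_mul, hWq a ha, zero_mul, add_zero, eval_rootPoly,
      Finset.prod_div_distrib]
    ring
  have hhd : h.natDegree ≤ N - 1 := by
    rw [natDegree_divByMonic f hWm, hWd]; omega
  have hhc : h.coeff (N - 1) = f.coeff (S.card + (N - 1)) := by
    have hr0 : r.coeff (S.card + (N - 1)) = 0 :=
      coeff_eq_zero_of_degree_lt (hrd.trans_le (by exact_mod_cast Nat.le_add_right _ _))
    have hW1 : W.coeff S.card = 1 := by rw [← hWd]; exact hWm.coeff_natDegree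
    rw [← hdec, coeff_add, coeff_mul_add_eq_of_natDegree_le hWd.le hhd, hr0, hW1, one_mul, zero_add]
  have hWa : ∀ a ∈ S, ∀ l, W.eval l = (l - q a) * (rootPoly q (S.erase a)).eval l := by
    intro a ha l
    rw [eval_rootPoly, eval_rootPoly, Finset.mul_prod_erase S (fun b => l - q b) ha]
  have e₁ : ∑ n, (W * h).eval (x n) * ∏ k ∈ Finset.univ.erase n, W.eval (x k) / (x n - x k) =
      f.coeff (S.card + (N - 1)) * ∏ k, W.eval (x k) := by
    rw [← hhc, ← sum_eval_div_prod hN hx hhd, Finset.sum_mul]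
    refine Finset.sum_congr rfl fun n _ => ?_
    rw [← Finset.mul_prod_erase Finset.univ (fun k => W.eval (x k)) (Finset.mem_univ n),
      Finset.prod_div_distrib, eval_mul]
    ring
  -- Taking the factor x_k - q_a out of each W(x_k) produces the Lagrange basis evaluated at q_a,
  -- and these values sum to 1.
  have e₂ : ∀ a ∈ S, ∑ n, (rootPoly q (S.erase a)).eval (x n) *
      ∏ k ∈ Finset.univ.erase n, W.eval (x k) / (x n - x k) =
      -((-1) ^ N * ∏ k, (rootPoly q (S.erase a)).eval (x k)) := by
    intro a ha
    have : ∀ n, (rootPoly q (S.erase a)).eval (x n) *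
        ∏ k ∈ Finset.univ.erase n, W.eval (x k) / (x n - x k) =
        -((-1) ^ N * ∏ k, (rootPoly q (S.erase a)).eval (x k)) *
        ∏ k ∈ Finset.univ.erase n, (q a - x k) / (x n - x k) := by
      intro n
      have h₁ : ∀ k, W.eval (x k) / (x n - x k) =
          (-1) * (rootPoly q (S.erase a)).eval (x k) * ((q a - x k) / (x n - x k)) := by
        intro k; rw [hWa a ha]; ring
      rw [Finset.prod_congr rfl fun k _ => h₁ k, Finset.prod_mul_distrib, Finset.prod_mul_distrib,
        Finset.prod_const, Finset.card_erase_of_mem (Finset.mem_univ n), Finset.card_univ,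
        Fintype.card_fin,
        ← Finset.mul_prod_erase Finset.univ (fun k => (rootPoly q (S.erase a)).eval (x k))
          (Finset.mem_univ n)]
      obtain ⟨M, rfl⟩ : ∃ M, N = M + 1 := ⟨N - 1, by omega⟩
      rw [Nat.add_sub_cancel, pow_succ]
      ring
    rw [Finset.sum_congr rfl fun n _ => this n, ← Finset.mul_sum, sum_prod_div_eq_one hN hx,
      mul_one]
  have e₃ : ∑ n, r.eval (x n) * ∏ k ∈ Finset.univ.erase n, W.eval (x k) / (x n - x k) =
      -((-1) ^ N * ∑ a ∈ S, f.eval (q a) / (∏ b ∈ S.erase a, (q a - q b)) *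
        ∏ k, (rootPoly q (S.erase a)).eval (x k)) := by
    simp only [hr, Finset.sum_mul]
    rw [Finset.sum_comm, Finset.mul_sum, ← Finset.sum_neg_distrib]
    refine Finset.sum_congr rfl fun a ha => ?_
    simp only [mul_assoc]
    rw [← Finset.mul_sum, e₂ a ha]
    ring
  have e₄ : ∑ n, f.eval (x n) * ∏ k ∈ Finset.univ.erase n, W.eval (x k) / (x n - x k) =
      ∑ n, r.eval (x n) * ∏ k ∈ Finset.univ.erase n, W.eval (x k) / (x n - x k) +
      ∑ n, (W * h).eval (x n) * ∏ k ∈ Finset.univ.erase n, W.eval (x k) / (x n - x k) := by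
    rw [← Finset.sum_add_distrib]
    refine Finset.sum_congr rfl fun n _ => ?_
    rw [← add_mul, ← eval_add, hdec]
  rw [e₄, e₃, e₁]
  ring

end Interpolation

/-! ### Vandermonde products under a change of one variable -/

section Vandermonde

variable {N : ℕ}

theorem vand_eq_mul (x : Fin N → ℂ) (n : Fin N) :
    vand x = (∏ i ∈ Finset.univ.erase n, (if i < n then 1 else -1) * (x n - x i)) *
      ∏ i ∈ Finset.univ.erase n, ∏ j ∈ (Finset.Ioi i).erase n, (x j - x i) := by
  have h₁ : ∏ j ∈ Finset.Ioi n, (x j - x n) =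
      ∏ i ∈ Finset.univ.erase n, if n < i then x i - x n else 1 := by
    rw [← Finset.prod_filter]
    refine Finset.prod_congr ?_ fun _ _ => rfl
    ext i
    simp only [Finset.mem_Ioi, Finset.mem_filter, Finset.mem_erase, Finset.mem_univ, and_true]
    exact ⟨fun h => ⟨h.ne', h⟩, fun h => h.2⟩
  have h₂ : ∀ i ∈ Finset.univ.erase n, ∏ j ∈ Finset.Ioi i, (x j - x i) =
      (if i < n then x n - x i else 1) * ∏ j ∈ (Finset.Ioi i).erase n, (x j - x i) := by
    intro i _
    split_ifs with h
    · rw [Finset.mul_prod_erase (Finset.Ioi i) (fun j => x j - x i) (Finset.mem_Ioi.2 h)]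
    · rw [Finset.erase_eq_of_notMem (by simpa using h), one_mul]
  rw [vand, ← Finset.mul_prod_erase _ _ (Finset.mem_univ n), h₁, Finset.prod_congr rfl h₂,
    Finset.prod_mul_distrib, ← mul_assoc, ← Finset.prod_mul_distrib]
  congr 1
  refine Finset.prod_congr rfl fun i hi => ?_
  rcases lt_or_gt_of_ne (Finset.ne_of_mem_erase hi) with h | h
  · simp [h, h.not_gt]
  · simp [h, h.not_gt]

/-- The signs and the pairs not involving n are common to both Vandermonde products. The identity is
kept free of division, so no distinctness is needed here. -/
theorem vand_update (x : Fin N → ℂ) (n : Fin N) (y : ℂ) :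
    vand (Function.update x n y) * ∏ k ∈ Finset.univ.erase n, (x n - x k) =
      vand x * ∏ k ∈ Finset.univ.erase n, (y - x k) := by
  have h₁ : ∀ i ∈ Finset.univ.erase n,
      (if i < n then 1 else -1 : ℂ) * (Function.update x n y n - Function.update x n y i) =
      (if i < n then 1 else -1) * (y - x i) := by
    intro i hi
    rw [Function.update_self, Function.update_of_ne (Finset.ne_of_mem_erase hi)]
  have h₂ : ∀ i ∈ Finset.univ.erase n, ∏ j ∈ (Finset.Ioi i).erase n,
      (Function.update x n y j - Function.update x n y i) =
      ∏ j ∈ (Finset.Ioi i).erase n, (x j - x i) := by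
    intro i hi
    refine Finset.prod_congr rfl fun j hj => ?_
    rw [Function.update_of_ne (Finset.ne_of_mem_erase hi),
      Function.update_of_ne (Finset.ne_of_mem_erase hj)]
  rw [vand_eq_mul x n, vand_eq_mul (Function.update x n y) n, Finset.prod_congr rfl h₁,
    Finset.prod_congr rfl h₂, Finset.prod_mul_distrib, Finset.prod_mul_distrib]
  ring

end Vandermonde

/-! ### Degree and leading coefficient of the monodromy entries -/

section PolynomialEntries

variable {N : ℕ}

theorem polyFun_rSite (η : ℂ) (n : Fin N) (x : ℂ) (i j : Fin 2) (u v : Spins N) :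
    PolyFun 1 ((1 : Matrix (Fin 2) (Fin 2) (Op N)) i j u v)
      (fun l => rSite η n (l - x) i j u v) := by
  set c := (1 : Matrix (Fin 2) (Fin 2) (Op N)) i j u v with hc
  refine ⟨C c * X + C (-x * c + η * unitOp n j i u v), fun l => ?_, natDegree_linear_le, ?_⟩
  · change _ = rSite η n (l - x) i j u v
    rw [rSite_apply, hc, Matrix.one_apply]
    simp only [eval_add, eval_mul, eval_C, eval_X, Matrix.add_apply, Matrix.smul_apply, smul_eq_mul]
    split_ifs
    · simp only [Matrix.smul_apply, smul_eq_mul]; ring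
    · simp
  · simp

/-- Each local factor is monic of degree one in l, with the identity as leading coefficient, so the
leading coefficient of the product is again the identity. -/
theorem polyFun_chain (η : ℂ) (ξ : Fin N → ℂ) (s : List (Fin N)) (i j : Fin 2) (u v : Spins N) :
    PolyFun s.length ((1 : Matrix (Fin 2) (Fin 2) (Op N)) i j u v)
      (fun l => chain η ξ s l i j u v) := by
  induction s generalizing i j u v with
  | nil =>
    exact ⟨C ((1 : Matrix (Fin 2) (Fin 2) (Op N)) i j u v), fun l => by simp [chain_nil],
      by simp, by simp⟩
  | cons n s ih =>
    have h₁ : ∀ l, chain η ξ (n :: s) l i j u v =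
        ∑ a, ∑ w, rSite η n (l - ξ n) i a u w * chain η ξ s l a j w v := by
      intro l
      rw [chain_cons, Matrix.mul_apply, Matrix.sum_apply]
      rfl
    have h₂ : (1 : Matrix (Fin 2) (Fin 2) (Op N)) i j u v =
        ∑ a, ∑ w, (1 : Matrix (Fin 2) (Fin 2) (Op N)) i a u w *
          (1 : Matrix (Fin 2) (Fin 2) (Op N)) a j w v := by
      conv_lhs => rw [← mul_one (1 : Matrix (Fin 2) (Fin 2) (Op N))]
      rw [Matrix.mul_apply, Matrix.sum_apply]
      rfl
    rw [funext h₁, h₂, List.length_cons, add_comm]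
    exact PolyFun.sum _ fun a _ => PolyFun.sum _ fun w _ => (polyFun_rSite η n (ξ n) i a u w).mul
      (ih a j w v)

theorem polyFun_twistedMonodromy (K : Matrix (Fin 2) (Fin 2) ℂ) (η : ℂ) (ξ : Fin N → ℂ)
    (i j : Fin 2) (u v : Spins N) :
    PolyFun N (K i j * (1 : Op N) u v) (fun l => twistedMonodromy K η ξ l i j u v) := by
  have h₁ : ∀ l, twistedMonodromy K η ξ l i j u v =
      ∑ k, K i k * chain η ξ (List.finRange N).reverse l k j u v := by
    intro l
    rw [twistedMonodromy, Matrix.of_apply, Matrix.sum_apply]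
    rfl
  have h₂ : K i j * (1 : Op N) u v =
      ∑ k, K i k * (1 : Matrix (Fin 2) (Fin 2) (Op N)) k j u v := by
    rw [Finset.sum_eq_single j (fun k _ hk => by rw [Matrix.one_apply_ne hk]; simp) (by simp),
      Matrix.one_apply_eq]
  rw [funext h₁, h₂]
  refine PolyFun.sum _ fun k _ => PolyFun.const_mul _ ?_
  have := polyFun_chain η ξ (List.finRange N).reverse k j u v
  rwa [List.length_reverse, List.length_finRange] at this

theorem polyFun_vecMul (K : Matrix (Fin 2) (Fin 2) ℂ) (η : ℂ) (ξ : Fin N → ℂ) (i j : Fin 2)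
    (v : Spins N → ℂ) (s : Spins N) :
    PolyFun N (K i j * v s) (fun l => Matrix.vecMul v (twistedMonodromy K η ξ l i j) s) := by
  have h₂ : K i j * v s = ∑ t, v t * (K i j * (1 : Op N) t s) := by
    simp [Matrix.one_apply, mul_comm]
  rw [h₂]
  exact PolyFun.sum _ fun t _ => (polyFun_twistedMonodromy K η ξ i j t s).const_mul _

theorem polyFun_mulVec (K : Matrix (Fin 2) (Fin 2) ℂ) (η : ℂ) (ξ : Fin N → ℂ) (i j : Fin 2)
    (v : Spins N → ℂ) (s : Spins N) :
    PolyFun N (K i j * v s) (fun l => Matrix.mulVec (twistedMonodromy K η ξ l i j) v s) := by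
  have h₂ : K i j * v s = ∑ t, v t * (K i j * (1 : Op N) s t) := by
    simp [Matrix.one_apply, mul_comm]
  rw [h₂]
  simp only [Matrix.mulVec, dotProduct, mul_comm _ (v _)]
  exact PolyFun.sum _ fun t _ => (polyFun_twistedMonodromy K η ξ i j s t).const_mul _

theorem continuous_vecMul_monodromy (K : Matrix (Fin 2) (Fin 2) ℂ) (η : ℂ) (ξ : Fin N → ℂ)
    (i j : Fin 2) (v : Spins N → ℂ) :
    Continuous fun l => Matrix.vecMul v (twistedMonodromy K η ξ l i j) :=
  continuous_pi fun s => (polyFun_vecMul K η ξ i j v s).continuous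

theorem continuous_mulVec_monodromy (K : Matrix (Fin 2) (Fin 2) ℂ) (η : ℂ) (ξ : Fin N → ℂ)
    (i j : Fin 2) (v : Spins N → ℂ) :
    Continuous fun l => Matrix.mulVec (twistedMonodromy K η ξ l i j) v :=
  continuous_pi fun s => (polyFun_mulVec K η ξ i j v s).continuous

end PolynomialEntries

/-! ### The reference bra and ket as eigenvectors of B -/

section ReferenceStates

/-- The bra `⊗ₙ (1,0)ₙ`. -/
def upBra (N : ℕ) : Spins N → ℂ := Pi.single (fun _ => 0) 1

/-- The ket `⊗ₙ (0,1)ₙ`. -/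
def downKet (N : ℕ) : Spins N → ℂ := Pi.single (fun _ => 1) 1

variable {N : ℕ}

theorem vecMul_up_unitOp (n : Fin N) (b : Fin 2) :
    Matrix.vecMul (upBra N) (unitOp n 1 b) = 0 := by
  funext t
  simp [upBra, siteOp]

theorem vecMul_up_unitOp_zero (n : Fin N) :
    Matrix.vecMul (upBra N) (unitOp n 0 0) = upBra N := by
  rw [eq_sub_of_add_eq (sum_unitOp n), Matrix.vecMul_sub, vecMul_up_unitOp, Matrix.vecMul_one,
    sub_zero]

theorem unitOp_mulVec_down (n : Fin N) (a : Fin 2) :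
    (unitOp n a 0).mulVec (downKet N) = 0 := by
  funext t
  simp [downKet, siteOp]

theorem unitOp_one_mulVec_down (n : Fin N) :
    (unitOp n 1 1).mulVec (downKet N) = downKet N := by
  rw [eq_sub_of_add_eq' (sum_unitOp n), Matrix.sub_mulVec, unitOp_mulVec_down, Matrix.one_mulVec,
    sub_zero]

/-- In the lower right entry the lowering term R₁₀ · (chain)₀₁ has the wrong order for acting on a
bra. Distinct sites let the two factors commute, and (chain)₀₁ then annihilates the bra. -/
theorem vecMul_up_chain (η : ℂ) (ξ : Fin N → ℂ) {s : List (Fin N)} (hs : s.Nodup) (l : ℂ) :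
    Matrix.vecMul (upBra N) (chain η ξ s l 0 1) = 0 ∧
    Matrix.vecMul (upBra N) (chain η ξ s l 1 1) =
      (s.map fun n => l - ξ n).prod • upBra N := by
  induction s with
  | nil => simp [chain_nil]
  | cons n s ih =>
    rw [List.nodup_cons] at hs
    obtain ⟨h₁, h₂⟩ := ih hs.2
    constructor
    · rw [chain_cons, Matrix.mul_apply, Fin.sum_univ_two, rSite_apply, rSite_apply,
        Matrix.vecMul_add,
        ← Matrix.vecMul_vecMul, ← Matrix.vecMul_vecMul]
      simp [Matrix.vecMul_add, Matrix.vecMul_smul, vecMul_up_unitOp, vecMul_up_unitOp_zero,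
        Matrix.add_vecMul, Matrix.smul_vecMul, h₁]
    · have hc : rSite η n (l - ξ n) 1 0 * chain η ξ s l 0 1 =
          chain η ξ s l 0 1 * rSite η n (l - ξ n) 1 0 :=
        (chain_commute_siteOp η ξ hs.1 _ l 0 1).symm
      rw [chain_cons, Matrix.mul_apply, Fin.sum_univ_two, hc, Matrix.vecMul_add,
        ← Matrix.vecMul_vecMul, ← Matrix.vecMul_vecMul, h₁, rSite_apply η n _ 1 1]
      simp [Matrix.vecMul_add, Matrix.vecMul_smul, vecMul_up_unitOp,
        Matrix.smul_vecMul, h₂, smul_smul]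

theorem chain_mulVec_down (η : ℂ) (ξ : Fin N → ℂ) (s : List (Fin N)) (l : ℂ) :
    (chain η ξ s l 0 1).mulVec (downKet N) = 0 ∧
    (chain η ξ s l 1 1).mulVec (downKet N) =
      (s.map fun n => l - ξ n + η).prod • downKet N := by
  induction s with
  | nil => simp [chain_nil]
  | cons n s ih =>
    obtain ⟨h₁, h₂⟩ := ih
    constructor
    · rw [chain_cons, Matrix.mul_apply, Fin.sum_univ_two, rSite_apply, rSite_apply,
        Matrix.add_mulVec,
        ← Matrix.mulVec_mulVec, ← Matrix.mulVec_mulVec, h₁, h₂]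
      simp [Matrix.smul_mulVec, unitOp_mulVec_down, Matrix.mulVec_smul]
    · rw [chain_cons, Matrix.mul_apply, Fin.sum_univ_two, rSite_apply, rSite_apply,
        Matrix.add_mulVec,
        ← Matrix.mulVec_mulVec, ← Matrix.mulVec_mulVec, h₁, h₂]
      simp [Matrix.add_mulVec, Matrix.smul_mulVec, unitOp_one_mulVec_down, Matrix.mulVec_smul,
        smul_smul, ← add_smul, mul_comm]

theorem vecMul_up_monodromy (K : Matrix (Fin 2) (Fin 2) ℂ) (η : ℂ) (ξ : Fin N → ℂ) (l : ℂ) :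
    Matrix.vecMul (upBra N) (twistedMonodromy K η ξ l 0 1) =
      (K 0 1 * ∏ n, (l - ξ n)) • upBra N := by
  obtain ⟨h₁, h₂⟩ := vecMul_up_chain η ξ (List.nodup_reverse.2 (List.nodup_finRange N)) l
  rw [twistedMonodromy, Matrix.of_apply, Fin.sum_univ_two]
  change Matrix.vecMul _ (K 0 0 • chain η ξ (List.finRange N).reverse l 0 1 +
    K 0 1 • chain η ξ (List.finRange N).reverse l 1 1) = _
  rw [Matrix.vecMul_add, Matrix.vecMul_smul, Matrix.vecMul_smul, h₁, h₂, smul_zero, zero_add,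
    smul_smul, List.map_reverse, List.prod_reverse, ← List.ofFn_eq_map, List.prod_ofFn]

theorem monodromy_mulVec_down (K : Matrix (Fin 2) (Fin 2) ℂ) (η : ℂ) (ξ : Fin N → ℂ) (l : ℂ) :
    (twistedMonodromy K η ξ l 0 1).mulVec (downKet N) =
      (K 0 1 * ∏ n, (l - ξ n + η)) • downKet N := by
  obtain ⟨h₁, h₂⟩ := chain_mulVec_down η ξ (List.finRange N).reverse l
  rw [twistedMonodromy, Matrix.of_apply, Fin.sum_univ_two]
  change (K 0 0 • chain η ξ (List.finRange N).reverse l 0 1 +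
    K 0 1 • chain η ξ (List.finRange N).reverse l 1 1).mulVec _ = _
  rw [Matrix.add_mulVec, Matrix.smul_mulVec, Matrix.smul_mulVec, h₁, h₂, smul_zero,
    zero_add, smul_smul, List.map_reverse, List.prod_reverse, ← List.ofFn_eq_map, List.prod_ofFn]

end ReferenceStates

/-- The genericity assumptions on the inhomogeneities and the twist. -/
structure Generic {N : ℕ} (K : Matrix (Fin 2) (Fin 2) ℂ) (k₁ η : ℂ) (ξ : Fin N → ℂ) : Prop where
  eta_ne : η ≠ 0
  xi_ne : ∀ i j, i ≠ j → ξ i ≠ ξ j ∧ ξ i ≠ ξ j + η ∧ ξ i ≠ ξ j - η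
  det_ne : K.det ≠ 0
  k₁_ne : k₁ ≠ 0

/-! ### Shifted inhomogeneities and label flips -/

section Shifts

variable {N : ℕ}

/-- Flip the label at the position `n`. -/
def flip (h : Spins N) (n : Fin N) : Spins N := Function.update h n (1 - h n)

theorem flip_flip (h : Spins N) (n : Fin N) : flip (flip h n) n = h := by
  simp [flip]

theorem shifted_update (η : ℂ) (ξ : Fin N → ℂ) (h : Spins N) (n : Fin N) (a : Fin 2) :
    shifted η ξ (Function.update h n a) =
      Function.update (shifted η ξ h) n (ξ n - ((a : ℕ) : ℂ) * η) := by
  funext k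
  by_cases hk : k = n
  · subst hk; simp [shifted]
  · simp [shifted, Function.update_of_ne hk]

theorem shifted_flip (η : ℂ) (ξ : Fin N → ℂ) (h : Spins N) (n : Fin N) :
    shifted η ξ (flip h n) = Function.update (shifted η ξ h) n (shifted η ξ (flip h n) n) := by
  conv_lhs => rw [flip, shifted_update]
  simp [shifted, flip]

theorem shifted_of_eq_zero (η : ℂ) (ξ : Fin N → ℂ) {h : Spins N} {n : Fin N} (hn : h n = 0) :
    shifted η ξ h n = ξ n := by simp [shifted, hn]

theorem shifted_of_eq_one (η : ℂ) (ξ : Fin N → ℂ) {h : Spins N} {n : Fin N} (hn : h n = 1) :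
    shifted η ξ h n = ξ n - η := by simp [shifted, hn]

theorem prod_erase_sub_update (f : Fin N → ℂ) (n : Fin N) (a μ : ℂ) :
    ∏ k ∈ Finset.univ.erase n, (μ - Function.update f n a k) =
      ∏ k ∈ Finset.univ.erase n, (μ - f k) :=
  Finset.prod_congr rfl fun k hk => by rw [Function.update_of_ne (Finset.ne_of_mem_erase hk)]

theorem dFun_xi (ξ : Fin N → ℂ) (n : Fin N) : dFun ξ (ξ n) = 0 :=
  Finset.prod_eq_zero (Finset.mem_univ n) (sub_self _)

theorem aFun_xi_sub (η : ℂ) (ξ : Fin N → ℂ) (n : Fin N) : aFun η ξ (ξ n - η) = 0 :=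
  Finset.prod_eq_zero (Finset.mem_univ n) (by ring)

variable {K : Matrix (Fin 2) (Fin 2) ℂ} {k₁ η : ℂ} {ξ : Fin N → ℂ}

/-- Two shifted points can only coincide if ξ_i - ξ_j lies in {0, η, -η}. This gives B simple zeros
on each basis vector and makes interpolation at these zeros possible. -/
theorem Generic.shifted_injective (H : Generic K k₁ η ξ) (h : Spins N) :
    Function.Injective (shifted η ξ h) := by
  intro i j hij
  by_contra hne
  obtain ⟨h₁, h₂, h₃⟩ := H.xi_ne i j hne
  rcases Fin.exists_fin_two.1 ⟨h i, rfl⟩ with hi | hi <;>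
    rcases Fin.exists_fin_two.1 ⟨h j, rfl⟩ with hj | hj <;>
    simp only [shifted, hi, hj] at hij <;> norm_num at hij
  · exact h₁ hij
  · exact h₃ hij
  · exact h₂ (by linear_combination hij)
  · exact h₁ hij

theorem Generic.dFun_ne (H : Generic K k₁ η ξ) (n : Fin N) : dFun ξ (ξ n - η) ≠ 0 := by
  refine Finset.prod_ne_zero_iff.2 fun k _ hk => ?_
  by_cases hkn : n = k
  · subst hkn
    exact H.eta_ne (by linear_combination -hk)
  · exact (H.xi_ne n k hkn).2.1 (by linear_combination hk)

theorem Generic.aFun_ne (H : Generic K k₁ η ξ) (n : Fin N) : aFun η ξ (ξ n) ≠ 0 := by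
  refine Finset.prod_ne_zero_iff.2 fun k _ hk => ?_
  by_cases hkn : n = k
  · subst hkn
    exact H.eta_ne (by linear_combination hk)
  · exact (H.xi_ne n k hkn).2.2 (by linear_combination hk)

theorem spins_induction {P : Spins N → Prop} (h₀ : P fun _ => 0)
    (step : ∀ h n, h n = 0 → P h → P (Function.update h n 1)) (h : Spins N) : P h := by
  have key : ∀ s : Finset (Fin N), P fun n => if n ∈ s then 1 else 0 := by
    intro s
    induction s using Finset.induction_on with
    | empty => simpa using h₀
    | insert a s ha ih =>
      convert step _ a (by simp [ha]) ih using 1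
      funext k
      by_cases hk : k = a
      · subst hk; simp
      · simp [hk]
  convert key (Finset.univ.filter fun n => h n = 1) using 1
  funext n
  rcases Fin.exists_fin_two.1 ⟨h n, rfl⟩ with hn | hn <;> simp [hn]

theorem spins_induction_down {P : Spins N → Prop} (h₁ : P fun _ => 1)
    (step : ∀ h n, h n = 1 → P h → P (Function.update h n 0)) (h : Spins N) : P h := by
  have := spins_induction (P := fun h => P fun n => 1 - h n) (by simpa using h₁) ?_
    (fun n => 1 - h n)
  · simpa using this
  · intro h n hn ih
    convert step _ n (by simp [hn]) ih using 1
    funext k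
    by_cases hk : k = n
    · subst hk; simp
    · simp [Function.update_of_ne hk]

/-- In a commuting product the new factor can be extracted on either side: the bra needs it last and
the ket needs it first. -/
theorem list_prod_pow_update {A : Type*} [Monoid A] {F : Fin N → A}
    (hF : ∀ i j, Commute (F i) (F j)) {e e' : Fin N → ℕ} {n : Fin N} (he : e n = 0)
    (he' : e' n = 1) (hne : ∀ k, k ≠ n → e' k = e k) :
    ((List.finRange N).map fun k => F k ^ e' k).prod =
      ((List.finRange N).map fun k => F k ^ e k).prod * F n ∧
    ((List.finRange N).map fun k => F k ^ e' k).prod =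
      F n * ((List.finRange N).map fun k => F k ^ e k).prod := by
  have hnd := List.nodup_finRange N
  rw [← finRange_take_drop n] at hnd ⊢
  set s := (List.finRange N).take n
  set t := (List.finRange N).drop (n + 1)
  rw [List.nodup_append', List.nodup_cons] at hnd
  have hs : s.map (fun k => F k ^ e' k) = s.map fun k => F k ^ e k :=
    List.map_congr_left fun k hk => by
      rw [hne k]; rintro rfl; exact hnd.2.2 hk (by simp)
  have ht : t.map (fun k => F k ^ e' k) = t.map fun k => F k ^ e k :=
    List.map_congr_left fun k hk => by
      rw [hne k]; rintro rfl; exact hnd.2.1.1 hk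
  have hc : ∀ l : List (Fin N), Commute (F n) (l.map fun k => F k ^ e k).prod := fun l =>
    Commute.list_prod_right _ _ fun x hx => by
      obtain ⟨k, -, rfl⟩ := List.mem_map.1 hx
      exact (hF n k).pow_right _
  simp only [List.map_append, List.map_cons, List.prod_append, List.prod_cons, hs, ht, he, he',
    pow_zero, pow_one, one_mul]
  constructor
  · rw [(hc t).eq, mul_assoc]
  · rw [← mul_assoc, ← mul_assoc, (hc s).eq]

end Shifts

/-! ### Action of A, B, D on the separated bases -/

section SoVBases

variable {N : ℕ} {K : Matrix (Fin 2) (Fin 2) ℂ} {k₁ η : ℂ} {ξ : Fin N → ℂ}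

theorem Generic.opA_commute (H : Generic K k₁ η ξ) (l μ : ℂ) :
    Commute (opA K η ξ l) (opA K η ξ μ) :=
  (rtt_twistedMonodromy K η ξ).commute H.eta_ne l μ 0 0

theorem Generic.leftSoV_update (H : Generic K k₁ η ξ) {h : Spins N} {n : Fin N} (hn : h n = 0) :
    leftSoV K k₁ η ξ (Function.update h n 1) =
      (k₁ * dFun ξ (ξ n - η))⁻¹ •
        Matrix.vecMul (leftSoV K k₁ η ξ h) (twistedMonodromy K η ξ (ξ n) 0 0) := by
  have := (list_prod_pow_update (F := fun n => (k₁ * dFun ξ (ξ n - η))⁻¹ • opA K η ξ (ξ n))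
    (fun i j => ((H.opA_commute _ _).smul_left _).smul_right _) (e := fun k => (h k : ℕ))
    (e' := fun k => (Function.update h n 1 k : ℕ)) (n := n) (by simp [hn]) (by simp)
    (fun k hk => by simp [Function.update_of_ne hk])).1
  rw [leftSoV, this, ← Matrix.vecMul_vecMul, Matrix.vecMul_smul]
  rfl

theorem Generic.rightSoVRaw_update (H : Generic K k₁ η ξ) {h : Spins N} {n : Fin N}
    (hn : h n = 1) :
    rightSoVRaw K k₁ η ξ (Function.update h n 0) =
      (k₁ * dFun ξ (ξ n - η))⁻¹ •
        (twistedMonodromy K η ξ (ξ n - η) 0 0).mulVec (rightSoVRaw K k₁ η ξ h) := by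
  have := (list_prod_pow_update (F := fun n => (k₁ * dFun ξ (ξ n - η))⁻¹ • opA K η ξ (ξ n - η))
    (fun i j => ((H.opA_commute _ _).smul_left _).smul_right _) (e := fun k => 1 - (h k : ℕ))
    (e' := fun k => 1 - (Function.update h n 0 k : ℕ)) (n := n) (by simp [hn]) (by simp)
    (fun k hk => by simp [Function.update_of_ne hk])).2
  rw [rightSoVRaw, this, ← Matrix.mulVec_mulVec, Matrix.smul_mulVec]
  rfl

/-- The left SoV basis diagonalizes the entry `B` of the monodromy matrix. -/
theorem Generic.leftSoV_vecMul_B (H : Generic K k₁ η ξ) (h : Spins N) (μ : ℂ) :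
    Matrix.vecMul (leftSoV K k₁ η ξ h) (twistedMonodromy K η ξ μ 0 1) =
      (K 0 1 * ∏ n, (μ - shifted η ξ h n)) • leftSoV K k₁ η ξ h := by
  induction h using spins_induction generalizing μ with
  | h₀ =>
    have : leftSoV K k₁ η ξ (fun _ => 0) = upBra N := by
      simp [leftSoV, ← upBra.eq_1]
    rw [this, vecMul_up_monodromy]
    simp [shifted]
  | step h n hn ih =>
    rw [H.leftSoV_update hn, Matrix.smul_vecMul, smul_comm]
    congr 1
    set v := leftSoV K k₁ η ξ h
    set w := Matrix.vecMul v (twistedMonodromy K η ξ (ξ n) 0 0)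
    rw [shifted_update]
    -- The exchange relation can be divided by ξ_n - μ only off μ = ξ_n; the missing value follows
    -- from continuity in μ.
    have hoff : ∀ μ, μ ∈ ({ξ n}ᶜ : Set ℂ) → Matrix.vecMul w (twistedMonodromy K η ξ μ 0 1) =
        (K 0 1 * ∏ k, (μ - Function.update (shifted η ξ h) n (ξ n - ((1 : Fin 2) : ℕ) * η) k)) •
          w := by
      intro μ hμ
      have hμ' : ξ n - μ ≠ 0 := sub_ne_zero.2 (Ne.symm hμ)
      have key := congrArg (Matrix.vecMul v)
        ((rtt_twistedMonodromy K η ξ).exchange_left (ξ n) μ)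
      simp only [Matrix.vecMul_add, Matrix.vecMul_smul, ← Matrix.vecMul_vecMul, ih,
        Matrix.smul_vecMul] at key
      -- The unwanted term contains B(ξ_n) acting on ⟨h|, whose eigenvalue vanishes because h_n = 0.
      have hz : ∏ k, (ξ n - shifted η ξ h k) = 0 :=
        Finset.prod_eq_zero (Finset.mem_univ n) (by rw [shifted_of_eq_zero η ξ hn, sub_self])
      rw [hz, mul_zero, zero_smul, smul_zero, add_zero, smul_smul] at key
      refine smul_right_injective _ hμ' (key.trans ?_)
      simp only [smul_smul]
      congr 1
      rw [← Finset.mul_prod_erase _ _ (Finset.mem_univ n),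
        ← Finset.mul_prod_erase _ _ (Finset.mem_univ n), Function.update_self,
        shifted_of_eq_zero η ξ hn]
      rw [prod_erase_sub_update]
      simp only [Fin.val_one, Nat.cast_one]
      ring
    have hc : Continuous fun μ : ℂ => (K 0 1 * ∏ k, (μ - Function.update (shifted η ξ h) n
        (ξ n - ((1 : Fin 2) : ℕ) * η) k)) • w := by fun_prop
    exact congrFun (Continuous.ext_on (dense_compl_singleton (ξ n))
      (continuous_vecMul_monodromy K η ξ 0 1 w) hc hoff) μ

/-- The right SoV basis diagonalizes the entry `B` of the monodromy matrix. -/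
theorem Generic.B_mulVec_rightSoVRaw (H : Generic K k₁ η ξ) (h : Spins N) (μ : ℂ) :
    (twistedMonodromy K η ξ μ 0 1).mulVec (rightSoVRaw K k₁ η ξ h) =
      (K 0 1 * ∏ n, (μ - shifted η ξ h n)) • rightSoVRaw K k₁ η ξ h := by
  induction h using spins_induction_down generalizing μ with
  | h₁ =>
    have : rightSoVRaw K k₁ η ξ (fun _ => 1) = downKet N := by
      simp [rightSoVRaw, ← downKet.eq_1]
    rw [this, monodromy_mulVec_down]
    simp [shifted, sub_add]
  | step h n hn ih =>
    rw [H.rightSoVRaw_update hn, Matrix.mulVec_smul, smul_comm]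
    congr 1
    set v := rightSoVRaw K k₁ η ξ h
    set w := (twistedMonodromy K η ξ (ξ n - η) 0 0).mulVec v
    rw [shifted_update]
    have hoff : ∀ μ, μ ∈ ({ξ n - η}ᶜ : Set ℂ) → (twistedMonodromy K η ξ μ 0 1).mulVec w =
        (K 0 1 * ∏ k, (μ - Function.update (shifted η ξ h) n (ξ n - ((0 : Fin 2) : ℕ) * η) k)) •
          w := by
      intro μ hμ
      have hμ' : ξ n - η - μ ≠ 0 := sub_ne_zero.2 (Ne.symm hμ)
      have key := congrArg (fun M => Matrix.mulVec M v)
        ((rtt_twistedMonodromy K η ξ).exchange_right (ξ n - η) μ)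
      simp only [Matrix.sub_mulVec, Matrix.smul_mulVec, ← Matrix.mulVec_mulVec, ih,
        Matrix.mulVec_smul] at key
      -- Here h_n = 1, so it is ξ_n - η that is a zero of the eigenvalue of B and removes the
      -- unwanted term.
      have hz : ∏ k, (ξ n - η - shifted η ξ h k) = 0 :=
        Finset.prod_eq_zero (Finset.mem_univ n) (by rw [shifted_of_eq_one η ξ hn, sub_self])
      rw [hz, mul_zero, zero_smul, smul_zero, sub_zero, smul_smul] at key
      refine smul_right_injective _ hμ' (key.trans ?_)
      simp only [smul_smul]
      congr 1
      rw [← Finset.mul_prod_erase _ _ (Finset.mem_univ n),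
        ← Finset.mul_prod_erase _ _ (Finset.mem_univ n), Function.update_self,
        shifted_of_eq_one η ξ hn]
      rw [prod_erase_sub_update]
      simp only [Fin.val_zero, Nat.cast_zero]
      ring
    have hc : Continuous fun μ : ℂ => (K 0 1 * ∏ k, (μ - Function.update (shifted η ξ h) n
        (ξ n - ((0 : Fin 2) : ℕ) * η) k)) • w := by fun_prop
    exact congrFun (Continuous.ext_on (dense_compl_singleton (ξ n - η))
      (continuous_mulVec_monodromy K η ξ 0 1 w) hc hoff) μ

theorem Generic.a_mul_a_eq_zero (H : Generic K k₁ η ξ) (n : Fin N) :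
    twistedMonodromy K η ξ (ξ n) 0 0 * twistedMonodromy K η ξ (ξ n - η) 0 0 = 0 := by
  have := (fusionAntisymm_twistedMonodromy K η ξ n).mul_self_eq_zero 0 0 0
  rw [sub_add_cancel] at this
  rw [← this]
  exact H.opA_commute _ _

/-- For h_n = 0 this is the recursion defining the basis. For h_n = 1 fusion gives A(ξ_n)A(ξ_n - η)
= 0, in agreement with d(ξ_n) = 0, so one formula covers both cases. -/
theorem Generic.leftSoV_vecMul_A (H : Generic K k₁ η ξ) (h : Spins N) (n : Fin N) :
    Matrix.vecMul (leftSoV K k₁ η ξ h) (twistedMonodromy K η ξ (shifted η ξ h n) 0 0) =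
      (k₁ * dFun ξ (shifted η ξ (flip h n) n)) • leftSoV K k₁ η ξ (flip h n) := by
  have hc : k₁ * dFun ξ (ξ n - η) ≠ 0 := mul_ne_zero H.k₁_ne (H.dFun_ne n)
  rcases Fin.exists_fin_two.1 ⟨h n, rfl⟩ with hn | hn
  · have hf : flip h n n = 1 := by simp [flip, hn]
    have hf' : flip h n = Function.update h n 1 := by simp [flip, hn]
    rw [shifted_of_eq_one η ξ hf, shifted_of_eq_zero η ξ hn, hf', H.leftSoV_update hn, smul_smul,
      mul_inv_cancel₀ hc, one_smul]
  · have hf : flip h n n = 0 := by simp [flip, hn]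
    have hf' : h = Function.update (flip h n) n 1 := by simp [flip, ← hn]
    rw [shifted_of_eq_zero η ξ hf, shifted_of_eq_one η ξ hn, dFun_xi, mul_zero, zero_smul]
    conv_lhs => rw [hf', H.leftSoV_update hf]
    rw [Matrix.smul_vecMul, Matrix.vecMul_vecMul, H.a_mul_a_eq_zero, Matrix.vecMul_zero, smul_zero]

theorem Generic.A_mulVec_rightSoVRaw (H : Generic K k₁ η ξ) (h : Spins N) (n : Fin N) :
    (twistedMonodromy K η ξ (shifted η ξ h n) 0 0).mulVec (rightSoVRaw K k₁ η ξ h) =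
      (k₁ * dFun ξ (shifted η ξ h n)) • rightSoVRaw K k₁ η ξ (flip h n) := by
  have hc : k₁ * dFun ξ (ξ n - η) ≠ 0 := mul_ne_zero H.k₁_ne (H.dFun_ne n)
  rcases Fin.exists_fin_two.1 ⟨h n, rfl⟩ with hn | hn
  · have hf : flip h n n = 1 := by simp [flip, hn]
    have hf' : h = Function.update (flip h n) n 0 := by simp [flip, ← hn]
    rw [shifted_of_eq_zero η ξ hn, dFun_xi, mul_zero, zero_smul]
    conv_lhs => rw [hf', H.rightSoVRaw_update hf]
    rw [Matrix.mulVec_smul, Matrix.mulVec_mulVec, H.a_mul_a_eq_zero, Matrix.zero_mulVec, smul_zero]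
  · have hf' : flip h n = Function.update h n 0 := by simp [flip, hn]
    rw [shifted_of_eq_one η ξ hn, hf', H.rightSoVRaw_update hn, smul_smul,
      mul_inv_cancel₀ hc, one_smul]

/-- With h_n = 1 the bra ends in A(ξ_n), and A(ξ_n)D(ξ_n - η) is the quantum determinant plus
B(ξ_n)C(ξ_n - η). The B term dies on the flipped bra, for which ξ_n is a zero of the eigenvalue. -/
theorem Generic.leftSoV_vecMul_D_of_one (H : Generic K k₁ η ξ) {h : Spins N} {n : Fin N}
    (hn : h n = 1) :
    Matrix.vecMul (leftSoV K k₁ η ξ h) (twistedMonodromy K η ξ (ξ n - η) 1 1) =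
      (K.det / k₁ * aFun η ξ (ξ n)) • leftSoV K k₁ η ξ (flip h n) := by
  have hf : flip h n n = 0 := by simp [flip, hn]
  have hf' : h = Function.update (flip h n) n 1 := by simp [flip, ← hn]
  have hq := (hasQDet_twistedMonodromy K η ξ).a_d_sub_b_c (rtt_twistedMonodromy K η ξ) H.eta_ne
    (ξ n - η)
  rw [sub_add_cancel, sub_eq_iff_eq_add] at hq
  conv_lhs => rw [hf', H.leftSoV_update hf]
  rw [Matrix.smul_vecMul, Matrix.vecMul_vecMul, hq, Matrix.vecMul_add, ← Matrix.vecMul_vecMul,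
    H.leftSoV_vecMul_B, Finset.prod_eq_zero (Finset.mem_univ n)
      (by rw [shifted_of_eq_zero η ξ hf, sub_self]), mul_zero, zero_smul, Matrix.zero_vecMul,
    add_zero, Matrix.vecMul_smul, Matrix.vecMul_one, smul_smul]
  congr 1
  have h₁ := H.dFun_ne n
  have h₂ := H.k₁_ne
  field_simp

theorem Generic.D_mulVec_rightSoVRaw_of_zero (H : Generic K k₁ η ξ) {h : Spins N} {n : Fin N}
    (hn : h n = 0) :
    (twistedMonodromy K η ξ (ξ n) 1 1).mulVec (rightSoVRaw K k₁ η ξ h) =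
      (K.det / k₁ * aFun η ξ (ξ n)) • rightSoVRaw K k₁ η ξ (flip h n) := by
  have hf : flip h n n = 1 := by simp [flip, hn]
  have hf' : h = Function.update (flip h n) n 0 := by simp [flip, ← hn]
  have hq := (hasQDet_twistedMonodromy K η ξ).d_a_sub_c_b (rtt_twistedMonodromy K η ξ) H.eta_ne
    (ξ n - η)
  rw [sub_add_cancel, sub_eq_iff_eq_add] at hq
  conv_lhs => rw [hf', H.rightSoVRaw_update hf]
  rw [Matrix.mulVec_smul, Matrix.mulVec_mulVec, hq, Matrix.add_mulVec, ← Matrix.mulVec_mulVec,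
    H.B_mulVec_rightSoVRaw, Finset.prod_eq_zero (Finset.mem_univ n)
      (by rw [shifted_of_eq_one η ξ hf, sub_self]), mul_zero, zero_smul, Matrix.mulVec_zero,
    add_zero, Matrix.smul_mulVec, Matrix.one_mulVec, smul_smul]
  congr 1
  have h₁ := H.dFun_ne n
  have h₂ := H.k₁_ne
  field_simp

theorem Generic.k₂_a_ne (H : Generic K k₁ η ξ) (n : Fin N) :
    K.det / k₁ * aFun η ξ (ξ n) ≠ 0 :=
  mul_ne_zero (div_ne_zero H.det_ne H.k₁_ne) (H.aFun_ne n)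

theorem d_mul_d_eq_zero (K : Matrix (Fin 2) (Fin 2) ℂ) (η : ℂ) (ξ : Fin N → ℂ) (n : Fin N) :
    twistedMonodromy K η ξ (ξ n - η) 1 1 * twistedMonodromy K η ξ (ξ n) 1 1 = 0 := by
  have := (fusionAntisymm_twistedMonodromy K η ξ n).mul_self_eq_zero 1 1 1
  rwa [sub_add_cancel] at this

/-- When h_n = 0 the bra is, up to the nonzero factor k₂ a(ξ_n), the image of its flip under D(ξ_n -
η). Fusion gives D(ξ_n - η)D(ξ_n) = 0, in agreement with a(ξ_n - η) = 0. -/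
theorem Generic.leftSoV_vecMul_D (H : Generic K k₁ η ξ) (h : Spins N) (n : Fin N) :
    Matrix.vecMul (leftSoV K k₁ η ξ h) (twistedMonodromy K η ξ (shifted η ξ h n) 1 1) =
      (K.det / k₁ * aFun η ξ (shifted η ξ (flip h n) n)) • leftSoV K k₁ η ξ (flip h n) := by
  rcases Fin.exists_fin_two.1 ⟨h n, rfl⟩ with hn | hn
  · have hf : flip h n n = 1 := by simp [flip, hn]
    have := H.leftSoV_vecMul_D_of_one hf
    rw [flip_flip] at this
    rw [shifted_of_eq_one η ξ hf, shifted_of_eq_zero η ξ hn, aFun_xi_sub, mul_zero, zero_smul]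
    refine smul_right_injective _ (H.k₂_a_ne n) ?_
    simp only
    rw [← Matrix.smul_vecMul, ← this, Matrix.vecMul_vecMul, d_mul_d_eq_zero, Matrix.vecMul_zero,
      smul_zero]
  · have hf : flip h n n = 0 := by simp [flip, hn]
    rw [shifted_of_eq_zero η ξ hf, shifted_of_eq_one η ξ hn, H.leftSoV_vecMul_D_of_one hn]

theorem Generic.D_mulVec_rightSoVRaw (H : Generic K k₁ η ξ) (h : Spins N) (n : Fin N) :
    (twistedMonodromy K η ξ (shifted η ξ h n) 1 1).mulVec (rightSoVRaw K k₁ η ξ h) =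
      (K.det / k₁ * aFun η ξ (shifted η ξ h n)) • rightSoVRaw K k₁ η ξ (flip h n) := by
  rcases Fin.exists_fin_two.1 ⟨h n, rfl⟩ with hn | hn
  · rw [shifted_of_eq_zero η ξ hn, H.D_mulVec_rightSoVRaw_of_zero hn]
  · have hf : flip h n n = 0 := by simp [flip, hn]
    have := H.D_mulVec_rightSoVRaw_of_zero hf
    rw [flip_flip] at this
    rw [shifted_of_eq_one η ξ hn, aFun_xi_sub, mul_zero, zero_smul]
    refine smul_right_injective _ (H.k₂_a_ne n) ?_
    simp only
    rw [← Matrix.mulVec_smul, ← this, Matrix.mulVec_mulVec, d_mul_d_eq_zero, Matrix.zero_mulVec,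
      smul_zero]

end SoVBases

/-! ### Action of A, B, D on left separate states -/

section LeftStates

variable {N : ℕ}

/-- The bra whose coefficients, up to a Vandermonde factor, are given by `F` in the left SoV
basis. -/
def bra (K : Matrix (Fin 2) (Fin 2) ℂ) (k₁ η : ℂ) (ξ : Fin N → ℂ) (F : Spins N → ℂ) :
    Spins N → ℂ :=
  ∑ h : Spins N, (F h * vand (shifted η ξ h)) • leftSoV K k₁ η ξ h

theorem bra_add (K : Matrix (Fin 2) (Fin 2) ℂ) (k₁ η : ℂ) (ξ : Fin N → ℂ) (F G : Spins N → ℂ) :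
    bra K k₁ η ξ (fun h => F h + G h) = bra K k₁ η ξ F + bra K k₁ η ξ G := by
  simp only [bra, add_mul, add_smul, Finset.sum_add_distrib]

theorem bra_smul (K : Matrix (Fin 2) (Fin 2) ℂ) (k₁ η : ℂ) (ξ : Fin N → ℂ) (c : ℂ)
    (F : Spins N → ℂ) : bra K k₁ η ξ (fun h => c * F h) = c • bra K k₁ η ξ F := by
  simp only [bra, mul_assoc, mul_smul, Finset.smul_sum]

theorem bra_sum (K : Matrix (Fin 2) (Fin 2) ℂ) (k₁ η : ℂ) (ξ : Fin N → ℂ) {ι : Type*}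
    (s : Finset ι) (F : ι → Spins N → ℂ) :
    bra K k₁ η ξ (fun h => ∑ i ∈ s, F i h) = ∑ i ∈ s, bra K k₁ η ξ (F i) := by
  simp only [bra, Finset.sum_mul, Finset.sum_smul]
  exact Finset.sum_comm

theorem leftState_eq_bra (K : Matrix (Fin 2) (Fin 2) ℂ) (k₁ η : ℂ) (ξ : Fin N → ℂ) (P : ℂ[X]) :
    leftState K k₁ η ξ P = bra K k₁ η ξ fun h => ∏ n, P.eval (shifted η ξ h n) := rfl

/-- Flipping one label is an involution of the configurations. The separate third argument of f
records the basis vector, so the substitution can move the flip from the vector to the coefficients.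
-/
theorem sum_flip {M : Type*} [AddCommMonoid M] (f : Spins N → Fin N → Spins N → M) :
    ∑ h, ∑ n, f h n (flip h n) = ∑ h, ∑ n, f (flip h n) n h := by
  rw [Finset.sum_comm, Finset.sum_comm (f := fun h n => f (flip h n) n h)]
  refine Finset.sum_congr rfl fun n _ => ?_
  refine Finset.sum_bij' (fun h _ => flip h n) (fun h _ => flip h n) ?_ ?_ ?_ ?_ ?_ <;>
    simp [flip_flip]

variable {K : Matrix (Fin 2) (Fin 2) ℂ} {k₁ η : ℂ} {ξ : Fin N → ℂ}

/-- The part of the Vandermonde product not involving site n is insensitive to the flip. This is why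
the weight V belongs in the definition of a separate state. -/
theorem Generic.vand_flip (H : Generic K k₁ η ξ) (h : Spins N) (n : Fin N) :
    vand (shifted η ξ (flip h n)) /
        ∏ k ∈ Finset.univ.erase n, (shifted η ξ (flip h n) n - shifted η ξ h k) =
      vand (shifted η ξ h) / ∏ k ∈ Finset.univ.erase n, (shifted η ξ h n - shifted η ξ h k) := by
  have h₁ : ∏ k ∈ Finset.univ.erase n, (shifted η ξ h n - shifted η ξ h k) ≠ 0 :=
    Finset.prod_ne_zero_iff.2 fun k hk =>
      sub_ne_zero.2 ((H.shifted_injective h).ne (Finset.ne_of_mem_erase hk).symm)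
  have h₂ : ∏ k ∈ Finset.univ.erase n, (shifted η ξ (flip h n) n - shifted η ξ h k) ≠ 0 :=
    Finset.prod_ne_zero_iff.2 fun k hk => by
      have := (H.shifted_injective (flip h n)).ne (Finset.ne_of_mem_erase hk).symm
      conv at this => rhs; rw [shifted_flip, Function.update_of_ne (Finset.ne_of_mem_erase hk)]
      exact sub_ne_zero.2 this
  rw [div_eq_div_iff h₂ h₁]
  conv_lhs => rw [shifted_flip]
  exact vand_update _ _ _

theorem prod_flip (f : ℂ → ℂ) (h : Spins N) (n : Fin N) :
    ∏ k, f (shifted η ξ (flip h n) k) =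
      f (shifted η ξ (flip h n) n) * ∏ k ∈ Finset.univ.erase n, f (shifted η ξ h k) := by
  rw [← Finset.mul_prod_erase _ _ (Finset.mem_univ n)]
  congr 1
  refine Finset.prod_congr rfl fun k hk => ?_
  rw [shifted_flip, Function.update_of_ne (Finset.ne_of_mem_erase hk)]

/-- The action on bras of an operator which flips the labels at the points of the spectrum. -/
theorem Generic.bra_vecMul (H : Generic K k₁ η ξ) {M : ℂ → Op N} {c : ℂ} {g : ℂ → ℂ}
    (hM : ∀ v s, PolyFun N (c * v s) fun l => Matrix.vecMul v (M l) s)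
    (hact : ∀ h n, Matrix.vecMul (leftSoV K k₁ η ξ h) (M (shifted η ξ h n)) =
      g (shifted η ξ (flip h n) n) • leftSoV K k₁ η ξ (flip h n))
    (F : Spins N → ℂ) (l : ℂ) :
    Matrix.vecMul (bra K k₁ η ξ F) (M l) = bra K k₁ η ξ fun h =>
      c * (∏ n, (l - shifted η ξ h n)) * F h +
        ∑ n, g (shifted η ξ h n) * (∏ k ∈ Finset.univ.erase n,
          (l - shifted η ξ h k) / (shifted η ξ h n - shifted η ξ h k)) * F (flip h n) := by
  have hexp : ∀ h, Matrix.vecMul (leftSoV K k₁ η ξ h) (M l) =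
      (c * ∏ n, (l - shifted η ξ h n)) • leftSoV K k₁ η ξ h +
      ∑ n, ((∏ k ∈ Finset.univ.erase n,
          (l - shifted η ξ h k) / (shifted η ξ h n - shifted η ξ h k)) *
          g (shifted η ξ (flip h n) n)) • leftSoV K k₁ η ξ (flip h n) := by
    intro h
    funext s
    rw [(hM _ s).eq_interpolate (H.shifted_injective h) l]
    simp only [hact, Pi.add_apply, Pi.smul_apply, Finset.sum_apply, smul_eq_mul]
    congr 1
    · ring
    · exact Finset.sum_congr rfl fun n _ => by ring
  rw [bra, Matrix.sum_vecMul]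
  simp only [Matrix.smul_vecMul, hexp, smul_add, Finset.smul_sum, Finset.sum_add_distrib, smul_smul]
  -- Relabelling h by its flip restores ⟨h| as the basis vector. The interpolation denominators then
  -- sit at the flipped point, and the Vandermonde ratio brings them back to the original one.
  have key := sum_flip (fun h n h' => (F h * vand (shifted η ξ h) *
    ((∏ k ∈ Finset.univ.erase n, (l - shifted η ξ h k) / (shifted η ξ h n - shifted η ξ h k)) *
      g (shifted η ξ h' n))) • leftSoV K k₁ η ξ h')
  rw [key, bra_add, bra_sum]
  congr 1
  · exact Finset.sum_congr rfl fun h _ => by congr 1; ring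
  · rw [Finset.sum_comm]
    refine Finset.sum_congr rfl fun n _ => Finset.sum_congr rfl fun h _ => ?_
    congr 1
    have h₁ : ∏ k ∈ Finset.univ.erase n, (l - shifted η ξ (flip h n) k) /
        (shifted η ξ (flip h n) n - shifted η ξ (flip h n) k) =
        (∏ k ∈ Finset.univ.erase n, (l - shifted η ξ h k)) /
        ∏ k ∈ Finset.univ.erase n, (shifted η ξ (flip h n) n - shifted η ξ h k) := by
      rw [← Finset.prod_div_distrib]
      refine Finset.prod_congr rfl fun k hk => ?_
      have : shifted η ξ (flip h n) k = shifted η ξ h k := by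
        rw [shifted_flip, Function.update_of_ne (Finset.ne_of_mem_erase hk)]
      rw [this]
    rw [h₁]
    beta_reduce
    rw [Finset.prod_div_distrib]
    linear_combination F (flip h n) * g (shifted η ξ h n) *
      (∏ k ∈ Finset.univ.erase n, (l - shifted η ξ h k)) * H.vand_flip h n

theorem Generic.bra_vecMul_A (H : Generic K k₁ η ξ) (F : Spins N → ℂ) (l : ℂ) :
    Matrix.vecMul (bra K k₁ η ξ F) (twistedMonodromy K η ξ l 0 0) = bra K k₁ η ξ fun h =>
      K 0 0 * (∏ n, (l - shifted η ξ h n)) * F h +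
        ∑ n, (k₁ * dFun ξ (shifted η ξ h n)) * (∏ k ∈ Finset.univ.erase n,
          (l - shifted η ξ h k) / (shifted η ξ h n - shifted η ξ h k)) * F (flip h n) :=
  H.bra_vecMul (g := fun z => k₁ * dFun ξ z) (polyFun_vecMul K η ξ 0 0) H.leftSoV_vecMul_A F l

theorem Generic.bra_vecMul_D (H : Generic K k₁ η ξ) (F : Spins N → ℂ) (l : ℂ) :
    Matrix.vecMul (bra K k₁ η ξ F) (twistedMonodromy K η ξ l 1 1) = bra K k₁ η ξ fun h =>
      K 1 1 * (∏ n, (l - shifted η ξ h n)) * F h +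
        ∑ n, (K.det / k₁ * aFun η ξ (shifted η ξ h n)) * (∏ k ∈ Finset.univ.erase n,
          (l - shifted η ξ h k) / (shifted η ξ h n - shifted η ξ h k)) * F (flip h n) :=
  H.bra_vecMul (g := fun z => K.det / k₁ * aFun η ξ z) (polyFun_vecMul K η ξ 1 1)
    H.leftSoV_vecMul_D F l

theorem Generic.bra_vecMul_B (H : Generic K k₁ η ξ) (F : Spins N → ℂ) (l : ℂ) :
    Matrix.vecMul (bra K k₁ η ξ F) (twistedMonodromy K η ξ l 0 1) = bra K k₁ η ξ fun h =>
      K 0 1 * (∏ n, (l - shifted η ξ h n)) * F h := by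
  rw [bra, Matrix.sum_vecMul]
  refine Finset.sum_congr rfl fun h _ => ?_
  rw [Matrix.smul_vecMul, H.leftSoV_vecMul_B, smul_smul]
  congr 1
  ring

/-- The polynomial `d`. -/
def dPoly (ξ : Fin N → ℂ) : ℂ[X] := rootPoly ξ Finset.univ

/-- The polynomial `a`. -/
def aPoly (η : ℂ) (ξ : Fin N → ℂ) : ℂ[X] := rootPoly (fun n => ξ n - η) Finset.univ

theorem eval_dPoly (ξ : Fin N → ℂ) (l : ℂ) : (dPoly ξ).eval l = dFun ξ l := by
  rw [dPoly, eval_rootPoly, dFun]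

theorem eval_aPoly (η : ℂ) (ξ : Fin N → ℂ) (l : ℂ) : (aPoly η ξ).eval l = aFun η ξ l := by
  rw [aPoly, eval_rootPoly, aFun]
  exact Finset.prod_congr rfl fun n _ => by ring

/-- The polynomial `d(z) P(z + η)` governing the action of `A` on separate states. -/
def shiftUp (η : ℂ) (ξ : Fin N → ℂ) (P : ℂ[X]) : ℂ[X] := dPoly ξ * P.comp (X + C η)

/-- The polynomial `a(z) P(z - η)` governing the action of `D` on separate states. -/
def shiftDown (η : ℂ) (ξ : Fin N → ℂ) (P : ℂ[X]) : ℂ[X] := aPoly η ξ * P.comp (X - C η)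

theorem eval_shiftUp (η : ℂ) (ξ : Fin N → ℂ) (P : ℂ[X]) (z : ℂ) :
    (shiftUp η ξ P).eval z = dFun ξ z * P.eval (z + η) := by
  simp [shiftUp, eval_dPoly]

theorem eval_shiftDown (η : ℂ) (ξ : Fin N → ℂ) (P : ℂ[X]) (z : ℂ) :
    (shiftDown η ξ P).eval z = aFun η ξ z * P.eval (z - η) := by
  simp [shiftDown, eval_aPoly]

/-- For h_n = 1 the flipped point is z + η; for h_n = 0 it is not, but there d vanishes. Thus the
label-dependent flip becomes evaluation of a single polynomial, as the residue identity requires. -/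
theorem dFun_mul_eval_flip (P : ℂ[X]) (h : Spins N) (n : Fin N) :
    dFun ξ (shifted η ξ h n) * P.eval (shifted η ξ (flip h n) n) =
      (shiftUp η ξ P).eval (shifted η ξ h n) := by
  rw [eval_shiftUp]
  rcases Fin.exists_fin_two.1 ⟨h n, rfl⟩ with hn | hn
  · rw [shifted_of_eq_zero η ξ hn, dFun_xi, zero_mul, zero_mul]
  · have hf : flip h n n = 0 := by simp [flip, hn]
    rw [shifted_of_eq_one η ξ hn, shifted_of_eq_zero η ξ hf, sub_add_cancel]

theorem aFun_mul_eval_flip (P : ℂ[X]) (h : Spins N) (n : Fin N) :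
    aFun η ξ (shifted η ξ h n) * P.eval (shifted η ξ (flip h n) n) =
      (shiftDown η ξ P).eval (shifted η ξ h n) := by
  rw [eval_shiftDown]
  rcases Fin.exists_fin_two.1 ⟨h n, rfl⟩ with hn | hn
  · have hf : flip h n n = 1 := by simp [flip, hn]
    rw [shifted_of_eq_zero η ξ hn, shifted_of_eq_one η ξ hf]
  · rw [shifted_of_eq_one η ξ hn, aFun_xi_sub, zero_mul, zero_mul]

/-- The coefficients of the image of a separate state under an entry of the monodromy matrix. -/
def actionCoeff (x : Fin N → ℂ) (c κ : ℂ) (f W : ℂ[X]) : ℂ :=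
  c * ∏ k, W.eval (x k) -
    κ * ∑ n, f.eval (x n) * ∏ k ∈ Finset.univ.erase n, W.eval (x k) / (x n - x k)

theorem prod_eval_mul_X_sub (x : Fin N → ℂ) (P : ℂ[X]) (l : ℂ) :
    ∏ k, (P * (X - C l)).eval (x k) = (-1) ^ N * ((∏ k, (l - x k)) * ∏ k, P.eval (x k)) := by
  have : ∀ k, (P * (X - C l)).eval (x k) = (-1) * ((l - x k) * P.eval (x k)) := by
    intro k; simp; ring
  simp only [this, Finset.prod_mul_distrib, Finset.prod_const, Finset.card_univ, Fintype.card_fin]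

theorem prod_erase_eval_mul_X_sub (x : Fin N → ℂ) (n : Fin N) (P : ℂ[X]) (l : ℂ) :
    ∏ k ∈ Finset.univ.erase n, (P * (X - C l)).eval (x k) / (x n - x k) =
      -((-1) ^ N * ((∏ k ∈ Finset.univ.erase n, (l - x k) / (x n - x k)) *
        ∏ k ∈ Finset.univ.erase n, P.eval (x k))) := by
  have : ∀ k, (P * (X - C l)).eval (x k) / (x n - x k) =
      (-1) * ((l - x k) / (x n - x k) * P.eval (x k)) := by
    intro k; simp; ring
  obtain ⟨M, rfl⟩ : ∃ M, N = M + 1 := ⟨N - 1, by have := n.pos; omega⟩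
  rw [Finset.prod_congr rfl fun k _ => this k, Finset.prod_mul_distrib, Finset.prod_const,
    Finset.card_erase_of_mem (Finset.mem_univ n), Finset.card_univ, Fintype.card_fin,
    Finset.prod_mul_distrib, Nat.add_sub_cancel, pow_succ]
  ring

/-- The interpolation factors l - x_k combine with the values P(x_k) into values of P · (X - l), up
to the sign (-1)^N: the action adjoins the root l. -/
theorem Generic.leftState_vecMul_A (H : Generic K k₁ η ξ) (P : ℂ[X]) (l : ℂ) :
    Matrix.vecMul (leftState K k₁ η ξ P) (twistedMonodromy K η ξ l 0 0) =
      (-1 : ℂ) ^ N • bra K k₁ η ξ fun h =>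
        actionCoeff (shifted η ξ h) (K 0 0) k₁ (shiftUp η ξ P) (P * (X - C l)) := by
  rw [leftState_eq_bra, H.bra_vecMul_A, ← bra_smul]
  congr 1
  funext h
  have hs : ((-1 : ℂ) ^ N) * (-1) ^ N = 1 := by rw [← mul_pow]; simp
  rw [actionCoeff, prod_eval_mul_X_sub, mul_sub, sub_eq_add_neg]
  congr 1
  · linear_combination (-(K 0 0 * ((∏ k, (l - shifted η ξ h k)) *
      ∏ k, P.eval (shifted η ξ h k)))) * hs
  · rw [Finset.mul_sum, Finset.mul_sum, ← Finset.sum_neg_distrib]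
    refine Finset.sum_congr rfl fun n _ => ?_
    rw [prod_erase_eval_mul_X_sub, prod_flip (fun z => P.eval z), ← dFun_mul_eval_flip]
    linear_combination (-(k₁ * dFun ξ (shifted η ξ h n) * P.eval (shifted η ξ (flip h n) n) *
      (∏ k ∈ Finset.univ.erase n, (l - shifted η ξ h k) / (shifted η ξ h n - shifted η ξ h k)) *
      ∏ k ∈ Finset.univ.erase n, P.eval (shifted η ξ h k))) * hs

theorem Generic.leftState_vecMul_D (H : Generic K k₁ η ξ) (P : ℂ[X]) (l : ℂ) :
    Matrix.vecMul (leftState K k₁ η ξ P) (twistedMonodromy K η ξ l 1 1) =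
      (-1 : ℂ) ^ N • bra K k₁ η ξ fun h =>
        actionCoeff (shifted η ξ h) (K 1 1) (K.det / k₁) (shiftDown η ξ P) (P * (X - C l)) := by
  rw [leftState_eq_bra, H.bra_vecMul_D, ← bra_smul]
  congr 1
  funext h
  have hs : ((-1 : ℂ) ^ N) * (-1) ^ N = 1 := by rw [← mul_pow]; simp
  rw [actionCoeff, prod_eval_mul_X_sub, mul_sub, sub_eq_add_neg]
  congr 1
  · linear_combination (-(K 1 1 * ((∏ k, (l - shifted η ξ h k)) *
      ∏ k, P.eval (shifted η ξ h k)))) * hs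
  · rw [Finset.mul_sum, Finset.mul_sum, ← Finset.sum_neg_distrib]
    refine Finset.sum_congr rfl fun n _ => ?_
    rw [prod_erase_eval_mul_X_sub, prod_flip (fun z => P.eval z), ← aFun_mul_eval_flip]
    linear_combination (-(K.det / k₁ * aFun η ξ (shifted η ξ h n) *
      P.eval (shifted η ξ (flip h n) n) *
      (∏ k ∈ Finset.univ.erase n, (l - shifted η ξ h k) / (shifted η ξ h n - shifted η ξ h k)) *
      ∏ k ∈ Finset.univ.erase n, P.eval (shifted η ξ h k))) * hs

theorem Generic.leftState_vecMul_B (H : Generic K k₁ η ξ) (P : ℂ[X]) (l : ℂ) :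
    Matrix.vecMul (leftState K k₁ η ξ P) (twistedMonodromy K η ξ l 0 1) =
      ((-1 : ℂ) ^ N * K 0 1) • leftState K k₁ η ξ (P * (X - C l)) := by
  have hs : ((-1 : ℂ) ^ N) * (-1) ^ N = 1 := by rw [← mul_pow]; simp
  rw [leftState_eq_bra, H.bra_vecMul_B, leftState_eq_bra, ← bra_smul]
  congr 1
  funext h
  rw [prod_eval_mul_X_sub]
  linear_combination (-(K 0 1 * ((∏ k, (l - shifted η ξ h k)) *
      ∏ k, P.eval (shifted η ξ h k)))) * hs

/-- On a separate state with the root `l`, the entry `D` at `l + η` factors through `B`. -/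
theorem Generic.leftState_vecMul_D_shift (H : Generic K k₁ η ξ) (hb : K 0 1 ≠ 0) (P : ℂ[X])
    (l : ℂ) :
    Matrix.vecMul (leftState K k₁ η ξ (P * (X - C l))) (twistedMonodromy K η ξ (l + η) 1 1) =
      (K 0 1)⁻¹ • Matrix.vecMul (bra K k₁ η ξ fun h =>
        actionCoeff (shifted η ξ h) (K 1 1) (K.det / k₁) (shiftDown η ξ P) (P * (X - C l)))
        (twistedMonodromy K η ξ (l + η) 0 1) := by
  rw [leftState_eq_bra, H.bra_vecMul_D, H.bra_vecMul_B, ← bra_smul]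
  congr 1
  funext h
  rw [← mul_assoc, ← mul_assoc, inv_mul_cancel₀ hb, one_mul, actionCoeff,
    mul_sub (∏ n, (l + η - shifted η ξ h n))]
  refine Eq.trans ?_ (sub_eq_add_neg _ _).symm
  congr 1
  · ring
  · rw [Finset.mul_sum, Finset.mul_sum, ← Finset.sum_neg_distrib]
    refine Finset.sum_congr rfl fun n _ => ?_
    have h₁ := aFun_mul_eval_flip (η := η) (ξ := ξ) (P * (X - C l)) h n
    -- The root l makes a(z)P(z-η) acquire the factor z - η - l, which at z = x_n is minus the one
    -- missing from the Lagrange numerator. The numerator thereby becomes the full eigenvalue of B(l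
    -- + η), up to b.
    have h₂ : (shiftDown η ξ (P * (X - C l))).eval (shifted η ξ h n) =
        -((l + η - shifted η ξ h n) * (shiftDown η ξ P).eval (shifted η ξ h n)) := by
      simp only [eval_shiftDown, eval_mul, eval_sub, eval_X, eval_C]; ring
    rw [prod_flip (η := η) (ξ := ξ) (fun z : ℂ => eval z (P * (X - C l))) h n,
      ← Finset.mul_prod_erase Finset.univ (fun k => l + η - shifted η ξ h k) (Finset.mem_univ n),
      Finset.prod_div_distrib, Finset.prod_div_distrib]
    rw [h₂] at h₁
    linear_combination (K.det / k₁ * ((∏ k ∈ Finset.univ.erase n, (l + η - shifted η ξ h k)) /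
      ∏ k ∈ Finset.univ.erase n, (shifted η ξ h n - shifted η ξ h k)) *
      ∏ k ∈ Finset.univ.erase n, (P * (X - C l)).eval (shifted η ξ h k)) * h₁

/-- The coefficients of the action in terms of the roots of the separate state. -/
theorem actionCoeff_eq (hN : 0 < N) {x : Fin N → ℂ} (hx : Function.Injective x) {ι : Type}
    [DecidableEq ι] (S : Finset ι) {q : ι → ℂ} (hq : Set.InjOn q S) {f : ℂ[X]} (hf : f.Monic)
    (hd : f.natDegree = S.card + (N - 1)) (c κ : ℂ) :
    actionCoeff x c κ f (rootPoly q S) = (c - κ) * ∏ k, (rootPoly q S).eval (x k) +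
      κ * ((-1) ^ N * ∑ a ∈ S, f.eval (q a) / (∏ b ∈ S.erase a, (q a - q b)) *
        ∏ k, (rootPoly q (S.erase a)).eval (x k)) := by
  have := sum_residues hN hx S hq hd.le
  rw [← hd, hf.coeff_natDegree, one_mul] at this
  rw [actionCoeff]
  linear_combination (-κ) * this

theorem monic_shiftUp (η : ℂ) (ξ : Fin N → ℂ) {P : ℂ[X]} (hP : P.Monic) :
    (shiftUp η ξ P).Monic :=
  (rootPoly_monic _ _).mul (hP.comp (monic_X_add_C η) (by simp))

theorem monic_shiftDown (η : ℂ) (ξ : Fin N → ℂ) {P : ℂ[X]} (hP : P.Monic) :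
    (shiftDown η ξ P).Monic :=
  (rootPoly_monic _ _).mul (hP.comp (monic_X_sub_C η) (by simp))

theorem natDegree_shiftUp (η : ℂ) (ξ : Fin N → ℂ) {P : ℂ[X]} (hP : P.Monic) :
    (shiftUp η ξ P).natDegree = N + P.natDegree := by
  rw [shiftUp, dPoly, (rootPoly_monic _ _).natDegree_mul (hP.comp (monic_X_add_C η) (by simp)),
    natDegree_rootPoly, natDegree_comp, natDegree_X_add_C]
  simp

theorem natDegree_shiftDown (η : ℂ) (ξ : Fin N → ℂ) {P : ℂ[X]} (hP : P.Monic) :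
    (shiftDown η ξ P).natDegree = N + P.natDegree := by
  rw [shiftDown, aPoly, (rootPoly_monic _ _).natDegree_mul (hP.comp (monic_X_sub_C η) (by simp)),
    natDegree_rootPoly, natDegree_comp, natDegree_X_sub_C]
  simp

end LeftStates

/-! ### Invertibility of B and the action of A in terms of roots -/

section LowerLeftEntry

variable {N : ℕ} {K : Matrix (Fin 2) (Fin 2) ℂ} {k₁ η : ℂ} {ξ : Fin N → ℂ} {ι : Type}
  [DecidableEq ι]

/-- The leading coefficient of B(l) is b times the identity, so det B(l) has leading coefficient a
power of b ≠ 0. Hence B(l) is invertible for all but finitely many l. -/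
theorem exists_poly_det_B (hb : K 0 1 ≠ 0) (η : ℂ) (ξ : Fin N → ℂ) :
    ∃ p : ℂ[X], p ≠ 0 ∧ ∀ l, p.eval l = (twistedMonodromy K η ξ l 0 1).det := by
  choose p hp hd hc using polyFun_twistedMonodromy K η ξ 0 1
  refine ⟨(Matrix.of p).det, ?_, fun l => ?_⟩
  · have key : (Matrix.of p).det.coeff (Fintype.card (Spins N) * N) =
        (Matrix.of fun u v => K 0 1 * (1 : Op N) u v).det := by
      rw [Matrix.det_apply, Matrix.det_apply, finsetSum_coeff]
      refine Finset.sum_congr rfl fun σ _ => ?_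
      rw [Units.smul_def, Units.smul_def, coeff_smul]
      congr 1
      have := coeff_prod_of_natDegree_le (Finset.univ : Finset (Spins N))
        (fun i => Matrix.of p (σ i) i) N (fun i _ => hd _ _)
      rw [Finset.card_univ] at this
      rw [this]
      exact Finset.prod_congr rfl fun i _ => hc _ _
    intro h0
    have h1 : (Matrix.of fun u v => K 0 1 * (1 : Op N) u v) = K 0 1 • (1 : Op N) := rfl
    rw [h0, coeff_zero, h1, Matrix.det_smul, Matrix.det_one, mul_one] at key
    exact pow_ne_zero _ hb key.symm
  · have h := RingHom.map_det (evalRingHom l) (Matrix.of p)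
    rw [coe_evalRingHom] at h
    rw [h]
    congr 1
    ext u v
    exact hp u v l

theorem eventually_eval_ne_zero {p : ℂ[X]} (hp : p ≠ 0) (x : ℂ) :
    ∀ᶠ l in nhdsWithin x {x}ᶜ, p.eval l ≠ 0 := by
  have hfin : {l | p.eval l = 0}.Finite := by
    refine p.roots.toFinset.finite_toSet.subset fun l hl => ?_
    simpa [hp] using hl
  have h₁ := (hfin.subset (Set.sdiff_subset (t := {x}))).isClosed.isOpen_compl.mem_nhds
    (show x ∈ ({l | p.eval l = 0} \ {x})ᶜ from fun h => h.2 rfl)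
  filter_upwards [nhdsWithin_le_nhds h₁, self_mem_nhdsWithin] with l hl hx h0
  exact hl ⟨h0, hx⟩

/-- The coefficient of the state with the root `q a` replaced by `l` in the action of `A(l)`. -/
def replaceCoeff (k₁ η : ℂ) (ξ : Fin N → ℂ) (q : ι → ℂ) (S : Finset ι) (a : ι) (l : ℂ) : ℂ :=
  k₁ * (dFun ξ (q a) * ∏ b ∈ S, (q a - q b + η)) /
    ((q a - l) * ∏ b ∈ S.erase a, (q a - q b))

/-- This is the residue form of the action for the roots of P together with l. Removing l again
gives the diagonal term and removing q_a replaces it by l; the diagonal term is kept separate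
because in the computation of C it meets the quantum determinant. -/
theorem Generic.leftState_vecMul_A_roots (H : Generic K k₁ η ξ) (hN : 0 < N) {q : ι → ℂ}
    {S : Finset ι} (hq : Set.InjOn q S) {l : ℂ} (hl : ∀ a ∈ S, q a ≠ l) :
    Matrix.vecMul (leftState K k₁ η ξ (rootPoly q S)) (twistedMonodromy K η ξ l 0 0) =
      ((-1) ^ N * (K 0 0 - k₁)) • leftState K k₁ η ξ (rootPoly q S * (X - C l)) +
      (k₁ * (dFun ξ l * (rootPoly q S).eval (l + η)) / (rootPoly q S).eval l) •
        leftState K k₁ η ξ (rootPoly q S) +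
      ∑ a ∈ S, replaceCoeff k₁ η ξ q S a l •
        leftState K k₁ η ξ (rootPoly q (S.erase a) * (X - C l)) := by
  -- The index `none` carries the adjoined root l, so that old and new roots form one injective
  -- family.
  set q' : Option ι → ℂ := fun o => o.elim l q with hq'
  have hroot : ∀ T : Finset ι, rootPoly q' (T.map Function.Embedding.some) = rootPoly q T := by
    intro T; simp [rootPoly, hq']
  have hinsert : ∀ T : Finset ι, rootPoly q' (Finset.insertNone T) = rootPoly q T * (X - C l) := by
    intro T
    simp [rootPoly, hq', Finset.insertNone, mul_comm]
  have hinj : Set.InjOn q' (Finset.insertNone S : Finset (Option ι)) := by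
    rintro (_ | a) ha (_ | b) hb hab
    · rfl
    · exact absurd hab.symm (hl b (by simpa using hb))
    · exact absurd hab (hl a (by simpa using ha))
    · exact congrArg some (hq (by simpa using ha) (by simpa using hb) hab)
  have hdeg : (shiftUp η ξ (rootPoly q S)).natDegree = (Finset.insertNone S).card + (N - 1) := by
    rw [natDegree_shiftUp η ξ (rootPoly_monic q S), natDegree_rootPoly, Finset.card_insertNone]
    omega
  have hs : ((-1 : ℂ) ^ N) * (-1) ^ N = 1 := by rw [← mul_pow]; simp
  have erase_none : (Finset.insertNone S).erase none = S.map Function.Embedding.some := by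
    ext (_ | a) <;> simp
  have erase_some : ∀ a, (Finset.insertNone S).erase (some a) = Finset.insertNone (S.erase a) := by
    intro a
    ext (_ | b) <;> simp
  rw [H.leftState_vecMul_A]
  simp only [leftState_eq_bra, ← bra_smul, ← bra_add, ← bra_sum]
  congr 1
  funext h
  have key := actionCoeff_eq hN (H.shifted_injective h) (Finset.insertNone S) hinj
    (monic_shiftUp η ξ (rootPoly_monic q S)) hdeg (K 0 0) k₁
  rw [hinsert] at key
  rw [key]
  have hsum : ∀ f : Option ι → ℂ,
      ∑ a ∈ Finset.insertNone S, f a = f none + ∑ a ∈ S, f (some a) := by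
    intro f
    simp [Finset.insertNone]
  have hprod : ∀ (T : Finset ι) (f : Option ι → ℂ),
      ∏ a ∈ Finset.insertNone T, f a = f none * ∏ a ∈ T, f (some a) := by
    intro T f
    simp [Finset.insertNone]
  rw [hsum]
  simp only [erase_none, erase_some, hprod, Finset.prod_map, hroot, hinsert]
  simp only [hq', Option.elim, Function.Embedding.some_apply, eval_shiftUp, replaceCoeff,
    eval_rootPoly, sub_add_eq_add_sub]
  have hdist : ∀ A t s : ℂ, (-1) ^ N * (A + k₁ * ((-1) ^ N * (t + s))) =
      (-1) ^ N * A + k₁ * t + k₁ * s := fun A t s => by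
    linear_combination (k₁ * (t + s)) * hs
  rw [hdist]
  congr 1
  · congr 1
    · ring
    · ring
  · rw [Finset.mul_sum]
    refine Finset.sum_congr rfl fun a _ => ?_
    ring

end LowerLeftEntry

/-! ### Action of the lower left entry C -/

section LowerLeftAction

variable {N : ℕ} {K : Matrix (Fin 2) (Fin 2) ℂ} {k₁ η : ℂ} {ξ : Fin N → ℂ} {ι : Type}
  [DecidableEq ι]

/-- The action of `P(μ) D(μ)` on the separate state of `P` is diagonal up to a term which factors
through `B(μ)`. -/
theorem Generic.exists_leftState_vecMul_D (H : Generic K k₁ η ξ) (hb : K 0 1 ≠ 0) (P : ℂ[X]) :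
    ∃ g : Spins N → ℂ[X], ∀ μ,
      P.eval μ • Matrix.vecMul (leftState K k₁ η ξ P) (twistedMonodromy K η ξ μ 1 1) =
        (K.det / k₁ * (shiftDown η ξ P).eval μ) • leftState K k₁ η ξ P +
          (K 0 1)⁻¹ • Matrix.vecMul (bra K k₁ η ξ fun h => (g h).eval μ)
            (twistedMonodromy K η ξ μ 0 1) := by
  set F : Spins N → ℂ := fun h => ∏ k, P.eval (shifted η ξ h k) with hF
  -- The coefficient of P(μ)⟨P|D(μ) minus the desired diagonal part, as a polynomial in μ. At a
  -- shifted point both reduce to k₂ a(x_n)P(x_n)P(x_n - η) ∏_{k≠n} P(x_k), so divisibility by ∏ (μ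
  -- - x_n), hence a factor B(μ), follows.
  let c : Spins N → ℂ[X] := fun h =>
    P * (C (K 1 1 * F h) * rootPoly (shifted η ξ h) Finset.univ +
      ∑ n, C (K.det / k₁ * aFun η ξ (shifted η ξ h n) * F (flip h n)) *
        Lagrange.basis Finset.univ (shifted η ξ h) n) - C (K.det / k₁ * F h) * shiftDown η ξ P
  have hroot : ∀ h n, (c h).eval (shifted η ξ h n) = 0 := by
    intro h n
    have hz : (rootPoly (shifted η ξ h) Finset.univ).eval (shifted η ξ h n) = 0 := by
      rw [eval_rootPoly]
      exact Finset.prod_eq_zero (Finset.mem_univ n) (sub_self _)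
    have hbasis : ∀ k, (Lagrange.basis Finset.univ (shifted η ξ h) k).eval (shifted η ξ h n) =
        if k = n then 1 else 0 := by
      intro k
      split_ifs with hk
      · subst hk
        exact Lagrange.eval_basis_self (H.shifted_injective h).injOn (Finset.mem_univ k)
      · exact Lagrange.eval_basis_of_ne hk (Finset.mem_univ n)
    simp only [c, eval_sub, eval_mul, eval_add, eval_finsetSum, eval_C, hz, hbasis, mul_zero,
      zero_add, mul_ite, mul_one, Finset.sum_ite_eq', Finset.mem_univ, if_true]
    have h₁ := aFun_mul_eval_flip (η := η) (ξ := ξ) P h n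
    simp only [hF]
    rw [prod_flip (fun z => P.eval z),
      ← Finset.mul_prod_erase Finset.univ (fun k => P.eval (shifted η ξ h k)) (Finset.mem_univ n)]
    linear_combination (P.eval (shifted η ξ h n) * (K.det / k₁) *
      ∏ k ∈ Finset.univ.erase n, P.eval (shifted η ξ h k)) * h₁
  have hdvd : ∀ h, rootPoly (shifted η ξ h) Finset.univ ∣ c h := fun h =>
    Finset.prod_dvd_of_coprime
      (fun i _ j _ hij => pairwise_coprime_X_sub_C (H.shifted_injective h) hij)
      fun n _ => dvd_iff_isRoot.2 (hroot h n)
  choose g hg using hdvd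
  refine ⟨g, fun μ => ?_⟩
  rw [leftState_eq_bra, H.bra_vecMul_D, H.bra_vecMul_B, ← bra_smul, ← bra_smul, ← bra_smul,
    ← bra_add]
  congr 1
  funext h
  have key := congrArg (eval μ) (hg h)
  simp only [c, eval_sub, eval_mul, eval_add, eval_finsetSum, eval_C, eval_rootPoly,
    eval_lagrange_basis] at key
  rw [← mul_assoc (K 0 1)⁻¹, ← mul_assoc (K 0 1)⁻¹, inv_mul_cancel₀ hb, one_mul, ← key]
  have hsum : ∑ n, K.det / k₁ * aFun η ξ (shifted η ξ h n) *
      (∏ k ∈ Finset.univ.erase n, (μ - shifted η ξ h k) / (shifted η ξ h n - shifted η ξ h k)) *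
        F (flip h n) = ∑ n, K.det / k₁ * aFun η ξ (shifted η ξ h n) * F (flip h n) *
      ∏ k ∈ Finset.univ.erase n, (μ - shifted η ξ h k) / (shifted η ξ h n - shifted η ξ h k) :=
    Finset.sum_congr rfl fun n _ => by ring
  rw [hsum]
  ring

theorem continuous_bra {F : ℂ → Spins N → ℂ} (hF : ∀ h, Continuous fun l => F l h) :
    Continuous fun l => bra K k₁ η ξ (F l) := by
  unfold bra
  fun_prop

/-- The action of `C(ξ n)` on a separate state, in terms of its roots. -/
theorem Generic.leftState_vecMul_C (H : Generic K k₁ η ξ) (hb : K 0 1 ≠ 0) {q : ι → ℂ}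
    {S : Finset ι} (hq : Set.InjOn q S) (n : Fin N) (hn : ∀ a ∈ S, q a ≠ ξ n) :
    Matrix.vecMul (leftState K k₁ η ξ (rootPoly q S)) (twistedMonodromy K η ξ (ξ n) 1 0) =
      (K 0 1)⁻¹ • (((-1) ^ N * (K 0 0 - k₁)) • (bra K k₁ η ξ fun h =>
          actionCoeff (shifted η ξ h) (K 1 1) (K.det / k₁) (shiftDown η ξ (rootPoly q S))
            (rootPoly q S * (X - C (ξ n)))) +
        ∑ a ∈ S, replaceCoeff k₁ η ξ q S a (ξ n) • (bra K k₁ η ξ fun h =>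
          actionCoeff (shifted η ξ h) (K 1 1) (K.det / k₁)
            (shiftDown η ξ (rootPoly q (S.erase a)))
            (rootPoly q (S.erase a) * (X - C (ξ n))))) := by
  have hN : 0 < N := n.pos
  set P := rootPoly q S with hP
  obtain ⟨g, hg⟩ := H.exists_leftState_vecMul_D hb P
  have hPn : P.eval (ξ n) ≠ 0 := by
    rw [hP, eval_rootPoly]
    exact Finset.prod_ne_zero_iff.2 fun a ha => sub_ne_zero.2 (hn a ha).symm
  let Γ : ℂ[X] → ℂ → Spins N → ℂ := fun W l => bra K k₁ η ξ fun h =>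
    actionCoeff (shifted η ξ h) (K 1 1) (K.det / k₁) (shiftDown η ξ W) (W * (X - C l))
  have hΓc : ∀ W, Continuous (Γ W) := by
    intro W
    refine continuous_bra fun h => ?_
    simp only [actionCoeff, eval_mul, eval_sub, eval_X, eval_C]
    fun_prop
  -- The expected value of ⟨P|C(l) at generic l. Its last summand is the part of the diagonal term
  -- that factors through B(l + η); it carries d(l) and so vanishes at l = ξ_n.
  let E : ℂ → Spins N → ℂ := fun l =>
    (K 0 1)⁻¹ • (((-1) ^ N * (K 0 0 - k₁)) • Γ P l +
        ∑ a ∈ S, replaceCoeff k₁ η ξ q S a l • Γ (rootPoly q (S.erase a)) l) +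
      (k₁ * dFun ξ l / P.eval l) • (K 0 1)⁻¹ • bra K k₁ η ξ fun h => (g h).eval (l + η)
  have hE : ContinuousAt E (ξ n) := by
    have h₁ : ∀ a ∈ S, ContinuousAt (fun l => replaceCoeff k₁ η ξ q S a l) (ξ n) := by
      intro a ha
      unfold replaceCoeff
      refine ContinuousAt.div (by fun_prop) (by fun_prop) ?_
      refine mul_ne_zero (sub_ne_zero.2 (hn a ha)) (Finset.prod_ne_zero_iff.2 fun b hb' => ?_)
      have hb'' := Finset.mem_erase.1 hb'
      exact sub_ne_zero.2 fun h => hb''.1 (hq ha hb''.2 h).symm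
    have h₂ : Continuous fun l => dFun ξ l := by unfold dFun; fun_prop
    refine ContinuousAt.add (ContinuousAt.fun_const_smul (ContinuousAt.add ?_ ?_) (K 0 1)⁻¹)
      (ContinuousAt.fun_smul ?_ ?_)
    · exact ((hΓc P).continuousAt).fun_const_smul ((-1 : ℂ) ^ N * (K 0 0 - k₁))
    · exact tendsto_finsetSum _ fun a ha => (h₁ a ha).smul (hΓc _).continuousAt
    · exact (continuous_const.mul h₂).continuousAt.div P.continuous.continuousAt hPn
    · exact ((continuous_bra fun h =>
        (g h).continuous.comp (continuous_add_const η)).continuousAt).fun_const_smul (K 0 1)⁻¹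
  have hev : ∀ᶠ l in nhdsWithin (ξ n) {ξ n}ᶜ,
      Matrix.vecMul (leftState K k₁ η ξ P) (twistedMonodromy K η ξ l 1 0) = E l := by
    obtain ⟨p, hp₀, hp⟩ := exists_poly_det_B hb η ξ
    have hp₁ : p.comp (X + C η) ≠ 0 := by
      intro h
      rcases comp_eq_zero_iff.1 h with h | h
      · exact hp₀ h
      · have := congrArg natDegree h.2
        simp at this
    have hP₀ : P ≠ 0 := (rootPoly_monic q S).ne_zero
    filter_upwards [eventually_eval_ne_zero hp₁ (ξ n), eventually_eval_ne_zero hP₀ (ξ n)]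
      with l hl₁ hl₂
    rw [eval_comp, eval_add, eval_X, eval_C, hp] at hl₁
    rw [hP, eval_rootPoly, Finset.prod_ne_zero_iff] at hl₂
    have hql : ∀ a ∈ S, q a ≠ l := fun a ha h => hl₂ a ha (sub_eq_zero.2 h.symm)
    -- Away from finitely many l it suffices to compare both sides after multiplication by the
    -- invertible B(l + η).
    refine Matrix.vecMul_injective_of_isUnit
      ((Matrix.isUnit_iff_isUnit_det _).2 (isUnit_iff_ne_zero.2 hl₁)) ?_
    have hqd := (hasQDet_twistedMonodromy K η ξ).a_d_sub_c_b l
    rw [sub_eq_iff_eq_add'] at hqd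
    have hqd' := congrArg (Matrix.vecMul (leftState K k₁ η ξ P)) hqd
    rw [Matrix.vecMul_add, ← Matrix.vecMul_vecMul, ← Matrix.vecMul_vecMul,
      Matrix.vecMul_smul, Matrix.vecMul_one, H.leftState_vecMul_A_roots hN hq hql] at hqd'
    simp only [Matrix.add_vecMul, Matrix.smul_vecMul, Matrix.sum_vecMul,
      H.leftState_vecMul_D_shift hb] at hqd'
    have hgl := congrArg (fun v => (k₁ * dFun ξ l / P.eval l) • v) (hg (l + η))
    simp only [smul_smul, smul_add] at hgl
    have hPl : P.eval l ≠ 0 := by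
      rw [hP, eval_rootPoly]
      exact Finset.prod_ne_zero_iff.2 hl₂
    have hc₁ : k₁ * (dFun ξ l * P.eval (l + η)) / P.eval l =
        k₁ * dFun ξ l / P.eval l * P.eval (l + η) := by ring
    -- The scalar part of the diagonal term is k₁ d(l) · k₂ a(l + η) with k₁k₂ = det K, which
    -- cancels the quantum determinant exactly. Everything left factors through B(l + η).
    have hc₂ : k₁ * dFun ξ l / P.eval l * (K.det / k₁ * (shiftDown η ξ P).eval (l + η)) =
        K.det * (dFun ξ l * aFun η ξ (l + η)) := by
      have := H.k₁_ne
      rw [eval_shiftDown, add_sub_cancel_right]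
      field_simp
    rw [← hP, hc₁, hgl, hc₂] at hqd'
    simp only [E, Γ, Matrix.add_vecMul, Matrix.smul_vecMul, Matrix.sum_vecMul, smul_add,
      Finset.smul_sum]
    simp only [smul_comm (K 0 1)⁻¹ (replaceCoeff k₁ η ξ q S _ l)]
    linear_combination (norm := module) -hqd'
  -- Both sides are continuous at ξ_n, so the generic identity passes to the limit even if B(ξ_n +
  -- η) is singular.
  have hlim := tendsto_nhds_unique
    (((continuous_vecMul_monodromy K η ξ 1 0 _).tendsto (ξ n)).mono_left nhdsWithin_le_nhds)
    ((hE.tendsto.mono_left nhdsWithin_le_nhds).congr' (hev.mono fun l hl => hl.symm))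
  rw [hlim]
  simp only [E, dFun_xi, mul_zero, zero_div, zero_smul, add_zero]
  rfl

end LowerLeftAction

/-! ### One formula for all four entries at an inhomogeneity -/

section SiteAction

variable {N : ℕ} {K : Matrix (Fin 2) (Fin 2) ℂ} {k₁ η : ℂ} {ξ : Fin N → ℂ} {ι : Type}
  [DecidableEq ι]

/-- The coefficient attached to the removal of the root `q a` by the factor `A` of an entry of the
monodromy matrix at `q r`. -/
def minusCoeff (k₁ η : ℂ) (ξ : Fin N → ℂ) (q : ι → ℂ) (S : Finset ι) (r a : ι) : ℂ :=
  k₁ * dFun ξ (q a) * (∏ b ∈ S.erase r, (q a - q b + η)) / ∏ b ∈ S.erase a, (q a - q b)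

/-- The coefficient attached to the removal of the root `q a` by the factor `D` of an entry of the
monodromy matrix at `q r`. -/
def plusCoeff (k₂ η : ℂ) (ξ : Fin N → ℂ) (q : ι → ℂ) (S : Finset ι) (r a : ι) : ℂ :=
  k₂ * aFun η ξ (q a) * (∏ b ∈ S.erase r, (q b - q a + η)) / ∏ b ∈ S.erase a, (q b - q a)

/-- The weight of removing at most one root by the factor `A`. -/
def minusWeight (K : Matrix (Fin 2) (Fin 2) ℂ) (k₁ η : ℂ) (ξ : Fin N → ℂ) (q : ι → ℂ)
    (S : Finset ι) (r : ι) (e : Fin 2) (o : Option ι) : ℂ :=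
  o.elim (if e = 0 then K 0 0 - k₁ else 1)
    fun a => if e = 0 ∧ a ∈ S then (-1) ^ N * minusCoeff k₁ η ξ q S r a else 0

/-- The weight of removing at most one root by the factor `D`. -/
def plusWeight (K : Matrix (Fin 2) (Fin 2) ℂ) (k₂ η : ℂ) (ξ : Fin N → ℂ) (q : ι → ℂ)
    (S : Finset ι) (r : ι) (e : Fin 2) (o : Option ι) : ℂ :=
  o.elim (if e = 1 then K 1 1 - k₂ else 1)
    fun a => if e = 1 ∧ a ∈ S then (-1) ^ N * plusCoeff k₂ η ξ q S r a else 0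

theorem rootPoly_insert (q : ι → ℂ) {S : Finset ι} {r : ι} (hr : r ∉ S) :
    rootPoly q (insert r S) = rootPoly q S * (X - C (q r)) := by
  rw [rootPoly, Finset.prod_insert hr, mul_comm, ← rootPoly]

/-- Reversing all differences costs the same sign in numerator and denominator, since each product
has as many factors as S has elements. -/
theorem plusCoeff_insert (k₂ η : ℂ) (ξ : Fin N → ℂ) (q : ι → ℂ) {S : Finset ι} {r a : ι}
    (hr : r ∉ S) (ha : a ∈ insert r S) :
    plusCoeff k₂ η ξ q (insert r S) r a = k₂ * ((shiftDown η ξ (rootPoly q S)).eval (q a) /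
      ∏ b ∈ (insert r S).erase a, (q a - q b)) := by
  have hcard : ((insert r S).erase a).card = S.card := by
    rw [Finset.card_erase_of_mem ha, Finset.card_insert_of_notMem hr, Nat.add_sub_cancel]
  have h₁ : ∏ b ∈ S, (q b - q a + η) = (-1) ^ S.card * ∏ b ∈ S, (q a - η - q b) := by
    rw [← Finset.prod_const, ← Finset.prod_mul_distrib]
    exact Finset.prod_congr rfl fun b _ => by ring
  have h₂ : ∏ b ∈ (insert r S).erase a, (q b - q a) =
      (-1) ^ S.card * ∏ b ∈ (insert r S).erase a, (q a - q b) := by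
    rw [← hcard, ← Finset.prod_const, ← Finset.prod_mul_distrib]
    exact Finset.prod_congr rfl fun b _ => by ring
  have h₃ : ((-1 : ℂ)) ^ S.card ≠ 0 := pow_ne_zero _ (by norm_num)
  rw [plusCoeff, Finset.erase_insert hr, h₁, h₂, eval_shiftDown, eval_rootPoly,
    show k₂ * aFun η ξ (q a) * ((-1) ^ S.card * ∏ b ∈ S, (q a - η - q b)) =
      (-1) ^ S.card * (k₂ * (aFun η ξ (q a) * ∏ b ∈ S, (q a - η - q b))) by ring,
    mul_div_mul_left _ _ h₃, mul_div_assoc]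

theorem replaceCoeff_eq (q : ι → ℂ) {S : Finset ι} {r a : ι} (hr : r ∉ S) (ha : a ∈ S) :
    replaceCoeff k₁ η ξ q S a (q r) = minusCoeff k₁ η ξ q (insert r S) r a := by
  have har : a ≠ r := fun h => hr (h ▸ ha)
  rw [replaceCoeff, minusCoeff, Finset.erase_insert hr, Finset.erase_insert_of_ne har.symm,
    Finset.prod_insert (fun h => hr (Finset.mem_of_mem_erase h)), mul_assoc]

variable [Fintype ι]

/-- The combination of separate states produced by the factor `D`. -/
def plusState (K : Matrix (Fin 2) (Fin 2) ℂ) (k₁ η : ℂ) (ξ : Fin N → ℂ) (q : ι → ℂ)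
    (S : Finset ι) (r : ι) (e : Fin 2) : Spins N → ℂ :=
  ∑ o : Option ι, plusWeight K (K.det / k₁) η ξ q S r e o •
    leftState K k₁ η ξ (rootPoly q (S \ o.toFinset))

theorem sum_ite_mem_smul {M : Type*} [AddCommGroup M] [Module ℂ M] (S : Finset ι) (f : ι → ℂ)
    (v : ι → M) : ∑ a, (if a ∈ S then f a else 0) • v a = ∑ a ∈ S, f a • v a := by
  simp [ite_smul, Finset.sum_ite_mem]

theorem plusState_zero (q : ι → ℂ) (S : Finset ι) (r : ι) :
    plusState K k₁ η ξ q S r 0 = leftState K k₁ η ξ (rootPoly q S) := by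
  simp [plusState, plusWeight, Fintype.sum_option]

theorem plusState_one (q : ι → ℂ) (S : Finset ι) (r : ι) :
    plusState K k₁ η ξ q S r 1 = (K 1 1 - K.det / k₁) • leftState K k₁ η ξ (rootPoly q S) +
      ∑ a ∈ S, ((-1) ^ N * plusCoeff (K.det / k₁) η ξ q S r a) •
        leftState K k₁ η ξ (rootPoly q (S.erase a)) := by
  rw [plusState, Fintype.sum_option]
  simp only [plusWeight, Option.elim, if_true, true_and, sum_ite_mem_smul, Option.toFinset_none,
    Option.toFinset_some, Finset.sdiff_empty, Finset.sdiff_singleton_eq_erase]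

/-- The residue identity applied to the roots in S and the adjoined root q_r. Since a(z)P(z-η) is
monic, the undisturbed state receives exactly the weight d - k₂. -/
theorem Generic.bra_actionCoeff_D (H : Generic K k₁ η ξ) (hN : 0 < N) {q : ι → ℂ} {S : Finset ι}
    {r : ι} (hr : r ∉ S) (hq : Set.InjOn q (insert r S : Finset ι)) :
    (bra K k₁ η ξ fun h => actionCoeff (shifted η ξ h) (K 1 1) (K.det / k₁)
      (shiftDown η ξ (rootPoly q S)) (rootPoly q S * (X - C (q r)))) =
      plusState K k₁ η ξ q (insert r S) r 1 := by
  have hdeg : (shiftDown η ξ (rootPoly q S)).natDegree = (insert r S).card + (N - 1) := by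
    rw [natDegree_shiftDown η ξ (rootPoly_monic q S), natDegree_rootPoly,
      Finset.card_insert_of_notMem hr]
    omega
  rw [plusState_one, ← rootPoly_insert q hr]
  simp only [leftState_eq_bra, ← bra_smul, ← bra_sum, ← bra_add]
  congr 1
  funext h
  rw [actionCoeff_eq hN (H.shifted_injective h) (insert r S) hq
    (monic_shiftDown η ξ (rootPoly_monic q S)) hdeg]
  congr 1
  rw [Finset.mul_sum, Finset.mul_sum]
  refine Finset.sum_congr rfl fun a ha => ?_
  rw [plusCoeff_insert _ η ξ q hr ha]
  ring

/-- The action of an entry of the monodromy matrix at an inhomogeneity on a separate state. -/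
theorem Generic.leftState_vecMul_entry (H : Generic K k₁ η ξ) (hb : K 0 1 ≠ 0) {q : ι → ℂ}
    {S : Finset ι} {r : ι} (hr : r ∉ S) (hq : Set.InjOn q (insert r S : Finset ι)) {n : Fin N}
    (hn : q r = ξ n) (e e' : Fin 2) :
    Matrix.vecMul (leftState K k₁ η ξ (rootPoly q S)) (twistedMonodromy K η ξ (ξ n) e' e) =
      ((-1) ^ N * K 0 1 ^ ((1 : ℤ) - (if e = 0 then 1 else 0) - if e' = 1 then 1 else 0)) •
        ∑ o : Option ι, minusWeight K k₁ η ξ q (insert r S) r e o •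
          plusState K k₁ η ξ q (insert r S \ o.toFinset) r e' := by
  have hN : 0 < N := n.pos
  have hs : ((-1 : ℂ) ^ N) * (-1) ^ N = 1 := by rw [← mul_pow]; simp
  have hqS : Set.InjOn q S := hq.mono (by simp)
  have hnS : ∀ a ∈ S, q a ≠ ξ n := fun a ha h =>
    hr (hq (by simp [ha]) (by simp) (h.trans hn.symm) ▸ ha)
  have hone : ∀ f : Finset ι → Spins N → ℂ,
      ∑ o : Option ι, minusWeight K k₁ η ξ q (insert r S) r 1 o • f (insert r S \ o.toFinset) =
        f (insert r S) := by
    intro f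
    simp [minusWeight, Fintype.sum_option]
  have hzero : ∀ f : Finset ι → Spins N → ℂ,
      ∑ o : Option ι, minusWeight K k₁ η ξ q (insert r S) r 0 o • f (insert r S \ o.toFinset) =
        (K 0 0 - k₁) • f (insert r S) +
          ∑ a ∈ S, ((-1) ^ N * replaceCoeff k₁ η ξ q S a (ξ n)) • f (insert r (S.erase a)) := by
    intro f
    rw [Fintype.sum_option]
    simp only [minusWeight, Option.elim, if_true, true_and, sum_ite_mem_smul, Option.toFinset_none,
      Option.toFinset_some, Finset.sdiff_empty, Finset.sdiff_singleton_eq_erase]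
    congr 1
    rw [Finset.sum_insert hr]
    -- A removal of A type never removes the root just adjoined, because d(ξ_n) = 0; the sum may
    -- therefore range over the enlarged set.
    have h0 : minusCoeff k₁ η ξ q (insert r S) r r = 0 := by
      rw [minusCoeff, hn, dFun_xi]; simp
    rw [h0, mul_zero, zero_smul, zero_add]
    refine Finset.sum_congr rfl fun a ha => ?_
    have har : a ≠ r := fun h => hr (h ▸ ha)
    rw [← replaceCoeff_eq q hr ha, hn, Finset.erase_insert_of_ne har.symm]
  have hbra : ∀ a ∈ S, (bra K k₁ η ξ fun h => actionCoeff (shifted η ξ h) (K 1 1) (K.det / k₁)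
      (shiftDown η ξ (rootPoly q (S.erase a))) (rootPoly q (S.erase a) * (X - C (ξ n)))) =
      plusState K k₁ η ξ q (insert r (S.erase a)) r 1 := by
    intro a _
    rw [← hn, H.bra_actionCoeff_D hN (fun h => hr (Finset.mem_of_mem_erase h))]
    exact hq.mono (by
      intro x hx
      simp only [Finset.coe_insert, Finset.coe_erase, Set.mem_insert_iff, Set.mem_sdiff] at hx ⊢
      tauto)
  have hins : ∀ a ∈ S, rootPoly q (S.erase a) * (X - C (ξ n)) =
      rootPoly q (insert r (S.erase a)) := by
    intro a _
    rw [rootPoly_insert q (fun h => hr (Finset.mem_of_mem_erase h)), hn]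
  rcases Fin.exists_fin_two.1 ⟨e, rfl⟩ with rfl | rfl <;>
    rcases Fin.exists_fin_two.1 ⟨e', rfl⟩ with rfl | rfl
  · rw [H.leftState_vecMul_A_roots hN hqS hnS, hzero fun T => plusState K k₁ η ξ q T r 0]
    simp only [plusState_zero, dFun_xi, zero_mul, mul_zero, zero_div, zero_smul, add_zero]
    rw [rootPoly_insert q hr, hn, smul_add, smul_smul, Finset.smul_sum]
    simp only [if_true, sub_self, if_neg (show (0 : Fin 2) ≠ 1 by decide), zpow_zero,
      mul_one]
    congr 1
    refine Finset.sum_congr rfl fun a ha => ?_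
    rw [smul_smul, ← mul_assoc, hs, one_mul, hins a ha]
  · rw [H.leftState_vecMul_C hb hqS n hnS, hzero fun T => plusState K k₁ η ξ q T r 1, ← hn,
      H.bra_actionCoeff_D hN hr hq, hn, Finset.sum_congr rfl fun a ha => by rw [hbra a ha]]
    simp only [if_true, sub_self, zero_sub, zpow_neg, zpow_one]
    rw [mul_comm ((-1) ^ N) (K 0 1)⁻¹, mul_smul (K 0 1)⁻¹]
    congr 1
    rw [smul_add, smul_smul, Finset.smul_sum]
    congr 1
    refine Finset.sum_congr rfl fun a ha => ?_
    rw [smul_smul, ← mul_assoc, hs, one_mul]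
  · rw [hone fun T => plusState K k₁ η ξ q T r 0, H.leftState_vecMul_B, plusState_zero,
      rootPoly_insert q hr, hn]
    simp
  · rw [hone fun T => plusState K k₁ η ξ q T r 1, H.leftState_vecMul_D, ← hn,
      H.bra_actionCoeff_D hN hr hq]
    simp

end SiteAction

/-! ### Iteration over the sites: sequences of optional removals -/

section Iteration

variable {N : ℕ} {K : Matrix (Fin 2) (Fin 2) ℂ} {k₁ η : ℂ} {ξ : Fin N → ℂ}

/-- The indices which are not removed by the first `j` of a sequence of removals. -/
def available {ι : Type} [Fintype ι] [DecidableEq ι] {M : ℕ} (g : Fin M → Option ι × Option ι)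
    (j : ℕ) : Finset ι :=
  Finset.univ.filter fun b => ∀ k : Fin M, (k : ℕ) < j → (g k).1 ≠ some b ∧ (g k).2 ≠ some b

theorem available_snoc {ι : Type} [Fintype ι] [DecidableEq ι] {M : ℕ}
    (g : Fin M → Option ι × Option ι) (o : Option ι × Option ι) {j : ℕ} (hj : j ≤ M) :
    available (Fin.snoc (α := fun _ => Option ι × Option ι) g o) j = available g j := by
  ext b
  simp only [available, Finset.mem_filter, Finset.mem_univ, true_and, Fin.forall_fin_succ',
    Fin.snoc_castSucc, Fin.snoc_last, Fin.val_castSucc, Fin.val_last]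
  exact ⟨fun h => h.1, fun h => ⟨h, fun h' => by omega⟩⟩

theorem available_snoc_succ {ι : Type} [Fintype ι] [DecidableEq ι] {M : ℕ}
    (g : Fin M → Option ι × Option ι) (o : Option ι × Option ι) :
    available (Fin.snoc (α := fun _ => Option ι × Option ι) g o) (M + 1) =
      (available g M \ o.1.toFinset) \ o.2.toFinset := by
  ext b
  simp only [available, Finset.mem_filter, Finset.mem_univ, true_and, Fin.forall_fin_succ',
    Fin.snoc_castSucc, Fin.snoc_last, Fin.val_castSucc, Fin.val_last, Finset.mem_sdiff,
    Option.mem_toFinset, Option.mem_def, lt_add_one, true_imp_iff, ne_eq]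
  refine ⟨fun h => ⟨⟨fun k hk => h.1 k (by omega), h.2.1⟩, h.2.2⟩,
    fun h => ⟨fun k _ => h.1.1 k k.2, h.1.2, h.2⟩⟩

/-- The weight of the removals at one site, from the set `A` of indices. -/
def stepWeight {ι : Type} [DecidableEq ι] (K : Matrix (Fin 2) (Fin 2) ℂ) (k₁ η : ℂ) (ξ : Fin N → ℂ)
    (x : ι → ℂ) (A : Finset ι) (r : ι) (e e' : Fin 2) (o : Option ι × Option ι) : ℂ :=
  minusWeight K k₁ η ξ x A r e o.1 * plusWeight K (K.det / k₁) η ξ x (A \ o.1.toFinset) r e' o.2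

theorem stepWeight_ne_zero {ι : Type} [DecidableEq ι] {x : ι → ℂ} {A : Finset ι} {r : ι}
    {e e' : Fin 2} {o : Option ι × Option ι} (h : stepWeight K k₁ η ξ x A r e e' o ≠ 0) :
    (∀ a, o.1 = some a → e = 0 ∧ a ∈ A) ∧
      ∀ a, o.2 = some a → e' = 1 ∧ a ∈ A \ o.1.toFinset := by
  obtain ⟨o₁, o₂⟩ := o
  constructor
  · rintro a rfl
    by_contra ha
    exact h (by rw [stepWeight, minusWeight, Option.elim, if_neg ha, zero_mul])
  · rintro a rfl
    by_contra ha
    exact h (by rw [stepWeight, plusWeight, Option.elim, if_neg ha, mul_zero])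

variable {R m : ℕ}

/-- The weight of a sequence of removals. -/
def pathWeight (K : Matrix (Fin 2) (Fin 2) ℂ) (k₁ η : ℂ) (ξ : Fin N → ℂ) (x : Fin (R + m) → ℂ)
    (e e' : Fin m → Fin 2) {M : ℕ} (hM : M ≤ m)
    (g : Fin M → Option (Fin (R + m)) × Option (Fin (R + m))) : ℂ :=
  ∏ k : Fin M, stepWeight K k₁ η ξ x
    ((available g k).filter fun b : Fin (R + m) => (b : ℕ) ≤ R + k)
    (Fin.natAdd R (Fin.castLE hM k)) (e (Fin.castLE hM k)) (e' (Fin.castLE hM k)) (g k)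

theorem pathWeight_snoc (x : Fin (R + m) → ℂ) (e e' : Fin m → Fin 2) {M : ℕ} (hM : M + 1 ≤ m)
    (g : Fin M → Option (Fin (R + m)) × Option (Fin (R + m)))
    (o : Option (Fin (R + m)) × Option (Fin (R + m))) :
    pathWeight K k₁ η ξ x e e' hM (Fin.snoc g o) =
      pathWeight K k₁ η ξ x e e' (Nat.le_of_succ_le hM) g *
        stepWeight K k₁ η ξ x ((available g M).filter fun b : Fin (R + m) => (b : ℕ) ≤ R + M)
          (Fin.natAdd R ⟨M, hM⟩) (e ⟨M, hM⟩) (e' ⟨M, hM⟩) o := by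
  rw [pathWeight, Fin.prod_univ_castSucc, pathWeight]
  congr 1
  · refine Finset.prod_congr rfl fun k _ => ?_
    rw [Fin.snoc_castSucc, Fin.val_castSucc, available_snoc g o k.2.le]
    rfl
  · rw [Fin.snoc_last, Fin.val_last, available_snoc g o le_rfl]
    rfl

/-- At step k only indices up to R + k have been adjoined, so nonzero weight forbids removing an
inhomogeneity before its own step. -/
theorem le_of_pathWeight_ne_zero {x : Fin (R + m) → ℂ} {e e' : Fin m → Fin 2} {M : ℕ}
    {hM : M ≤ m} {g : Fin M → Option (Fin (R + m)) × Option (Fin (R + m))}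
    (h : pathWeight K k₁ η ξ x e e' hM g ≠ 0) (k : Fin M) (b : Fin (R + m))
    (hb : (g k).1 = some b ∨ (g k).2 = some b) : (b : ℕ) ≤ R + k := by
  have := stepWeight_ne_zero (Finset.prod_ne_zero_iff.1 h k (Finset.mem_univ k))
  rcases hb with hb | hb
  · exact (Finset.mem_filter.1 (this.1 b hb).2).2
  · exact (Finset.mem_filter.1 (Finset.mem_sdiff.1 (this.2 b hb).2).1).2

/-- The action of a product of entries of the monodromy matrix at the inhomogeneities on a separate
state. -/
theorem Generic.leftState_vecMul_prod (H : Generic K k₁ η ξ) (hb : K 0 1 ≠ 0)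
    {x : Fin (R + m) → ℂ} (hx : Function.Injective x) (hm : m ≤ N)
    (hxξ : ∀ k : Fin m, x (Fin.natAdd R k) = ξ (Fin.castLE hm k)) (e e' : Fin m → Fin 2) {M : ℕ}
    (hM : M ≤ m) :
    Matrix.vecMul (leftState K k₁ η ξ
        (rootPoly x (Finset.univ.filter fun b : Fin (R + m) => (b : ℕ) < R)))
      (List.ofFn fun k : Fin M => twistedMonodromy K η ξ (ξ (Fin.castLE (hM.trans hm) k))
        (e' (Fin.castLE hM k)) (e (Fin.castLE hM k))).prod =
      (∏ k : Fin M, (-1) ^ N * K 0 1 ^ ((1 : ℤ) - (if e (Fin.castLE hM k) = 0 then 1 else 0) -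
          if e' (Fin.castLE hM k) = 1 then 1 else 0)) •
        ∑ g : Fin M → Option (Fin (R + m)) × Option (Fin (R + m)),
          pathWeight K k₁ η ξ x e e' hM g • leftState K k₁ η ξ (rootPoly x
            ((available g M).filter fun b : Fin (R + m) => (b : ℕ) < R + M)) := by
  induction M with
  | zero =>
    simp [pathWeight, available]
  | succ M ih =>
    have hstep : ∀ g : Fin M → Option (Fin (R + m)) × Option (Fin (R + m)),
        pathWeight K k₁ η ξ x e e' (Nat.le_of_succ_le hM) g • Matrix.vecMul
          (leftState K k₁ η ξ (rootPoly x
            ((available g M).filter fun b : Fin (R + m) => (b : ℕ) < R + M)))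
          (twistedMonodromy K η ξ (ξ (Fin.castLE hm ⟨M, hM⟩)) (e' ⟨M, hM⟩) (e ⟨M, hM⟩)) =
        ((-1) ^ N * K 0 1 ^ ((1 : ℤ) - (if e ⟨M, hM⟩ = 0 then 1 else 0) -
            if e' ⟨M, hM⟩ = 1 then 1 else 0)) •
          ∑ o, pathWeight K k₁ η ξ x e e' hM (Fin.snoc g o) •
            leftState K k₁ η ξ (rootPoly x ((available (Fin.snoc
              (α := fun _ => Option (Fin (R + m)) × Option (Fin (R + m))) g o) (M + 1)).filter
                fun b : Fin (R + m) => (b : ℕ) < R + (M + 1))) := by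
      intro g
      simp only [pathWeight_snoc]
      by_cases h0 : pathWeight K k₁ η ξ x e e' (Nat.le_of_succ_le hM) g = 0
      · simp [h0]
      have hle := le_of_pathWeight_ne_zero h0
      -- The root adjoined at step M has index R + M (steps counted from 0). Earlier removals
      -- concern smaller indices, so it is still available and is genuinely new.
      have hins : insert (Fin.natAdd R ⟨M, hM⟩)
          ((available g M).filter fun b : Fin (R + m) => (b : ℕ) < R + M) =
          (available g M).filter fun b : Fin (R + m) => (b : ℕ) ≤ R + M := by
        ext b
        simp only [Finset.mem_insert, Finset.mem_filter]
        constructor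
        · rintro (rfl | ⟨h, h'⟩)
          · refine ⟨Finset.mem_filter.2 ⟨Finset.mem_univ _, fun k _ => ?_⟩, le_rfl⟩
            have := fun h => hle k (Fin.natAdd R ⟨M, hM⟩) h
            simp only [Fin.val_natAdd] at this
            have hk := k.2
            constructor
            · intro h; have := this (Or.inl h); omega
            · intro h; have := this (Or.inr h); omega
          · exact ⟨h, h'.le⟩
        · rintro ⟨h, h'⟩
          rcases h'.eq_or_lt with h' | h'
          · exact Or.inl (Fin.ext h')
          · exact Or.inr ⟨h, h'⟩
      rw [H.leftState_vecMul_entry hb (r := Fin.natAdd R ⟨M, hM⟩) (by simp) hx.injOn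
        (hxξ ⟨M, hM⟩), hins, smul_comm]
      congr 1
      rw [Finset.smul_sum, Fintype.sum_prod_type]
      refine Finset.sum_congr rfl fun o _ => ?_
      rw [plusState, Finset.smul_sum, Finset.smul_sum]
      refine Finset.sum_congr rfl fun o' _ => ?_
      rw [smul_smul, smul_smul, stepWeight, mul_assoc, available_snoc_succ]
      congr 4
      ext b
      simp only [Finset.mem_filter, Finset.mem_sdiff, Nat.lt_succ_iff, ← add_assoc]
      tauto
    rw [List.ofFn_succ', List.concat_eq_append, List.prod_append, List.prod_singleton,
      ← Matrix.vecMul_vecMul]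
    have ih' := ih (Nat.le_of_succ_le hM)
    rw [Fin.prod_univ_castSucc]
    refine (congrArg (fun v => Matrix.vecMul v _) ih').trans ?_
    rw [Matrix.smul_vecMul, Matrix.sum_vecMul, mul_smul]
    congr 1
    simp only [Matrix.smul_vecMul]
    refine (Finset.sum_congr rfl fun g _ => hstep g).trans ?_
    rw [← Finset.smul_sum]
    congr 1
    rw [← (Fin.snocEquiv fun _ => Option (Fin (R + m)) × Option (Fin (R + m))).sum_comp,
      Fintype.sum_prod_type, Finset.sum_comm]
    rfl

end Iteration

/-! ### The right separate state as eigenvector of the transfer matrix -/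

section RightEigenvector

variable {N : ℕ} {K : Matrix (Fin 2) (Fin 2) ℂ} {k₁ η : ℂ} {ξ : Fin N → ℂ}

/-- Both terms on the right of TQ have degree N + deg Q and monic polynomial parts, so dividing by
the monic Q bounds deg τ by N and leaves the coefficient k₁ + k₂. -/
theorem polyFun_of_TQ {τ Q : ℂ[X]} (hQ : Q.Monic) {k₂ : ℂ}
    (hTQ : ∀ l : ℂ, τ.eval l * Q.eval l =
      k₂ * aFun η ξ l * Q.eval (l - η) + k₁ * dFun ξ l * Q.eval (l + η)) :
    PolyFun N (k₁ + k₂) fun l => τ.eval l := by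
  have hpoly : τ * Q = C k₂ * shiftDown η ξ Q + C k₁ * shiftUp η ξ Q := by
    refine funext fun l => ?_
    simp only [eval_mul, eval_add, eval_C, eval_shiftDown, eval_shiftUp]
    rw [hTQ]
    ring
  have hu := natDegree_shiftUp η ξ hQ
  have hd := natDegree_shiftDown η ξ hQ
  have hle : (τ * Q).natDegree ≤ N + Q.natDegree := by
    rw [hpoly]
    exact natDegree_add_le_of_degree_le ((natDegree_C_mul_le _ _).trans hd.le)
      ((natDegree_C_mul_le _ _).trans hu.le)
  have hτ : τ.natDegree ≤ N := by
    by_cases h0 : τ = 0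
    · simp [h0]
    · rw [mul_comm, hQ.natDegree_mul' h0] at hle
      omega
  refine ⟨τ, fun _ => rfl, hτ, ?_⟩
  have hc := congrArg (fun p => coeff p (N + Q.natDegree)) hpoly
  simp only [coeff_add, coeff_C_mul] at hc
  rw [coeff_mul_add_eq_of_natDegree_le hτ le_rfl, hQ.coeff_natDegree, mul_one] at hc
  have h₁ := (monic_shiftDown η ξ hQ).coeff_natDegree
  have h₂ := (monic_shiftUp η ξ hQ).coeff_natDegree
  rw [hd] at h₁
  rw [hu] at h₂
  rw [hc, h₁, h₂]
  ring

/-- The coefficients of a right separate state in the unnormalized SoV basis. -/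
def rightCoeff (K : Matrix (Fin 2) (Fin 2) ℂ) (k₁ η : ℂ) (ξ : Fin N → ℂ) (Q : ℂ[X])
    (h : Spins N) : ℂ :=
  (∏ n, (-((K.det / k₁) / k₁)) ^ (h n : ℕ) * Q.eval (shifted η ξ h n)) *
    vand (shifted η ξ (fun n => 1 - h n))

theorem rightState_eq (K : Matrix (Fin 2) (Fin 2) ℂ) (k₁ η : ℂ) (ξ : Fin N → ℂ) (Q : ℂ[X]) :
    rightState K k₁ η ξ Q =
      (sovNorm K k₁ η ξ)⁻¹ • ∑ h, rightCoeff K k₁ η ξ Q h • rightSoVRaw K k₁ η ξ h := by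
  rw [rightState, Finset.smul_sum]
  refine Finset.sum_congr rfl fun h _ => ?_
  rw [rightSoV, smul_comm]
  rfl

theorem shifted_mul_shifted_compl (f : ℂ → ℂ) (h : Spins N) (k : Fin N) :
    f (shifted η ξ h k) * f (shifted η ξ (fun n => 1 - h n) k) = f (ξ k) * f (ξ k - η) := by
  rcases Fin.exists_fin_two.1 ⟨h k, rfl⟩ with hk | hk
  · rw [shifted_of_eq_zero η ξ hk, shifted_of_eq_one η ξ (by simp [hk])]
  · rw [shifted_of_eq_one η ξ hk, shifted_of_eq_zero η ξ (by simp [hk]), mul_comm]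

/-- The Vandermonde identity comparing complementary configurations. -/
theorem Generic.vand_compl_flip (H : Generic K k₁ η ξ) {h : Spins N} {n : Fin N} (hn : h n = 0) :
    -(dFun ξ (ξ n - η) * vand (shifted η ξ fun k => 1 - flip h n k) *
        ∏ k ∈ Finset.univ.erase n, (ξ n - shifted η ξ h k)) =
      aFun η ξ (ξ n) * vand (shifted η ξ fun k => 1 - h k) *
        ∏ k ∈ Finset.univ.erase n, (ξ n - η - shifted η ξ h k) := by
  set c : Spins N := fun k => 1 - h k with hc
  have hcn : c n = 1 := by simp [hc, hn]
  have hcf : (fun k => 1 - flip h n k) = flip c n := by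
    funext k
    by_cases hk : k = n
    · subst hk; simp [flip, hc]
    · simp [flip, hc, Function.update_of_ne hk]
  have hfn : flip c n n = 0 := by simp [flip, hcn]
  have key := H.vand_flip c n
  rw [shifted_of_eq_one η ξ hcn, shifted_of_eq_zero η ξ hfn] at key
  have h₁ : ∏ k ∈ Finset.univ.erase n, (ξ n - η - shifted η ξ c k) ≠ 0 :=
    Finset.prod_ne_zero_iff.2 fun k hk => by
      have := (H.shifted_injective c).ne (Finset.ne_of_mem_erase hk)
      rw [shifted_of_eq_one η ξ hcn] at this
      exact sub_ne_zero.2 this.symm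
  have h₂ : ∏ k ∈ Finset.univ.erase n, (ξ n - shifted η ξ c k) ≠ 0 :=
    Finset.prod_ne_zero_iff.2 fun k hk => by
      have := (H.shifted_injective (flip c n)).ne (Finset.ne_of_mem_erase hk)
      rw [shifted_of_eq_zero η ξ hfn, shifted_flip,
        Function.update_of_ne (Finset.ne_of_mem_erase hk)] at this
      exact sub_ne_zero.2 this.symm
  rw [div_eq_div_iff h₂ h₁] at key
  -- A product over a configuration times the one over its complement does not depend on h. The
  -- factors -η and η at k = n in d(ξ_n - η) and a(ξ_n) account for the relative sign.
  have e₁ : (∏ k ∈ Finset.univ.erase n, (ξ n - shifted η ξ h k)) *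
      ∏ k ∈ Finset.univ.erase n, (ξ n - shifted η ξ c k) =
      (∏ k ∈ Finset.univ.erase n, (ξ n - ξ k)) *
        ∏ k ∈ Finset.univ.erase n, (ξ n - ξ k + η) := by
    rw [← Finset.prod_mul_distrib, ← Finset.prod_mul_distrib]
    refine Finset.prod_congr rfl fun k _ => ?_
    rw [shifted_mul_shifted_compl (fun z => ξ n - z)]
    ring
  have e₂ : (∏ k ∈ Finset.univ.erase n, (ξ n - η - shifted η ξ h k)) *
      ∏ k ∈ Finset.univ.erase n, (ξ n - η - shifted η ξ c k) =
      (∏ k ∈ Finset.univ.erase n, (ξ n - η - ξ k)) *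
        ∏ k ∈ Finset.univ.erase n, (ξ n - ξ k) := by
    rw [← Finset.prod_mul_distrib, ← Finset.prod_mul_distrib]
    refine Finset.prod_congr rfl fun k _ => ?_
    rw [shifted_mul_shifted_compl (fun z => ξ n - η - z)]
    ring
  have e₃ : dFun ξ (ξ n - η) = -η * ∏ k ∈ Finset.univ.erase n, (ξ n - η - ξ k) := by
    rw [dFun, ← Finset.mul_prod_erase _ _ (Finset.mem_univ n)]
    ring
  have e₄ : aFun η ξ (ξ n) = η * ∏ k ∈ Finset.univ.erase n, (ξ n - ξ k + η) := by
    rw [aFun, ← Finset.mul_prod_erase _ _ (Finset.mem_univ n)]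
    ring
  rw [hcf, e₃, e₄]
  refine mul_right_cancel₀ h₁ (mul_right_cancel₀ h₂ ?_)
  set X₁ := ∏ k ∈ Finset.univ.erase n, (ξ n - shifted η ξ h k)
  set X₂ := ∏ k ∈ Finset.univ.erase n, (ξ n - shifted η ξ c k)
  set Y₁ := ∏ k ∈ Finset.univ.erase n, (ξ n - η - shifted η ξ h k)
  set Y₂ := ∏ k ∈ Finset.univ.erase n, (ξ n - η - shifted η ξ c k)
  set A := ∏ k ∈ Finset.univ.erase n, (ξ n - ξ k)
  set B := ∏ k ∈ Finset.univ.erase n, (ξ n - ξ k + η)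
  set D := ∏ k ∈ Finset.univ.erase n, (ξ n - η - ξ k)
  linear_combination (η * D * X₁ * X₂) * key + η * D * X₂ * vand (shifted η ξ c) * e₁ -
    η * B * X₂ * vand (shifted η ξ c) * e₂

theorem Generic.mulVec_rightSoVRaw (H : Generic K k₁ η ξ) (h : Spins N) (l : ℂ) :
    (transfer K η ξ l).mulVec (rightSoVRaw K k₁ η ξ h) =
      (K.trace * ∏ n, (l - shifted η ξ h n)) • rightSoVRaw K k₁ η ξ h +
      ∑ n, ((∏ k ∈ Finset.univ.erase n,
          (l - shifted η ξ h k) / (shifted η ξ h n - shifted η ξ h k)) *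
          (k₁ * dFun ξ (shifted η ξ h n) + K.det / k₁ * aFun η ξ (shifted η ξ h n))) •
            rightSoVRaw K k₁ η ξ (flip h n) := by
  rw [transfer, Matrix.trace_fin_two, Matrix.add_mulVec]
  funext s
  rw [Pi.add_apply, (polyFun_mulVec K η ξ 0 0 _ s).eq_interpolate (H.shifted_injective h) l,
    (polyFun_mulVec K η ξ 1 1 _ s).eq_interpolate (H.shifted_injective h) l]
  simp only [H.A_mulVec_rightSoVRaw, H.D_mulVec_rightSoVRaw, Pi.add_apply, Pi.smul_apply,
    Finset.sum_apply, smul_eq_mul, Matrix.trace_fin_two]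
  rw [add_add_add_comm, ← Finset.sum_add_distrib]
  congr 1
  · ring
  · exact Finset.sum_congr rfl fun n _ => by ring

theorem prod_pow_flip (c : ℂ) (Q : ℂ[X]) (h : Spins N) (n : Fin N) :
    ∏ k, c ^ (flip h n k : ℕ) * Q.eval (shifted η ξ (flip h n) k) =
      c ^ (flip h n n : ℕ) * Q.eval (shifted η ξ (flip h n) n) *
        ∏ k ∈ Finset.univ.erase n, c ^ (h k : ℕ) * Q.eval (shifted η ξ h k) := by
  rw [← Finset.mul_prod_erase _ _ (Finset.mem_univ n)]
  congr 1
  refine Finset.prod_congr rfl fun k hk => ?_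
  rw [shifted_flip, flip, Function.update_of_ne (Finset.ne_of_mem_erase hk),
    Function.update_of_ne (Finset.ne_of_mem_erase hk)]

/-- This is the eigenvector equation at one site. At ξ_n only the a term of TQ survives and at ξ_n -
η only the d term; the factor -k₂/k₁ and the complementary Vandermonde product convert between k₁ d
and k₂ a. -/
theorem Generic.rightCoeff_flip (H : Generic K k₁ η ξ) {τ Q : ℂ[X]}
    (hTQ : ∀ l : ℂ, τ.eval l * Q.eval l =
      K.det / k₁ * aFun η ξ l * Q.eval (l - η) + k₁ * dFun ξ l * Q.eval (l + η))
    (h : Spins N) (n : Fin N) :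
    rightCoeff K k₁ η ξ Q (flip h n) * (k₁ * dFun ξ (shifted η ξ (flip h n) n) +
        K.det / k₁ * aFun η ξ (shifted η ξ (flip h n) n)) *
        ∏ k ∈ Finset.univ.erase n, (shifted η ξ h n - shifted η ξ h k) =
      τ.eval (shifted η ξ h n) * rightCoeff K k₁ η ξ Q h *
        ∏ k ∈ Finset.univ.erase n, (shifted η ξ (flip h n) n - shifted η ξ h k) := by
  have hk := H.k₁_ne
  rw [rightCoeff, rightCoeff, prod_pow_flip,
    ← Finset.mul_prod_erase Finset.univ (fun k => _ ^ (h k : ℕ) * Q.eval (shifted η ξ h k))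
      (Finset.mem_univ n)]
  set E := ∏ k ∈ Finset.univ.erase n,
    (-((K.det / k₁) / k₁)) ^ (h k : ℕ) * Q.eval (shifted η ξ h k)
  rcases Fin.exists_fin_two.1 ⟨h n, rfl⟩ with hn | hn
  · have hf : flip h n n = 1 := by simp [flip, hn]
    have key := H.vand_compl_flip hn
    have hT := hTQ (ξ n)
    rw [dFun_xi, mul_zero, zero_mul, add_zero] at hT
    rw [shifted_of_eq_zero η ξ hn, shifted_of_eq_one η ξ hf, hn, hf, aFun_xi_sub]
    simp only [Fin.val_zero, Fin.val_one, pow_zero, pow_one, one_mul, mul_zero, add_zero]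
    have hkk : K.det / k₁ / k₁ * k₁ = K.det / k₁ := div_mul_cancel₀ _ hk
    linear_combination (K.det / k₁ / k₁ * k₁ * Q.eval (ξ n - η) * E) * key +
      (aFun η ξ (ξ n) * vand (shifted η ξ fun k => 1 - h k) * Q.eval (ξ n - η) * E *
        ∏ k ∈ Finset.univ.erase n, (ξ n - η - shifted η ξ h k)) * hkk -
      (E * vand (shifted η ξ fun k => 1 - h k) *
        ∏ k ∈ Finset.univ.erase n, (ξ n - η - shifted η ξ h k)) * hT
  · have hf : flip h n n = 0 := by simp [flip, hn]
    have key := H.vand_compl_flip hf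
    rw [flip_flip] at key
    have hsh : ∀ (f : ℂ → ℂ), ∏ k ∈ Finset.univ.erase n, f (shifted η ξ (flip h n) k) =
        ∏ k ∈ Finset.univ.erase n, f (shifted η ξ h k) := fun f =>
      Finset.prod_congr rfl fun k hk => by
        rw [shifted_flip, Function.update_of_ne (Finset.ne_of_mem_erase hk)]
    rw [hsh (fun z => ξ n - z), hsh (fun z => ξ n - η - z)] at key
    have hT := hTQ (ξ n - η)
    rw [aFun_xi_sub, mul_zero, zero_mul, zero_add, sub_add_cancel] at hT
    rw [shifted_of_eq_one η ξ hn, shifted_of_eq_zero η ξ hf, hn, hf, dFun_xi]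
    simp only [Fin.val_zero, Fin.val_one, pow_zero, pow_one, one_mul, mul_zero, zero_add]
    have hkk : K.det / k₁ / k₁ * k₁ = K.det / k₁ := div_mul_cancel₀ _ hk
    set V := vand (shifted η ξ fun k => 1 - h k)
    set V' := vand (shifted η ξ fun k => 1 - flip h n k)
    linear_combination (-(K.det / k₁ * Q.eval (ξ n) * E)) * key +
      (K.det / k₁ / k₁ * E * V * ∏ k ∈ Finset.univ.erase n, (ξ n - shifted η ξ h k)) * hT +
      (dFun ξ (ξ n - η) * Q.eval (ξ n) * E * V *
        ∏ k ∈ Finset.univ.erase n, (ξ n - shifted η ξ h k)) * hkk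

/-- A solution of the `TQ` equation gives an eigenvector of the transfer matrix. -/
theorem Generic.transfer_mulVec_rightState (H : Generic K k₁ η ξ) {τ Q : ℂ[X]} (hQ : Q.Monic)
    (hk : k₁ + K.det / k₁ = K.trace)
    (hTQ : ∀ l : ℂ, τ.eval l * Q.eval l =
      K.det / k₁ * aFun η ξ l * Q.eval (l - η) + k₁ * dFun ξ l * Q.eval (l + η)) (l : ℂ) :
    (transfer K η ξ l).mulVec (rightState K k₁ η ξ Q) =
      τ.eval l • rightState K k₁ η ξ Q := by
  -- Since k₁ + k₂ = tr K, τ has the leading coefficient of the transfer matrix, so comparing values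
  -- at the N shifted points is enough.
  have hpoly := polyFun_of_TQ hQ hTQ
  rw [hk] at hpoly
  rw [rightState_eq, Matrix.mulVec_smul, smul_comm]
  congr 1
  rw [Matrix.mulVec_sum, Finset.smul_sum]
  simp only [Matrix.mulVec_smul, H.mulVec_rightSoVRaw, smul_add, Finset.smul_sum, smul_smul,
    Finset.sum_add_distrib]
  rw [sum_flip (fun h n h' => (rightCoeff K k₁ η ξ Q h * ((∏ k ∈ Finset.univ.erase n,
    (l - shifted η ξ h k) / (shifted η ξ h n - shifted η ξ h k)) *
    (k₁ * dFun ξ (shifted η ξ h n) + K.det / k₁ * aFun η ξ (shifted η ξ h n)))) •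
      rightSoVRaw K k₁ η ξ h'), ← Finset.sum_add_distrib]
  refine Finset.sum_congr rfl fun h _ => ?_
  rw [← Finset.sum_smul, ← add_smul]
  congr 1
  rw [hpoly.eq_interpolate (H.shifted_injective h) l, add_mul, Finset.sum_mul]
  congr 1
  · ring
  · refine Finset.sum_congr rfl fun n _ => ?_
    have h₁ : ∏ k ∈ Finset.univ.erase n, (shifted η ξ h n - shifted η ξ h k) ≠ 0 :=
      Finset.prod_ne_zero_iff.2 fun k hk =>
        sub_ne_zero.2 ((H.shifted_injective h).ne (Finset.ne_of_mem_erase hk).symm)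
    have h₂ : ∏ k ∈ Finset.univ.erase n, (shifted η ξ (flip h n) n - shifted η ξ h k) ≠ 0 :=
      Finset.prod_ne_zero_iff.2 fun k hk => by
        have := (H.shifted_injective (flip h n)).ne (Finset.ne_of_mem_erase hk).symm
        conv at this => rhs; rw [shifted_flip, Function.update_of_ne (Finset.ne_of_mem_erase hk)]
        exact sub_ne_zero.2 this
    have h₃ : ∏ k ∈ Finset.univ.erase n, (l - shifted η ξ (flip h n) k) /
        (shifted η ξ (flip h n) n - shifted η ξ (flip h n) k) =
        (∏ k ∈ Finset.univ.erase n, (l - shifted η ξ h k)) /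
        ∏ k ∈ Finset.univ.erase n, (shifted η ξ (flip h n) n - shifted η ξ h k) := by
      rw [← Finset.prod_div_distrib]
      refine Finset.prod_congr rfl fun k hk => ?_
      have : shifted η ξ (flip h n) k = shifted η ξ h k := by
        rw [shifted_flip, Function.update_of_ne (Finset.ne_of_mem_erase hk)]
      rw [this]
    have key := H.rightCoeff_flip hTQ h n
    rw [h₃, Finset.prod_div_distrib]
    set u := ∏ k ∈ Finset.univ.erase n, (l - shifted η ξ h k)
    set y := ∏ k ∈ Finset.univ.erase n, (shifted η ξ h n - shifted η ξ h k)
    set z := ∏ k ∈ Finset.univ.erase n, (shifted η ξ (flip h n) n - shifted η ξ h k)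
    refine mul_right_cancel₀ h₁ (mul_right_cancel₀ h₂ ?_)
    have e₁ : u / z * z = u := div_mul_cancel₀ _ h₂
    have e₂ : u / y * y = u := div_mul_cancel₀ _ h₁
    linear_combination u * key + rightCoeff K k₁ η ξ Q (flip h n) * y *
      (k₁ * dFun ξ (shifted η ξ (flip h n) n) +
        K.det / k₁ * aFun η ξ (shifted η ξ (flip h n) n)) * e₁ -
      τ.eval (shifted η ξ h n) * rightCoeff K k₁ η ξ Q h * z * e₂

/-- If τ(ξ_n) = 0, the equation at ξ_n forces Q(ξ_n - η) = 0, and then the equation at ξ_n - η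
forces Q(ξ_n) = 0. -/
theorem Generic.eval_xi_ne_zero (H : Generic K k₁ η ξ) {τ Q : ℂ[X]}
    (hTQ : ∀ l : ℂ, τ.eval l * Q.eval l =
      K.det / k₁ * aFun η ξ l * Q.eval (l - η) + k₁ * dFun ξ l * Q.eval (l + η))
    (n : Fin N) (hQ : Q.eval (ξ n) ≠ 0) : τ.eval (ξ n) ≠ 0 := by
  intro h0
  have h₁ := hTQ (ξ n)
  rw [h0, dFun_xi, mul_zero, zero_mul, zero_mul, add_zero] at h₁
  have h₂ : Q.eval (ξ n - η) = 0 := (mul_eq_zero.1 h₁.symm).resolve_left (H.k₂_a_ne n)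
  have h₃ := hTQ (ξ n - η)
  rw [h₂, aFun_xi_sub, mul_zero, mul_zero, zero_mul, zero_add, sub_add_cancel] at h₃
  exact mul_ne_zero (mul_ne_zero H.k₁_ne (H.dFun_ne n)) hQ h₃.symm

end RightEigenvector

/-! ### From removal sequences to subsets and indices -/

section Reindexing

/-- Extend a function on a finite set by `none`. -/
def optionExtend {ι κ : Type} [DecidableEq ι] (β : Finset ι) (a : β → κ) (k : ι) : Option κ :=
  if h : k ∈ β then some (a ⟨k, h⟩) else none

theorem optionExtend_coe {ι κ : Type} [DecidableEq ι] {β : Finset ι} (a : β → κ) (k : β) :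
    optionExtend β a k = some (a k) := by
  rw [optionExtend, dif_pos k.2]

theorem optionExtend_of_notMem {ι κ : Type} [DecidableEq ι] {β : Finset ι} (a : β → κ) {k : ι}
    (hk : k ∉ β) : optionExtend β a k = none := by
  rw [optionExtend, dif_neg hk]

theorem optionExtend_eq_some {ι κ : Type} [DecidableEq ι] {β : Finset ι} {a : β → κ} {k : ι}
    {b : κ} : optionExtend β a k = some b ↔ ∃ h : k ∈ β, a ⟨k, h⟩ = b := by
  by_cases h : k ∈ β
  · simp [optionExtend, h]
  · simp [optionExtend, h]

/-- A function into `Option κ` is the same as its support together with a κ-valued function on it;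
the support becomes ᾱ⁻ or ᾱ⁺. -/
theorem sum_optionExtend {ι κ : Type} [Fintype ι] [DecidableEq ι] [Fintype κ]
    {V : Type*} [AddCommMonoid V] (f : (ι → Option κ) → V) :
    ∑ g, f g = ∑ β : Finset ι, ∑ a : β → κ, f (optionExtend β a) := by
  rw [← Fintype.sum_sigma' fun (β : Finset ι) (a : β → κ) => f (optionExtend β a)]
  refine (Function.Bijective.sum_comp (g := f)
    (e := fun p : Σ β : Finset ι, β → κ => optionExtend p.1 p.2) ⟨?_, ?_⟩).symm
  · rintro ⟨β, a⟩ ⟨β', a'⟩ h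
    have hβ : β = β' := by
      ext k
      have := congrArg Option.isSome (congrFun h k)
      by_cases h₁ : k ∈ β <;> by_cases h₂ : k ∈ β' <;> simp_all [optionExtend]
    subst hβ
    congr 1
    funext k
    have := congrFun h k
    simpa only [optionExtend_coe, Option.some_inj] using this
  · intro g
    refine ⟨⟨Finset.univ.filter fun k => (g k).isSome,
      fun k => (g k).get (Finset.mem_filter.1 k.2).2⟩, ?_⟩
    funext k
    change optionExtend _ _ k = g k
    by_cases hk : (g k).isSome
    · rw [optionExtend, dif_pos (by simpa using hk), Option.some_get]
    · rw [optionExtend, dif_neg (by simpa using hk), Option.not_isSome_iff_eq_none.1 hk]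

/-- Each position of the ambient set where nothing is removed contributes c, and positions outside
that set contribute 1. The inclusion makes the truncated subtraction the true count. -/
theorem prod_optionExtend_elim {ι κ : Type} [Fintype ι] [DecidableEq ι] (p : ι → Prop)
    [DecidablePred p] {β : Finset ι} (hβ : β ⊆ Finset.univ.filter p) (a : β → κ) (c : ℂ)
    (w : ι → κ → ℂ) :
    ∏ k, (optionExtend β a k).elim (if p k then c else 1) (w k) =
      c ^ ((Finset.univ.filter p).card - β.card) * ∏ k : β, w k (a k) := by
  rw [← Finset.prod_mul_prod_compl β, mul_comm]
  congr 1
  · rw [Finset.prod_congr rfl fun k hk => by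
      rw [optionExtend_of_notMem a (Finset.mem_compl.1 hk), Option.elim], Finset.prod_ite,
      Finset.prod_const, Finset.prod_const_one, mul_one, ← Finset.card_sdiff_of_subset hβ]
    congr 2
    ext k
    simp [and_comm]
  · rw [← Finset.prod_attach, ← Finset.univ_eq_attach]
    exact Finset.prod_congr rfl fun k _ => by rw [optionExtend_coe, Option.elim]

variable {N m R : ℕ} {K : Matrix (Fin 2) (Fin 2) ℂ} {k₁ k₂ η : ℂ} {ξ : Fin N → ℂ}
  {βm βp : Finset (Fin m)}

theorem available_optionExtend (a : βm → Fin (R + m)) (a' : βp → Fin (R + m)) (j : ℕ) :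
    available (fun k => (optionExtend βm a k, optionExtend βp a' k)) j = setA a a' j := by
  ext b
  simp only [available, setA, Finset.mem_filter, Finset.mem_univ, true_and, ne_eq,
    optionExtend_eq_some, Subtype.forall, not_exists]
  exact ⟨fun h => ⟨fun k hk hj e => (h k hj).1 hk e.symm, fun k hk hj e => (h k hj).2 hk e.symm⟩,
    fun h k hj => ⟨fun hk e => h.1 k hk hj e.symm, fun hk e => h.2 k hk hj e.symm⟩⟩

theorem setA_sdiff (a : βm → Fin (R + m)) (a' : βp → Fin (R + m)) (k : Fin m) :
    setA a a' k \ (optionExtend βm a k).toFinset = setA' a a' k := by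
  ext b
  simp only [setA, setA', Finset.mem_filter, Finset.mem_univ, true_and, ne_eq, Finset.mem_sdiff,
    Option.mem_toFinset, Option.mem_def, optionExtend_eq_some, Subtype.forall, not_exists]
  constructor
  · rintro ⟨⟨h₁, h₂⟩, h₃⟩
    refine ⟨fun i hi hik e => ?_, h₂⟩
    rcases hik.eq_or_lt with hik | hik
    · obtain rfl := Fin.ext hik
      exact h₃ hi e.symm
    · exact h₁ i hi hik e
  · rintro ⟨h₁, h₂⟩
    exact ⟨⟨fun i hi hik => h₁ i hi hik.le, h₂⟩, fun hk e => h₁ k hk le_rfl e.symm⟩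

theorem setA'_sdiff (a : βm → Fin (R + m)) (a' : βp → Fin (R + m)) (k : Fin m) :
    setA' a a' k \ (optionExtend βp a' k).toFinset = setA a a' (k + 1) := by
  ext b
  simp only [setA, setA', Finset.mem_filter, Finset.mem_univ, true_and, ne_eq, Finset.mem_sdiff,
    Option.mem_toFinset, Option.mem_def, optionExtend_eq_some, Subtype.forall, not_exists,
    Nat.lt_succ_iff]
  constructor
  · rintro ⟨⟨h₁, h₂⟩, h₃⟩
    refine ⟨h₁, fun i hi hik e => ?_⟩
    rcases hik.eq_or_lt with hik | hik
    · obtain rfl := Fin.ext hik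
      exact h₃ hi e.symm
    · exact h₂ i hi hik e
  · rintro ⟨h₁, h₂⟩
    exact ⟨⟨h₁, fun i hi hik => h₂ i hi hik.le⟩, fun hk e => h₂ k hk le_rfl e.symm⟩

theorem filter_sdiff_eq {ι : Type} [DecidableEq ι] (S T : Finset ι) (p : ι → Prop)
    [DecidablePred p] : S.filter p \ T = (S \ T).filter p := by
  ext b
  simp only [Finset.mem_sdiff, Finset.mem_filter]
  tauto

theorem filter_le_erase (S : Finset (Fin (R + m))) (k : Fin m) :
    (S.filter fun b : Fin (R + m) => (b : ℕ) ≤ R + k).erase (Fin.natAdd R k) =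
      S.filter fun b : Fin (R + m) => (b : ℕ) < R + k := by
  ext b
  simp only [Finset.mem_erase, Finset.mem_filter, ne_eq, Fin.ext_iff, Fin.val_natAdd]
  exact ⟨fun h => ⟨h.2.1, by omega⟩, fun h => ⟨by omega, h.1, by omega⟩⟩

theorem minusCoeff_eq_factorMinus (x : Fin (R + m) → ℂ) (a : βm → Fin (R + m))
    (a' : βp → Fin (R + m)) (k : βm) :
    minusCoeff k₁ η ξ x
        ((setA a a' ((k : Fin m) : ℕ)).filter fun b : Fin (R + m) => (b : ℕ) ≤ R + (k : Fin m))
        (Fin.natAdd R k) (a k) = factorMinus k₁ η ξ x a a' k := by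
  rw [minusCoeff, filter_le_erase, factorMinus, ← setA_sdiff a a' k, optionExtend_coe,
    Option.toFinset_some, ← filter_sdiff_eq, Finset.sdiff_singleton_eq_erase]

theorem plusCoeff_eq_factorPlus (x : Fin (R + m) → ℂ) (a : βm → Fin (R + m))
    (a' : βp → Fin (R + m)) (k : βp) :
    plusCoeff k₂ η ξ x
        ((setA' a a' ((k : Fin m) : ℕ)).filter fun b : Fin (R + m) => (b : ℕ) ≤ R + (k : Fin m))
        (Fin.natAdd R k) (a' k) = factorPlus k₂ η ξ x a a' k := by
  rw [plusCoeff, filter_le_erase, factorPlus, ← setA'_sdiff a a' k, optionExtend_coe,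
    Option.toFinset_some, ← filter_sdiff_eq, Finset.sdiff_singleton_eq_erase]

theorem stepWeight_optionExtend (x : Fin (R + m) → ℂ) (e e' : Fin m → Fin 2)
    (a : βm → Fin (R + m)) (a' : βp → Fin (R + m)) (k : Fin m) :
    stepWeight K k₁ η ξ x ((available (fun k => (optionExtend βm a k, optionExtend βp a' k))
        (k : ℕ)).filter fun b : Fin (R + m) => (b : ℕ) ≤ R + k) (Fin.natAdd R k) (e k) (e' k)
        (optionExtend βm a k, optionExtend βp a' k) =
      minusWeight K k₁ η ξ x ((setA a a' k).filter fun b : Fin (R + m) => (b : ℕ) ≤ R + k)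
          (Fin.natAdd R k) (e k) (optionExtend βm a k) *
        plusWeight K (K.det / k₁) η ξ x
          ((setA' a a' k).filter fun b : Fin (R + m) => (b : ℕ) ≤ R + k)
          (Fin.natAdd R k) (e' k) (optionExtend βp a' k) := by
  rw [stepWeight, available_optionExtend, filter_sdiff_eq, setA_sdiff]

/-- The weights were set to zero on inadmissible removals, so the unrestricted sum over sequences
collapses to the constrained sums of the claim. -/
theorem pathWeight_eq_zero (x : Fin (R + m) → ℂ) (e e' : Fin m → Fin 2)
    (a : βm → Fin (R + m)) (a' : βp → Fin (R + m))
    (h : ¬(βm ⊆ (Finset.univ.filter fun j => e j = 0) ∧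
      βp ⊆ (Finset.univ.filter fun j => e' j = 1) ∧ (a, a') ∈ indexChoices R βm βp)) :
    pathWeight K k₁ η ξ x e e' le_rfl
      (fun k => (optionExtend βm a k, optionExtend βp a' k)) = 0 := by
  by_contra h0
  have hk := fun k => stepWeight_ne_zero (Finset.prod_ne_zero_iff.1 h0 k (Finset.mem_univ k))
  simp only [available_optionExtend, filter_sdiff_eq, setA_sdiff, Finset.mem_filter] at hk
  refine h ⟨fun k hm => ?_, fun k hp => ?_, ?_⟩
  · exact Finset.mem_filter.2 ⟨Finset.mem_univ _, ((hk k).1 _ (optionExtend_coe a ⟨k, hm⟩)).1⟩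
  · exact Finset.mem_filter.2 ⟨Finset.mem_univ _, ((hk k).2 _ (optionExtend_coe a' ⟨k, hp⟩)).1⟩
  · refine Finset.mem_filter.2 ⟨Finset.mem_univ _, fun k => ?_, fun k => ?_⟩
    · exact ((hk k).1 _ (optionExtend_coe a k)).2.symm
    · exact ((hk k).2 _ (optionExtend_coe a' k)).2.symm

theorem pathWeight_optionExtend (x : Fin (R + m) → ℂ) (e e' : Fin m → Fin 2)
    (hβm : βm ⊆ Finset.univ.filter fun j => e j = 0)
    (hβp : βp ⊆ Finset.univ.filter fun j => e' j = 1)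
    {a : βm → Fin (R + m)} {a' : βp → Fin (R + m)} (h : (a, a') ∈ indexChoices R βm βp) :
    pathWeight K k₁ η ξ x e e' le_rfl
        (fun k => (optionExtend βm a k, optionExtend βp a' k)) =
      ((-1) ^ N) ^ (βm.card + βp.card) *
        (K 0 0 - k₁) ^ ((Finset.univ.filter fun j => e j = 0).card - βm.card) *
        (K 1 1 - K.det / k₁) ^ ((Finset.univ.filter fun j => e' j = 1).card - βp.card) *
        ((∏ j, factorMinus k₁ η ξ x a a' j) * ∏ j, factorPlus (K.det / k₁) η ξ x a a' j) := by
  have hi := (Finset.mem_filter.1 h).2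
  rw [pathWeight]
  refine (Finset.prod_congr rfl fun k _ => stepWeight_optionExtend x e e' a a' k).trans ?_
  rw [Finset.prod_mul_distrib]
  simp only [minusWeight, plusWeight]
  rw [prod_optionExtend_elim _ hβm, prod_optionExtend_elim _ hβp]
  have h₁ : ∀ k : βm, (if e k = 0 ∧ a k ∈ ((setA a a' ((k : Fin m) : ℕ)).filter
      fun b : Fin (R + m) => (b : ℕ) ≤ R + (k : Fin m)) then (-1) ^ N * minusCoeff k₁ η ξ x
        ((setA a a' ((k : Fin m) : ℕ)).filter fun b : Fin (R + m) => (b : ℕ) ≤ R + (k : Fin m))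
        (Fin.natAdd R k) (a k) else 0) = (-1) ^ N * factorMinus k₁ η ξ x a a' k := fun k => by
    rw [if_pos ⟨(Finset.mem_filter.1 (hβm k.2)).2,
      Finset.mem_filter.2 ⟨(hi.1 k).2, (hi.1 k).1⟩⟩, minusCoeff_eq_factorMinus]
  have h₂ : ∀ k : βp, (if e' k = 1 ∧ a' k ∈ ((setA' a a' ((k : Fin m) : ℕ)).filter
      fun b : Fin (R + m) => (b : ℕ) ≤ R + (k : Fin m)) then
        (-1) ^ N * plusCoeff (K.det / k₁) η ξ x
        ((setA' a a' ((k : Fin m) : ℕ)).filter fun b : Fin (R + m) => (b : ℕ) ≤ R + (k : Fin m))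
        (Fin.natAdd R k) (a' k) else 0) = (-1) ^ N * factorPlus (K.det / k₁) η ξ x a a' k :=
    fun k => by
    rw [if_pos ⟨(Finset.mem_filter.1 (hβp k.2)).2,
      Finset.mem_filter.2 ⟨(hi.2 k).2, (hi.2 k).1⟩⟩, plusCoeff_eq_factorPlus]
  rw [Finset.prod_congr rfl fun k _ => h₁ k, Finset.prod_congr rfl fun k _ => h₂ k,
    Finset.prod_mul_distrib, Finset.prod_mul_distrib, Finset.prod_const, Finset.prod_const,
    Finset.card_univ, Finset.card_univ, Fintype.card_coe, Fintype.card_coe, pow_add]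
  ring

/-- The sum over sequences of removals, in terms of the index sets. -/
theorem sum_pathWeight (x : Fin (R + m) → ℂ) (e e' : Fin m → Fin 2)
    (F : Finset (Fin (R + m)) → ℂ) :
    ∑ g, pathWeight K k₁ η ξ x e e' le_rfl g * F (available g m) =
      ∑ βm ∈ (Finset.univ.filter fun j => e j = 0).powerset,
        ∑ βp ∈ (Finset.univ.filter fun j => e' j = 1).powerset,
          ((-1) ^ N) ^ (βm.card + βp.card) *
          (K 0 0 - k₁) ^ ((Finset.univ.filter fun j => e j = 0).card - βm.card) *
          (K 1 1 - K.det / k₁) ^ ((Finset.univ.filter fun j => e' j = 1).card - βp.card) *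
          ∑ p ∈ indexChoices R βm βp, (∏ j, factorMinus k₁ η ξ x p.1 p.2 j) *
            (∏ j, factorPlus (K.det / k₁) η ξ x p.1 p.2 j) * F (setA p.1 p.2 m) := by
  have h₀ : ∑ g, pathWeight K k₁ η ξ x e e' le_rfl g * F (available g m) =
      ∑ βm : Finset (Fin m), ∑ βp : Finset (Fin m),
        ∑ p : (βm → Fin (R + m)) × (βp → Fin (R + m)),
          pathWeight K k₁ η ξ x e e' le_rfl
            (fun k => (optionExtend βm p.1 k, optionExtend βp p.2 k)) * F (setA p.1 p.2 m) := by
    rw [← (Equiv.arrowProdEquivProdArrow (Fin m) (fun _ => Option (Fin (R + m)))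
      (fun _ => Option (Fin (R + m)))).symm.sum_comp, Fintype.sum_prod_type, sum_optionExtend]
    refine Finset.sum_congr rfl fun βm _ => ?_
    simp only [sum_optionExtend (ι := Fin m) (κ := Fin (R + m))]
    rw [Finset.sum_comm]
    refine Finset.sum_congr rfl fun βp _ => ?_
    rw [Fintype.sum_prod_type]
    refine Finset.sum_congr rfl fun a _ => Finset.sum_congr rfl fun a' _ => ?_
    rw [← available_optionExtend]
    rfl
  rw [h₀]
  refine (Finset.sum_subset (Finset.subset_univ _) fun βm _ hm => ?_).symm.trans
    (Finset.sum_congr rfl fun βm hm => ?_)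
  · refine Finset.sum_eq_zero fun βp _ => Finset.sum_eq_zero fun p _ => ?_
    rw [pathWeight_eq_zero, zero_mul]
    exact fun h => hm (Finset.mem_powerset.2 h.1)
  refine (Finset.sum_subset (Finset.subset_univ _) fun βp _ hp => ?_).symm.trans
    (Finset.sum_congr rfl fun βp hp => ?_)
  · refine Finset.sum_eq_zero fun p _ => ?_
    rw [pathWeight_eq_zero, zero_mul]
    exact fun h => hp (Finset.mem_powerset.2 h.2.1)
  rw [Finset.mul_sum]
  refine (Finset.sum_subset (Finset.subset_univ _) fun p _ hi => ?_).symm.trans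
    (Finset.sum_congr rfl fun p hi => ?_)
  · rw [pathWeight_eq_zero, zero_mul]
    exact fun h => hi h.2.2
  · rw [pathWeight_optionExtend x e e' (Finset.mem_powerset.1 hm) (Finset.mem_powerset.1 hp) hi]
    ring

/-- Admissible indices are distinct, which fixes the number of remaining indices. -/
theorem card_setA {a : βm → Fin (R + m)} {a' : βp → Fin (R + m)}
    (h : (a, a') ∈ indexChoices R βm βp) :
    (setA a a' m).card + βm.card + βp.card = R + m := by
  have hi := (Finset.mem_filter.1 h).2
  simp only [setA, setA', Finset.mem_filter, Finset.mem_univ, true_and] at hi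
  have ha : Function.Injective a := by
    intro i j hij
    by_contra hne
    rcases lt_or_gt_of_ne (fun h => hne (Subtype.ext (Fin.ext h)) :
      (((i : Fin m) : ℕ) ≠ ((j : Fin m) : ℕ))) with hlt | hlt
    · exact (hi.1 j).2.1 i hlt hij.symm
    · exact (hi.1 i).2.1 j hlt hij
  have ha' : Function.Injective a' := by
    intro i j hij
    by_contra hne
    rcases lt_or_gt_of_ne (fun h => hne (Subtype.ext (Fin.ext h)) :
      (((i : Fin m) : ℕ) ≠ ((j : Fin m) : ℕ))) with hlt | hlt
    · exact (hi.2 j).2.2 i hlt hij.symm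
    · exact (hi.2 i).2.2 j hlt hij
  have haa : ∀ i j, a i ≠ a' j := by
    intro i j hij
    rcases le_or_gt ((i : Fin m) : ℕ) ((j : Fin m) : ℕ) with hle | hlt
    · exact (hi.2 j).2.1 i hle hij.symm
    · exact (hi.1 i).2.2 j hlt hij
  have hset : setA a a' m = (Finset.univ.image a ∪ Finset.univ.image a')ᶜ := by
    ext b
    simp only [setA, Finset.mem_filter, Finset.mem_univ, true_and, Finset.mem_compl,
      Finset.mem_union, Finset.mem_image, not_or, not_exists]
    exact ⟨fun h => ⟨fun i e => h.1 i i.1.2 e.symm, fun i e => h.2 i i.1.2 e.symm⟩,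
      fun h => ⟨fun i _ e => h.1 i e.symm, fun i _ e => h.2 i e.symm⟩⟩
  have hdisj : Disjoint (Finset.univ.image a) (Finset.univ.image a') := by
    rw [Finset.disjoint_left]
    intro b hb hb'
    obtain ⟨i, -, rfl⟩ := Finset.mem_image.1 hb
    obtain ⟨j, -, hj⟩ := Finset.mem_image.1 hb'
    exact haa i j hj.symm
  have hcard := Finset.card_add_card_compl (Finset.univ.image a ∪ Finset.univ.image a')
  rw [← hset, Finset.card_union_of_disjoint hdisj, Finset.card_image_of_injective _ ha,
    Finset.card_image_of_injective _ ha', Finset.card_univ, Finset.card_univ, Fintype.card_coe,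
    Fintype.card_coe, Fintype.card_fin] at hcard
  omega

end Reindexing

/-! ### Matrix elements of products of elementary matrices -/

section ElementaryBlocks

variable {N m R : ℕ} {K : Matrix (Fin 2) (Fin 2) ℂ} {k₁ η : ℂ} {ξ : Fin N → ℂ}

theorem prod_zpow_eq_zpow_sum {ι : Type} {b : ℂ} (hb : b ≠ 0) (s : Finset ι) (f : ι → ℤ) :
    ∏ k ∈ s, b ^ f k = b ^ ∑ k ∈ s, f k := by
  classical
  induction s using Finset.induction_on with
  | empty => simp
  | insert a s ha ih => rw [Finset.prod_insert ha, Finset.sum_insert ha, zpow_add₀ hb, ih]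

theorem prod_siteCoeff {b : ℂ} (hb : b ≠ 0) (z : ℂ) (e e' : Fin m → Fin 2) :
    ∏ k, z * b ^ ((1 : ℤ) - (if e k = 0 then 1 else 0) - if e' k = 1 then 1 else 0) =
      z ^ m * b ^ ((m : ℤ) - (Finset.univ.filter fun j => e j = 0).card -
        (Finset.univ.filter fun j => e' j = 1).card) := by
  rw [Finset.prod_mul_distrib, prod_zpow_eq_zpow_sum hb, Finset.sum_sub_distrib,
    Finset.sum_sub_distrib, Finset.sum_boole, Finset.sum_boole]
  simp

theorem transferProd_mulVec {hm : m ≤ N} {v : Spins N → ℂ} {t : ℂ → ℂ}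
    (hv : ∀ l, (transfer K η ξ l).mulVec v = t l • v) :
    (transferProd K η ξ hm).mulVec v = (∏ k : Fin m, t (ξ (Fin.castLE hm k))) • v := by
  induction m with
  | zero => simp [transferProd]
  | succ m ih =>
    rw [transferProd_succ, ← Matrix.mulVec_mulVec, hv, Matrix.mulVec_smul, ih, smul_smul,
      Fin.prod_univ_castSucc, mul_comm]
    rfl

theorem rootPoly_qExt (hm : m ≤ N) (q : Fin R → ℂ) :
    rootPoly (qExt hm ξ q) (Finset.univ.filter fun b : Fin (R + m) => (b : ℕ) < R) =
      rootPoly q Finset.univ := by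
  rw [rootPoly, Finset.prod_filter, Fin.prod_univ_add, rootPoly]
  simp [qExt]

theorem qExt_injective (hm : m ≤ N) {q : Fin R → ℂ} (hq : Function.Injective q)
    (hξ : Function.Injective ξ) (hqξ : ∀ j n, q j ≠ ξ n) : Function.Injective (qExt hm ξ q) :=
  Fin.append_injective_iff.2 ⟨hq, hξ.comp (Fin.castLE_injective hm), fun _ _ => hqξ _ _⟩

/-- Replacing m + b by m - b changes the exponent by an even number. This merges the sign (-1)^N of
each site with that of each removal. -/
theorem neg_one_pow_mul {b p : ℕ} (hb : b ≤ m) :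
    ((-1 : ℂ) ^ N) ^ m * ((-1) ^ N) ^ (b + p) = (-1) ^ ((m - b + p) * N) := by
  have h : ((-1 : ℂ) ^ N) ^ (2 * b) = 1 := by
    rw [← pow_mul, show N * (2 * b) = 2 * (N * b) by ring, pow_mul, neg_one_sq, one_pow]
  rw [mul_comm (m - b + p), pow_mul, ← pow_add, show m + (b + p) = 2 * b + (m - b + p) by omega,
    pow_add, h, one_mul]

/-- The matrix elements of products of elementary matrices between separate eigenstates. -/
theorem Generic.matrixElement_elemProduct (H : Generic K k₁ η ξ) (hb : K 0 1 ≠ 0) (hm : m ≤ N)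
    {q : Fin R → ℂ} (hx : Function.Injective (qExt hm ξ q)) {v : Spins N → ℂ} {t : ℂ → ℂ}
    (hv : ∀ l, (transfer K η ξ l).mulVec v = t l • v) (ε : Fin (2 * m) → Fin 2) :
    (∏ k : Fin m, t (ξ (Fin.castLE hm k))) *
        (Matrix.vecMul (leftState K k₁ η ξ (rootPoly q Finset.univ)) (elemProduct hm ε) ⬝ᵥ v) =
      K 0 1 ^ ((m : ℤ) - (alphaMinus ε).card - (alphaPlus ε).card) *
        ∑ βm ∈ (alphaMinus ε).powerset, ∑ βp ∈ (alphaPlus ε).powerset,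
          (-1 : ℂ) ^ ((m - βm.card + βp.card) * N) *
          (K 0 0 - k₁) ^ ((alphaMinus ε).card - βm.card) *
          (K 1 1 - K.det / k₁) ^ ((alphaPlus ε).card - βp.card) *
          ∑ p ∈ indexChoices R βm βp,
            (∏ j, factorMinus k₁ η ξ (qExt hm ξ q) p.1 p.2 j) *
            (∏ j, factorPlus (K.det / k₁) η ξ (qExt hm ξ q) p.1 p.2 j) *
            (leftState K k₁ η ξ (rootPoly (qExt hm ξ q) (setA p.1 p.2 m)) ⬝ᵥ v) := by
  have h₁ : (∏ k : Fin m, t (ξ (Fin.castLE hm k))) *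
      (Matrix.vecMul (leftState K k₁ η ξ (rootPoly q Finset.univ)) (elemProduct hm ε) ⬝ᵥ v) =
      Matrix.vecMul (leftState K k₁ η ξ (rootPoly q Finset.univ)) (List.ofFn fun k : Fin m =>
        twistedMonodromy K η ξ (ξ (Fin.castLE hm k)) (epsEven ε k) (epsOdd ε k)).prod ⬝ᵥ v := by
    -- The transfer matrices stand to the right of the elementary matrices, so they act on the
    -- eigenvector v and no inverse of them is required.
    rw [← prod_unitOp_mul_transferProd K η ξ hm, ← Matrix.vecMul_vecMul,
      ← Matrix.dotProduct_mulVec _ (transferProd K η ξ hm), transferProd_mulVec hv,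
      dotProduct_smul, smul_eq_mul]
    rfl
  have h₂ := H.leftState_vecMul_prod hb hx hm (fun k => by simp [qExt]) (epsOdd ε) (epsEven ε)
    le_rfl
  simp only [rootPoly_qExt, Fin.castLE_rfl, id_eq] at h₂
  have h₃ : ∀ S : Finset (Fin (R + m)), (S.filter fun b : Fin (R + m) => (b : ℕ) < R + m) = S :=
    fun S => Finset.filter_true_of_mem fun b _ => b.2
  simp only [h₃] at h₂
  rw [h₁, h₂, smul_dotProduct, sum_dotProduct]
  simp only [smul_dotProduct, smul_eq_mul]
  rw [sum_pathWeight (qExt hm ξ q) (epsOdd ε) (epsEven ε)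
    fun S => leftState K k₁ η ξ (rootPoly (qExt hm ξ q) S) ⬝ᵥ v, prod_siteCoeff hb,
    mul_comm (((-1 : ℂ) ^ N) ^ m), mul_assoc]
  congr 1
  rw [Finset.mul_sum]
  refine Finset.sum_congr rfl fun βm _ => ?_
  rw [Finset.mul_sum]
  refine Finset.sum_congr rfl fun βp _ => ?_
  rw [← neg_one_pow_mul (N := N) (p := βp.card)
    ((Finset.card_le_univ βm).trans_eq (Fintype.card_fin m)), alphaMinus, alphaPlus]
  ring

end ElementaryBlocks

end XXX

end

/-! ### The formula for the elementary blocks -/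

theorem mainTheorem11
    {N m R : ℕ} (hm : m ≤ N) (hR : R ≤ N)
    (η : ℂ) (hη : η ≠ 0)
    (ξ : Fin N → ℂ)
    (hξ : ∀ i j, i ≠ j → ξ i ≠ ξ j ∧ ξ i ≠ ξ j + η ∧ ξ i ≠ ξ j - η)
    (K : Matrix (Fin 2) (Fin 2) ℂ) (hK : K.det ≠ 0) (hb : K 0 1 ≠ 0)
    (k₁ k₂ : ℂ) (hk₁ : k₁ ^ 2 - k₁ * K.trace + K.det = 0) (hk₂ : k₂ = K.det / k₁)
    (q : Fin R → ℂ) (hq : Function.Injective q) (hqξ : ∀ j n, q j ≠ ξ n)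
    (τ Q : Polynomial ℂ) (hQ : Q = XXX.rootPoly q Finset.univ)
    (hTQ : ∀ l : ℂ, τ.eval l * Q.eval l =
      k₂ * XXX.aFun η ξ l * Q.eval (l - η) + k₁ * XXX.dFun ξ l * Q.eval (l + η))
    (ε : Fin (2 * m) → Fin 2) :
    (XXX.elemBlock hm K k₁ η ξ Q ε =
      (K 0 1) ^ ((m : ℤ) - (XXX.alphaMinus ε).card - (XXX.alphaPlus ε).card) /
          (∏ k : Fin m, τ.eval (ξ (Fin.castLE hm k))) *
        ∑ βm ∈ (XXX.alphaMinus ε).powerset, ∑ βp ∈ (XXX.alphaPlus ε).powerset,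
          (-1 : ℂ) ^ ((m - βm.card + βp.card) * N) *
          (K 0 0 - k₁) ^ ((XXX.alphaMinus ε).card - βm.card) *
          (K 1 1 - k₂) ^ ((XXX.alphaPlus ε).card - βp.card) *
          ∑ p ∈ XXX.indexChoices R βm βp,
            (∏ j, XXX.factorMinus k₁ η ξ (XXX.qExt hm ξ q) p.1 p.2 j) *
            (∏ j, XXX.factorPlus k₂ η ξ (XXX.qExt hm ξ q) p.1 p.2 j) *
            (XXX.scalarProduct K k₁ η ξ
                (XXX.rootPoly (XXX.qExt hm ξ q) (XXX.setA p.1 p.2 m)) Q /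
              XXX.scalarProduct K k₁ η ξ Q Q)) ∧
    (∀ βm ∈ (XXX.alphaMinus ε).powerset, ∀ βp ∈ (XXX.alphaPlus ε).powerset,
      ∀ p ∈ XXX.indexChoices R βm βp,
        (XXX.rootPoly (XXX.qExt hm ξ q) (XXX.setA p.1 p.2 m)).natDegree + βm.card + βp.card =
          R + m) := by
  -- For k₁ = 0 the characteristic equation would read det K = 0.
  have hk₁0 : k₁ ≠ 0 := by
    rintro rfl
    exact hK (by simpa using hk₁)
  have H : XXX.Generic K k₁ η ξ := ⟨hη, hξ, hK, hk₁0⟩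
  have hξi : Function.Injective ξ := fun i j hij => by
    by_contra hne
    exact (hξ i j hne).1 hij
  subst hQ hk₂
  have htr : k₁ + K.det / k₁ = K.trace := by
    field_simp
    linear_combination hk₁
  have hv := H.transfer_mulVec_rightState (XXX.rootPoly_monic q Finset.univ) htr hTQ
  refine ⟨?_, fun βm _ βp _ p hp => ?_⟩
  · have hτ : ∏ k : Fin m, τ.eval (ξ (Fin.castLE hm k)) ≠ 0 :=
      Finset.prod_ne_zero_iff.2 fun k _ => H.eval_xi_ne_zero hTQ _ (by
        rw [XXX.eval_rootPoly]
        exact Finset.prod_ne_zero_iff.2 fun j _ => sub_ne_zero.2 (hqξ j _).symm)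
    have key := H.matrixElement_elemProduct hb hm (XXX.qExt_injective hm hq hξi hqξ) hv ε
    -- Only the product of the τ(ξ_k) has to be cleared. The norm ⟨Q|Q⟩ remains a common divisor of
    -- both sides, so with division by zero equal to zero its vanishing causes no exception.
    rw [XXX.elemBlock, div_mul_eq_mul_div, eq_div_iff hτ, mul_comm, ← mul_div_assoc, key,
      mul_div_assoc]
    congr 1
    simp only [Finset.sum_div, mul_div_assoc]
    rfl
  · rw [XXX.natDegree_rootPoly, XXX.card_setA hp]
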